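/- **Setting.** Let $d\ge 1$, $\Omega=[0,1)^d$, $\widetilde\Omega=[-\pi,\pi)^d$, and let $N\ge 1$ be an integer and $\alpha$ a real number with $2-\frac1N<\alpha<2$. Let $\mu\in L_\infty(\mathbb R^d\times\mathbb R^d)$ satisfy $$0<\mu_-\le\mu(x,y)\le\mu_+<\infty,\qquad \mu(x,y)=\mu(y,x),\qquad \mu(x+m,y+n)=\mu(x,y)\quad(m,n\in\mathbb Z^d).$$ Functions on $\Omega$ are extended $\mathbb Z^d$-periodically to $\mathbb R^d$. Let $\widetilde H^{\alpha/2}(\Omega)$ be the space of $u\in L_2(\Omega)$ whose periodic extension lies in $H^{\alpha/2}_{\rm loc}(\mathbb R^d)$. For $\xi\in\widetilde\Omega$ let $\mathbb A(\xi)=\mathbb A(\xi;\alpha,\mu)$ be the self-adjoint operator in $L_2(\Omega)$ generated by the closed form $$a(\xi)[u,u]=\frac12\int_{\mathbb R^d}dy\int_\Omega dx\,\mu(x,y)\frac{|e^{i\langle\xi,x\rangle}u(x)-e^{i\langle\xi,y\rangle}u(y)|^2}{|x-y|^{d+\alpha}},\qquad u\in\widetilde H^{\alpha/2}(\Omega).$$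 Put $\mu^0=\int_\Omega\int_\Omega\mu(x,y)\,dx\,dy$, $\mathbb A^0(\xi)=\mathbb A(\xi;\alpha,\mu^0)$ (the same operator with the constant coefficient $\mu^0$), and $\mu_*(z)=\int_\Omega\mu(x,z+x)\,dx-\mu^0$. For $k=1,\dots,d$ let $v_k\in\widetilde H^{\alpha/2}(\Omega)$, $\int_\Omega v_k\,dx=0$, be the solution of $$\int_{\mathbb R^d}dy\int_\Omega dx\,\frac{\mu(x,y)}{|x-y|^{d+\alpha}}\bigl(v_k(x)-v_k(y)+x_k-y_k\bigr)\overline{(\eta(x)-\eta(y))}=0\qquad\text{for all }\eta\in\widetilde H^{\alpha/2}(\Omega),$$ and let $g^0=(g^0_{jk})$ be the real symmetric matrix $$g^0_{jk}=\frac14\int_{\mathbb R^d}dy\int_\Omega dx\,\frac{\mu(x,y)}{|x-y|^{d+\alpha}}\bigl((x_j-y_j)(v_k(x)-v_k(y))+(x_k-y_k)(v_j(x)-v_j(y))\bigr)+\sum_{n\in\mathbb Z^d}\int_{\Omega+n}\frac{\mu_*(z)z_jz_k}{2|z|^{d+\alpha}}\,dz.$$ With $D=-i\nabla$ (periodic boundary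 conditions), define for $\varepsilon>0$ and $m=1,\dots,N$ the bounded operators in $L_2(\Omega)$ $$\mathbb K_m(\xi,\varepsilon)=(-1)^m\bigl((D+\xi)^*g^0(D+\xi)\bigr)^m(\mathbb A^0(\xi)+\varepsilon^\alpha I)^{-m-1}.$$ **Theorem.** These objects are well defined, and there is a constant $C$ depending only on $d,\alpha,\mu_-,\mu_+$ and $N$ such that for all $\varepsilon>0$ and $\xi\in\widetilde\Omega$ $$\Bigl\|(\mathbb A(\xi)+\varepsilon^\alpha I)^{-1}-(\mathbb A^0(\xi)+\varepsilon^\alpha I)^{-1}-\sum_{m=1}^N\mathbb K_m(\xi,\varepsilon)\Bigr\|_{L_2(\Omega)\to L_2(\Omega)}\le C\begin{cases}\varepsilon^{1-\alpha},& 2-\frac1N<\alpha\le 2-\frac1{N+1},\\ \varepsilon^{(N+1)(2-\alpha)-\alpha},& 2-\frac1{N+1}<\alpha<2.\end{cases}$$ -/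

import Mathlib

open MeasureTheory Set
open scoped ContDiff ComplexConjugate

noncomputable section

namespace LevyHomog

/-- `ℝ^d` with the Euclidean norm. -/
abbrev E (d : ℕ) : Type := EuclideanSpace ℝ (Fin d)

/-- The vector of `ℝ^d` with integer coordinates `n`. -/
def latticeVec {d : ℕ} (n : Fin d → ℤ) : E d := WithLp.toLp 2 fun i => (n i : ℝ)

/-- The shifted cell `Ω + n`, where `Ω = [0,1)^d` and `n ∈ ℤ^d`. -/
def shiftedCell {d : ℕ} (n : Fin d → ℤ) : Set (E d) :=
  {x | ∀ i, x i ∈ Ico (n i : ℝ) (n i + 1)}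

/-- The periodicity cell `Ω = [0,1)^d` of the lattice `ℤ^d`. -/
def cell (d : ℕ) : Set (E d) := {x | ∀ i, x i ∈ Ico (0 : ℝ) 1}

/-- The dual cell `[-π,π)^d`. -/
def dualCell (d : ℕ) : Set (E d) := {ξ | ∀ i, ξ i ∈ Ico (-Real.pi) Real.pi}

/-- The complex Hilbert space `L₂(Ω)`. -/
abbrev L2 (d : ℕ) : Type := Lp ℂ 2 ((volume : Measure (E d)).restrict (cell d))

/-- The `ℤ^d`-periodic extension to `ℝ^d` of a function given on `Ω`. -/
def perExt {d : ℕ} (u : E d → ℂ) (x : E d) : ℂ := u (WithLp.toLp 2 fun i => Int.fract (x i))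

/-- The product measure `dx dy` on `Ω × ℝ^d`. -/
def cellProd (d : ℕ) : Measure (E d × E d) :=
  ((volume : Measure (E d)).restrict (cell d)).prod volume

/-- The conditions on the coefficient: `μ` is a (class of a) bounded measurable function on
`ℝ^d × ℝ^d` with `μ₋ ≤ μ ≤ μ₊`, symmetric, and `ℤ^d`-periodic in each variable. -/
structure IsCoefficient {d : ℕ} (μm μp : ℝ) (μ : E d → E d → ℝ) : Prop where
  aemeasurable : AEMeasurable (fun p : E d × E d => μ p.1 p.2) volume
  bounds : ∀ᵐ p : E d × E d, μm ≤ μ p.1 p.2 ∧ μ p.1 p.2 ≤ μp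
  symm : ∀ᵐ p : E d × E d, μ p.1 p.2 = μ p.2 p.1
  periodic : ∀ m n : Fin d → ℤ, ∀ᵐ p : E d × E d,
    μ (p.1 + latticeVec m) (p.2 + latticeVec n) = μ p.1 p.2

/-- The space `H̃^s(Ω)`, `0 < s < 1`: functions `u ∈ L₂(Ω)` whose periodic extension belongs to
`H^s_loc(ℝ^d)`, i.e. has a finite Gagliardo–Slobodeckij seminorm of order `s` on every ball. -/
def MemHper {d : ℕ} (s : ℝ) (u : L2 d) : Prop :=
  ∀ r : ℝ, ∫⁻ p in Metric.ball (0 : E d) r ×ˢ Metric.ball (0 : E d) r,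
    ENNReal.ofReal (‖perExt u p.1 - perExt u p.2‖ ^ 2 / ‖p.1 - p.2‖ ^ ((d : ℝ) + 2 * s)) < ⊤

/-- The plane wave factor `e^{i⟨ξ,x⟩}`. -/
def phase {d : ℕ} (ξ x : E d) : ℂ := Complex.exp (Complex.I * (inner ℝ ξ x : ℝ))

/-- The sesquilinear form `a(ξ;α,μ)[u,v]` (linear in `u`) of the quadratic form
`½ ∫_{ℝ^d} dy ∫_Ω dx μ(x,y) |e^{i⟨ξ,x⟩} u(x) - e^{i⟨ξ,y⟩} u(y)|² / |x-y|^{d+α}`. -/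
def levyForm {d : ℕ} (α : ℝ) (μ : E d → E d → ℝ) (ξ : E d) (u v : L2 d) : ℂ :=
  (1 / 2 : ℂ) * ∫ p : E d × E d,
    ((μ p.1 p.2 / ‖p.1 - p.2‖ ^ ((d : ℝ) + α) : ℝ) : ℂ) *
      ((phase ξ p.1 * perExt u p.1 - phase ξ p.2 * perExt u p.2) *
        conj (phase ξ p.1 * perExt v p.1 - phase ξ p.2 * perExt v p.2)) ∂(cellProd d)

/-- The graph of the operator `𝔸(ξ;α,μ)` generated in `L₂(Ω)` by the form `a(ξ;α,μ)` with form
domain `H̃^{α/2}(Ω)`: `u` is in the domain and `𝔸(ξ) u = f` iff `u` is in the form domain and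
`a(ξ)[u,v] = (f,v)` for every `v` in the form domain. -/
def levyOp {d : ℕ} (α : ℝ) (μ : E d → E d → ℝ) (ξ : E d) : Set (L2 d × L2 d) :=
  {q | MemHper (α / 2) q.1 ∧
    ∀ v : L2 d, MemHper (α / 2) v → levyForm α μ ξ q.1 v = inner ℂ v q.2}

/-- `R = (A + κ I)⁻¹` for the operator with graph `A`: for all `f, u` one has `R f = u` iff
`u ∈ Dom A` and `A u + κ u = f`. -/
def IsResolvent {d : ℕ} (A : Set (L2 d × L2 d)) (κ : ℝ) (R : L2 d →L[ℂ] L2 d) : Prop :=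
  ∀ f u : L2 d, R f = u ↔ (u, f - (κ : ℂ) • u) ∈ A

/-- The mean value `μ⁰ = ∫_Ω ∫_Ω μ(x,y) dx dy`. -/
def meanCoeff {d : ℕ} (μ : E d → E d → ℝ) : ℝ :=
  ∫ p in cell d ×ˢ cell d, μ p.1 p.2

/-- `μ_*(z) = ∫_Ω μ(x, z + x) dx - μ⁰`. -/
def muStar {d : ℕ} (μ : E d → E d → ℝ) (z : E d) : ℝ :=
  (∫ x in cell d, μ x (z + x)) - meanCoeff μ

/-- The auxiliary problem for `v_k`: `v_k ∈ H̃^{α/2}(Ω)`, `∫_Ω v_k = 0`, and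
`∫_{ℝ^d} dy ∫_Ω dx μ(x,y) |x-y|^{-d-α} (v_k(x) - v_k(y) + x_k - y_k) conj(η(x) - η(y)) = 0`
for all `η ∈ H̃^{α/2}(Ω)`. -/
def IsCellSolution {d : ℕ} (α : ℝ) (μ : E d → E d → ℝ) (k : Fin d) (v : L2 d) : Prop :=
  MemHper (α / 2) v ∧ (∫ x in cell d, v x) = 0 ∧
    ∀ η : L2 d, MemHper (α / 2) η →
      ∫ p : E d × E d, ((μ p.1 p.2 / ‖p.1 - p.2‖ ^ ((d : ℝ) + α) : ℝ) : ℂ) *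
        ((perExt v p.1 - perExt v p.2 + ((p.1 k - p.2 k : ℝ) : ℂ)) *
          conj (perExt η p.1 - perExt η p.2)) ∂(cellProd d) = 0

/-- The matrix `g⁰` built from the solutions `v_1, …, v_d` of the auxiliary problems. The solutions
are real-valued, as `μ` is; `re` only turns them into real numbers. The integral of `μ_*` over `ℝ^d`
is the sum of the integrals over the cells `Ω + n`. -/
def effMatrix {d : ℕ} (α : ℝ) (μ : E d → E d → ℝ) (v : Fin d → L2 d) (j k : Fin d) : ℝ :=
  (1 / 4) * (∫ p : E d × E d, μ p.1 p.2 / ‖p.1 - p.2‖ ^ ((d : ℝ) + α) *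
      ((p.1 j - p.2 j) * (perExt (v k) p.1 - perExt (v k) p.2).re +
        (p.1 k - p.2 k) * (perExt (v j) p.1 - perExt (v j) p.2).re) ∂(cellProd d)) +
    ∑' n : Fin d → ℤ, ∫ z in shiftedCell n,
      muStar μ z * z j * z k / (2 * ‖z‖ ^ ((d : ℝ) + α))

/-- `((D_j + ξ_j) φ)(x)` with `D_j = -i ∂_j`. -/
def shiftedD {d : ℕ} (ξ : E d) (j : Fin d) (φ : E d → ℂ) (x : E d) : ℂ :=
  -Complex.I * fderiv ℝ φ x (EuclideanSpace.single j (1 : ℝ)) + (ξ j : ℂ) * φ x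

/-- `(D+ξ)^* g (D+ξ) φ = ∑_{j,k} g_{jk} (D_j+ξ_j)(D_k+ξ_k) φ` for a smooth function `φ`. -/
def diffExpr {d : ℕ} (g : Fin d → Fin d → ℝ) (ξ : E d) (φ : E d → ℂ) (x : E d) : ℂ :=
  ∑ j, ∑ k, (g j k : ℂ) * shiftedD ξ j (shiftedD ξ k φ) x

/-- The graph of `(D+ξ)^* g (D+ξ)` (`g` real and symmetric) in `L₂(Ω)` with periodic boundary
conditions, on its maximal domain: the expression is applied to `u` in the weak sense, against
smooth `ℤ^d`-periodic test functions. -/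
def diffOp {d : ℕ} (g : Fin d → Fin d → ℝ) (ξ : E d) : Set (L2 d × L2 d) :=
  {q | ∀ φ : E d → ℂ, ContDiff ℝ ∞ φ → (∀ (n : Fin d → ℤ) (x : E d), φ (x + latticeVec n) = φ x) →
    ∫ x in cell d, q.1 x * conj (diffExpr g ξ φ x) = ∫ x in cell d, q.2 x * conj (φ x)}

/-- The graph of the `m`-th power of the operator with graph `G`. -/
def graphPow {H : Type*} (G : Set (H × H)) : ℕ → Set (H × H)
  | 0 => {q | q.1 = q.2}
  | m + 1 => {q | ∃ w, (q.1, w) ∈ graphPow G m ∧ (w, q.2) ∈ G}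

/-- `K = (-1)^m B^m R₀^{m+1}`, an everywhere defined bounded operator, where `B` is the operator
with graph `G`. -/
def IsCorrector {d : ℕ} (G : Set (L2 d × L2 d)) (R₀ : L2 d →L[ℂ] L2 d) (m : ℕ)
    (K : L2 d →L[ℂ] L2 d) : Prop :=
  ∀ f : L2 d, ∃ w : L2 d, ((R₀ ^ (m + 1)) f, w) ∈ graphPow G m ∧ K f = ((-1 : ℂ) ^ m) • w

/-- The right-hand side of the estimate (without the constant). -/
def rate (N : ℕ) (α ε : ℝ) : ℝ :=
  if α ≤ 2 - 1 / ((N : ℝ) + 1) then ε ^ (1 - α) else ε ^ (((N : ℝ) + 1) * (2 - α) - α)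

end LevyHomog

end

/-!
# Higher order approximation of the resolvent of a nonlocal operator

In the coordinates `(x, z) = (x, y - x)` the form `a(ξ)[u,v]` is the inner product of the twisted
differences `𝒟_ξ u = u(x) - e^{i⟨ξ,z⟩} u(x+z)` in `L₂` of the measure `μ(x,x+z)|z|^{-d-α} dx dz / 2`
(`fmap`, `levyForm_eq_inner`). For a constant coefficient it is diagonal in the Fourier basis, with
the symbol `symb k`, which is comparable to `|k|^α` (`symb_le`, `exists_symb_ge`). In particular
the form is bounded below on functions of mean value zero, uniformly in `ξ` (`exists_poincare`), and
`(𝔸⁰(ξ) + ε^α)⁻¹` and the correctors are Fourier multipliers (`IsResolvent.fc_const`,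
`IsCorrector.fc_eq`). No spectral theory is needed: everything reduces to an equation for the mean
value of `u = (𝔸(ξ) + ε^α)⁻¹ f`.

Let `w = ∑ ξ_k v_k` be the combination of the solutions of the auxiliary problems. The identity
`(1 - e^{-it})(a - e^{it} b) = i t (a - b) + O(min(|t|, t²)) (|a| + |b|)` with `t = ⟨ξ,z⟩` shows that
`⟨𝒟_ξ 1, 𝒟_ξ η⟩` agrees with `i ⟨𝒟_0 w, 𝒟_0 η⟩` up to `O(|ξ|^α ‖η‖)`
(`norm_inner_fmap_one_sub_le`; the factor `min(|t|, t²)` is integrable against `|z|^{-d-α}` as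
`1 < α < 2`). Hence the corrected constant `1 + i w` is almost orthogonal to the functions of mean
value zero (`norm_inner_fmap_corrected_le`), and its product with the constant is
`⟨𝒟_ξ 1, 𝒟_ξ (1 + i w)⟩ = λ⁰(ξ) + ⟨g⁰ ξ, ξ⟩ + O(|ξ|^{1+α})` (`norm_inner_one_corrected_sub_le`), where
`λ⁰` is the symbol of `𝔸⁰(ξ)`. Here the first term of `g⁰` has the quadratic form `-‖𝒟_0 w‖²`
(`exists_cell_combination`). The second one comes from `‖𝒟_ξ 1‖² - λ⁰(ξ) = ∫ μ_*(z) (1 - cos⟨ξ,z⟩)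
|z|^{-d-α} dz` by the second order Taylor expansion of the cosine (`CoeffData.expansion`): since `μ_*`
has mean value zero over each cell, the remainder may be differentiated once more before it is
integrated (`lattice_sum_bound`).

Testing the equation for `u` with its part of mean value zero, and then with the constant `1`, one
finds that the mean value `c` of `u` satisfies `(λ⁰(ξ) + ⟨g⁰ ξ, ξ⟩ + ε^α) c = f̂(0) + O(|ξ|) ‖f‖`, and
that `u - c` is bounded by `‖f‖` up to a similar error (`resolvent_mean`). The sum of
`(𝔸⁰(ξ) + ε^α)⁻¹` and of the correctors is the partial sum of the Neumann series for this equation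
(`fc_add_sum_correctors`), whose remainder is of the order
`|ξ|^{(N+1)(2-α)} / (|ξ|^α + ε^α)`. The error `O(|ξ|)` contributes `|ξ| / (|ξ|^α + ε^α)`, and the
Fourier modes other than the zeroth one, where `|ξ + 2πn| ≥ π`, are of no greater order. With
`σ = min(1, (N+1)(2-α))` all of this is bounded by a multiple of `ε^{σ-α}`, which is the rate in the
theorem (`rpow_le_mul_add`, `exists_norm_sub_le`).
-/

noncomputable section

namespace LevyHomog

open Filter Topology
open scoped ENNReal NNReal Pointwise

variable {d : ℕ}

/-! ### The periodicity cell -/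

/-- The representative in the cell `Ω` of the class of `x` modulo `ℤ^d`. -/
def fractE (x : E d) : E d := WithLp.toLp 2 fun i => Int.fract (x i)

/-- Lebesgue measure on the cell `Ω`. -/
abbrev cm (d : ℕ) : Measure (E d) := (volume : Measure (E d)).restrict (cell d)

@[simp] lemma fractE_apply (x : E d) (i : Fin d) : fractE x i = Int.fract (x i) := rfl

@[simp] lemma latticeVec_apply (n : Fin d → ℤ) (i : Fin d) : latticeVec n i = (n i : ℝ) := rfl

lemma norm_le_sum_norm_apply (x : E d) : ‖x‖ ≤ ∑ i, ‖x i‖ := by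
  rw [EuclideanSpace.norm_eq]
  refine Real.sqrt_le_iff.2 ⟨Finset.sum_nonneg fun i _ => norm_nonneg _, ?_⟩
  exact Finset.sum_sq_le_sq_sum_of_nonneg fun i _ => norm_nonneg _

lemma perExt_eq (u : E d → ℂ) (x : E d) : perExt u x = u (fractE x) := rfl

@[fun_prop]
lemma measurable_fractE : Measurable (fractE (d := d)) := by
  unfold fractE
  refine (WithLp.measurable_toLp 2 _).comp (measurable_pi_lambda _ fun i => ?_)
  exact measurable_fract.comp (by fun_prop)

lemma fractE_mem_cell (x : E d) : fractE x ∈ cell d :=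
  fun _ => ⟨Int.fract_nonneg _, Int.fract_lt_one _⟩

lemma fractE_of_mem {x : E d} (hx : x ∈ cell d) : fractE x = x := by
  ext i
  exact Int.fract_eq_self.2 (hx i)

@[simp] lemma fractE_add_latticeVec (x : E d) (n : Fin d → ℤ) :
    fractE (x + latticeVec n) = fractE x := by
  ext i
  simp

lemma exists_fractE_eq (x : E d) : ∃ n : Fin d → ℤ, x = fractE x + latticeVec n :=
  ⟨fun i => ⌊x i⌋, by ext i; simp⟩

lemma perExt_add_latticeVec (u : E d → ℂ) (x : E d) (n : Fin d → ℤ) :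
    perExt u (x + latticeVec n) = perExt u x := by simp [perExt_eq]

lemma measurableSet_shiftedCell (n : Fin d → ℤ) : MeasurableSet (shiftedCell n) := by
  have : shiftedCell n = ⋂ i, (fun x : E d => x i) ⁻¹' Ico (n i : ℝ) (n i + 1) := by
    ext x; simp [shiftedCell]
  rw [this]
  exact MeasurableSet.iInter fun i => measurableSet_Ico.preimage (by fun_prop)

lemma cell_eq_shiftedCell : cell d = shiftedCell 0 := by ext; simp [cell, shiftedCell]

lemma measurableSet_cell : MeasurableSet (cell d) :=
  cell_eq_shiftedCell ▸ measurableSet_shiftedCell 0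

lemma shiftedCell_eq_preimage (n : Fin d → ℤ) :
    shiftedCell n = (fun x : E d => x + latticeVec (-n)) ⁻¹' cell d := by
  ext x
  simp only [shiftedCell, cell, mem_Ico, mem_ofPred_eq, mem_preimage, PiLp.add_apply,
    latticeVec_apply, Pi.neg_apply, Int.cast_neg]
  refine forall_congr' fun i => ⟨fun h => ⟨?_, ?_⟩, fun h => ⟨?_, ?_⟩⟩ <;> linarith [h.1, h.2]

lemma iUnion_shiftedCell : ⋃ n, shiftedCell (d := d) n = univ := by
  refine eq_univ_of_forall fun x => mem_iUnion.2 ⟨fun i => ⌊x i⌋, fun i => ⟨Int.floor_le _, ?_⟩⟩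
  exact Int.lt_floor_add_one _

lemma pairwise_disjoint_shiftedCell :
    Pairwise (Function.onFun Disjoint (shiftedCell (d := d))) := by
  intro m n hmn
  refine Set.disjoint_left.2 fun x hm hn => hmn (funext fun i => ?_)
  rw [← Int.floor_eq_iff.2 ⟨(hm i).1, (hm i).2⟩, Int.floor_eq_iff.2 ⟨(hn i).1, (hn i).2⟩]

lemma volume_cell : (volume : Measure (E d)) (cell d) = 1 := by
  have h := (EuclideanSpace.volume_preserving_symm_measurableEquiv_toLp (Fin d)).symm
  have hc : cell d = (MeasurableEquiv.toLp 2 (Fin d → ℝ)).symm ⁻¹'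
      (Set.pi univ fun _ => Ico (0 : ℝ) 1) := by
    ext x; simp [cell, Set.mem_pi]
  rw [hc, (EuclideanSpace.volume_preserving_symm_measurableEquiv_toLp (Fin d)).measure_preimage_equiv,
    Real.volume_pi_Ico]
  simp

instance : IsProbabilityMeasure (cm d) :=
  ⟨by rw [Measure.restrict_apply_univ, volume_cell]⟩

lemma volume_shiftedCell (n : Fin d → ℤ) : (volume : Measure (E d)) (shiftedCell n) = 1 := by
  rw [shiftedCell_eq_preimage, measure_preimage_add_right, volume_cell]

lemma lintegral_shiftedCell (f : E d → ℝ≥0∞) (n : Fin d → ℤ) :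
    ∫⁻ x in shiftedCell n, f x = ∫⁻ x in cell d, f (x + latticeVec n) := by
  have h := (measurePreserving_add_right (volume : Measure (E d)) (latticeVec n))
  have h2 := h.setLIntegral_comp_preimage_emb (MeasurableEquiv.addRight _).measurableEmbedding f
    (shiftedCell n)
  rw [← h2]
  congr 2
  rw [shiftedCell_eq_preimage]
  ext x
  simp only [mem_preimage]
  congr! 1
  ext i; simp

lemma lintegral_eq_tsum_shiftedCell (f : E d → ℝ≥0∞) :
    ∫⁻ x, f x = ∑' n : Fin d → ℤ, ∫⁻ x in shiftedCell n, f x := by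
  rw [← lintegral_iUnion measurableSet_shiftedCell pairwise_disjoint_shiftedCell,
    iUnion_shiftedCell, Measure.restrict_univ]

lemma isAddFundamentalDomain_cell :
    IsAddFundamentalDomain
      (Submodule.span ℤ (Set.range (EuclideanSpace.basisFun (Fin d) ℝ).toBasis)).toAddSubgroup
      (cell d)
      (volume : Measure (E d)) := by
  have h := ZSpan.isAddFundamentalDomain' (EuclideanSpace.basisFun (Fin d) ℝ).toBasis
    (volume : Measure (E d))
  convert h using 1
  ext x
  simp [cell, ZSpan.mem_fundamentalDomain]

lemma exists_latticeVec_of_mem_span {g : E d}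
    (hg : g ∈ Submodule.span ℤ (Set.range (EuclideanSpace.basisFun (Fin d) ℝ).toBasis)) :
    ∃ n : Fin d → ℤ, g = latticeVec n := by
  have h := (Module.Basis.mem_span_iff_repr_mem ℤ (EuclideanSpace.basisFun (Fin d) ℝ).toBasis g).1 hg
  choose n hn using h
  refine ⟨n, ?_⟩
  ext i
  have := hn i
  simp at this
  simp [this]

/-- Integration of a periodic function over the cell is invariant under translations. -/
lemma lintegral_cell_add (f : E d → ℝ≥0∞) (hf : ∀ x (n : Fin d → ℤ), f (x + latticeVec n) = f x)
    (z : E d) : ∫⁻ x in cell d, f (x + z) = ∫⁻ x in cell d, f x := by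
  have h1 := isAddFundamentalDomain_cell (d := d)
  have : Countable
      (Submodule.span ℤ (Set.range (EuclideanSpace.basisFun (Fin d) ℝ).toBasis)).toAddSubgroup :=
    inferInstanceAs (Countable
      (Submodule.span ℤ (Set.range (EuclideanSpace.basisFun (Fin d) ℝ).toBasis)))
  have h2 := h1.vadd_of_comm z
  have h3 := h1.setLIntegral_eq h2 f (by
    rintro ⟨g, hg⟩ x
    obtain ⟨n, rfl⟩ := exists_latticeVec_of_mem_span hg
    rw [← hf x n, add_comm]
    rfl)
  rw [h3]
  have h := (measurePreserving_add_right (volume : Measure (E d)) z)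
  have h4 := h.setLIntegral_comp_preimage_emb (MeasurableEquiv.addRight z).measurableEmbedding f
    (z +ᵥ cell d)
  rw [← h4]
  congr 2
  ext x
  simp [Set.mem_vadd_set, add_comm z]

/-- The translation by `z` of the torus `ℝ^d/ℤ^d`, in terms of representatives in the cell,
preserves Lebesgue measure. -/
lemma measurePreserving_fractE_add (z : E d) :
    MeasurePreserving (fun x : E d => fractE (x + z)) (cm d) (cm d) := by
  refine ⟨by fun_prop, Measure.ext fun s hs => ?_⟩
  have hm : Measurable fun x : E d => fractE (x + z) := by fun_prop
  rw [Measure.map_apply hm hs]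
  have h := lintegral_cell_add (fun x => s.indicator 1 (fractE x)) (by simp) z
  have e1 : ∀ x : E d, s.indicator (1 : E d → ℝ≥0∞) (fractE (x + z))
      = ((fun x : E d => fractE (x + z)) ⁻¹' s).indicator 1 x := fun x => rfl
  have e2 : ∫⁻ x in cell d, s.indicator (1 : E d → ℝ≥0∞) (fractE x)
      = ∫⁻ x in cell d, s.indicator (1 : E d → ℝ≥0∞) x :=
    setLIntegral_congr_fun measurableSet_cell fun x hx => by simp only [fractE_of_mem hx]
  rw [e2] at h
  simp only [e1] at h
  rwa [lintegral_indicator_one (hm hs), lintegral_indicator_one hs] at h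

lemma quasiMeasurePreserving_fractE :
    Measure.QuasiMeasurePreserving (fractE (d := d)) volume (cm d) := by
  refine ⟨measurable_fractE, Measure.AbsolutelyContinuous.mk fun s hs h0 => ?_⟩
  rw [Measure.map_apply measurable_fractE hs, ← lintegral_indicator_one (measurable_fractE hs),
    lintegral_eq_tsum_shiftedCell]
  refine ENNReal.tsum_eq_zero.2 fun n => ?_
  rw [lintegral_shiftedCell]
  have e1 : ∀ x : E d, (fractE ⁻¹' s).indicator (1 : E d → ℝ≥0∞) (x + latticeVec n)
      = s.indicator 1 (fractE x) := fun x => by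
    change s.indicator 1 (fractE (x + latticeVec n)) = _
    rw [fractE_add_latticeVec]
  simp only [e1]
  rw [setLIntegral_congr_fun (g := s.indicator 1) measurableSet_cell
    (fun x hx => by simp only [fractE_of_mem hx]), lintegral_indicator_one hs, h0]

/-! ### The Lévy measure -/

/-- The Lévy measure `|z|^{-d-α} dz`. -/
def levyMeasure (d : ℕ) (α : ℝ) : Measure (E d) :=
  (volume : Measure (E d)).withDensity fun z => ENNReal.ofReal (‖z‖ ^ (-((d : ℝ) + α)))

instance (α : ℝ) : SigmaFinite (levyMeasure d α) :=
  SigmaFinite.withDensity_of_ne_top' fun _ => ENNReal.ofReal_ne_top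

@[fun_prop]
lemma measurable_levyDensity (α : ℝ) :
    Measurable fun z : E d => ENNReal.ofReal (‖z‖ ^ (-((d : ℝ) + α))) := by fun_prop

lemma lintegral_levyMeasure (α : ℝ) {f : E d → ℝ≥0∞} (hf : Measurable f) :
    ∫⁻ z, f z ∂(levyMeasure d α) = ∫⁻ z, ENNReal.ofReal (‖z‖ ^ (-((d : ℝ) + α))) * f z := by
  rw [levyMeasure, lintegral_withDensity_eq_lintegral_mul _ (by fun_prop) hf]
  rfl

/-- The Lévy measure is homogeneous of degree `-α`. -/
lemma lintegral_levyMeasure_smul (α : ℝ) {f : E d → ℝ≥0∞} (hf : Measurable f) {t : ℝ}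
    (ht : 0 < t) :
    ∫⁻ z, f (t • z) ∂(levyMeasure d α) = ENNReal.ofReal (t ^ α) * ∫⁻ z, f z ∂(levyMeasure d α) := by
  rw [lintegral_levyMeasure α (by fun_prop), lintegral_levyMeasure α hf]
  set F : E d → ℝ≥0∞ := fun z => ENNReal.ofReal (‖z‖ ^ (-((d : ℝ) + α))) * f z with hF
  have hFm : Measurable F := by fun_prop
  have e1 : ∀ z : E d, ENNReal.ofReal (‖z‖ ^ (-((d : ℝ) + α))) * f (t • z)
      = ENNReal.ofReal (t ^ ((d : ℝ) + α)) * F (t • z) := by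
    intro z
    rw [hF]
    dsimp only
    rw [← mul_assoc, ← ENNReal.ofReal_mul (by positivity)]
    congr 2
    rw [norm_smul, Real.norm_of_nonneg ht.le, Real.mul_rpow ht.le (norm_nonneg _),
      ← mul_assoc, ← Real.rpow_add ht]
    simp
  simp only [e1]
  rw [lintegral_const_mul _ (by fun_prop)]
  have e2 : ∫⁻ z, F (t • z) = ENNReal.ofReal (t ^ (-(d : ℝ))) * ∫⁻ z, F z := by
    have h := lintegral_map (μ := (volume : Measure (E d))) hFm (g := fun z => t • z) (by fun_prop)
    rw [← h, Measure.map_addHaar_smul _ ht.ne', lintegral_smul_measure]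
    simp only [finrank_euclideanSpace, Fintype.card_fin, smul_eq_mul]
    congr 2
    rw [abs_of_nonneg (by positivity), Real.rpow_neg ht.le, Real.rpow_natCast]
  rw [e2, ← mul_assoc, ← ENNReal.ofReal_mul (by positivity), ← Real.rpow_add ht]
  congr 3
  ring

/-- The profile `min(r, r²)`, which is integrable against the Lévy measure for `1 < α < 2`. -/
def prof (r : ℝ) : ℝ := min r (r ^ 2)

@[fun_prop] lemma measurable_prof : Measurable prof := by unfold prof; fun_prop

lemma prof_nonneg {r : ℝ} (hr : 0 ≤ r) : 0 ≤ prof r := le_min hr (sq_nonneg r)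

lemma prof_mono {r s : ℝ} (hr : 0 ≤ r) (h : r ≤ s) : prof r ≤ prof s :=
  min_le_min h (by gcongr)

lemma integrable_prof_norm (hd : 1 ≤ d) {α : ℝ} (hα : 1 < α) (hα2 : α < 2) :
    Integrable fun z : E d => prof ‖z‖ * ‖z‖ ^ (-((d : ℝ) + α)) := by
  have : Nonempty (Fin d) := ⟨⟨0, hd⟩⟩
  rw [integrable_fun_norm_addHaar volume (f := fun r => prof r * r ^ (-((d : ℝ) + α)))]
  simp only [finrank_euclideanSpace, Fintype.card_fin, smul_eq_mul]
  have key : ∀ y : ℝ, 0 < y → y ^ (d - 1) = y ^ ((d : ℝ) - 1) := by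
    intro y hy
    rw [← Real.rpow_natCast, Nat.cast_sub hd, Nat.cast_one]
  rw [← Ioc_union_Ioi_eq_Ioi zero_le_one]
  refine IntegrableOn.union ?_ ?_
  · have h : IntegrableOn (fun y : ℝ => y ^ (1 - α)) (Ioc 0 1) := by
      rw [← intervalIntegrable_iff_integrableOn_Ioc_of_le zero_le_one]
      exact intervalIntegral.intervalIntegrable_rpow' (by linarith)
    refine h.congr_fun (fun y hy => ?_) measurableSet_Ioc
    have hp : prof y = y ^ (2 : ℝ) := by
      rw [Real.rpow_two]
      exact min_eq_right (by nlinarith [hy.1, hy.2])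
    dsimp only
    rw [hp, key y hy.1, ← Real.rpow_add hy.1, ← Real.rpow_add hy.1]
    congr 1; ring
  · have h : IntegrableOn (fun y : ℝ => y ^ (-α)) (Ioi 1) :=
      integrableOn_Ioi_rpow_of_lt (by linarith) zero_lt_one
    refine h.congr_fun (fun y hy => ?_) measurableSet_Ioi
    have hy1 : 1 < y := hy
    have hy0 : 0 < y := by linarith
    have hp : prof y = y ^ (1 : ℝ) := by
      rw [Real.rpow_one]
      exact min_eq_left (by nlinarith)
    dsimp only
    rw [hp, key y hy0, ← Real.rpow_add hy0, ← Real.rpow_add hy0]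
    congr 1; ring

/-- The integral of the profile against the Lévy measure. -/
def profInt (d : ℕ) (α : ℝ) : ℝ := (∫⁻ z, ENNReal.ofReal (prof ‖z‖) ∂(levyMeasure d α)).toReal

lemma profInt_nonneg (α : ℝ) : 0 ≤ profInt d α := ENNReal.toReal_nonneg

lemma lintegral_prof_one (hd : 1 ≤ d) {α : ℝ} (hα : 1 < α) (hα2 : α < 2) :
    ∫⁻ z, ENNReal.ofReal (prof ‖z‖) ∂(levyMeasure d α) = ENNReal.ofReal (profInt d α) := by
  rw [profInt, ENNReal.ofReal_toReal]
  rw [lintegral_levyMeasure α (by fun_prop)]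
  have h := (integrable_prof_norm hd hα hα2).lintegral_lt_top
  refine ne_of_lt (lt_of_eq_of_lt (lintegral_congr fun z => ?_) h)
  rw [← ENNReal.ofReal_mul (by positivity), mul_comm]

lemma lintegral_prof (hd : 1 ≤ d) {α : ℝ} (hα : 1 < α) (hα2 : α < 2) {t : ℝ} (ht : 0 ≤ t) :
    ∫⁻ z, ENNReal.ofReal (prof (t * ‖z‖)) ∂(levyMeasure d α)
      = ENNReal.ofReal (t ^ α * profInt d α) := by
  rcases ht.eq_or_lt with rfl | ht
  · simp [prof, Real.zero_rpow (by linarith : α ≠ 0)]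
  · rw [ENNReal.ofReal_mul (by positivity), ← lintegral_prof_one hd hα hα2,
      ← lintegral_levyMeasure_smul α (by fun_prop) ht]
    simp [norm_smul, abs_of_pos ht]

/-! ### The symbol of the operator with constant coefficient -/

lemma one_sub_cos_le_prof (t : ℝ) : 1 - Real.cos t ≤ prof |t| := by
  have h1 := Real.one_sub_sq_div_two_le_cos (x := t)
  have h2 := Real.neg_one_le_cos t
  refine le_min ?_ (by rw [sq_abs]; nlinarith [sq_nonneg t])
  rcases le_total |t| 2 with h | h
  · nlinarith [abs_nonneg t, sq_abs t]
  · linarith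

lemma abs_sin_sub_le_prof (t : ℝ) : |Real.sin t - t| ≤ 2 * prof |t| := by
  have key : ∀ s : ℝ, 0 ≤ s → |Real.sin s - s| ≤ 2 * prof s := by
    intro s hs
    have h1 : Real.sin s ≤ s := Real.sin_le hs
    rw [abs_of_nonpos (by linarith)]
    rcases le_total s 1 with h | h
    · have hp : prof s = s ^ 2 := min_eq_right (by nlinarith)
      rw [hp]
      rcases hs.eq_or_lt with rfl | h0
      · simp
      · have := Real.sin_gt_sub_cube h0
        nlinarith [mul_nonneg hs hs, mul_nonneg (mul_nonneg hs hs) (sub_nonneg.2 h)]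
    · have hp : prof s = s := min_eq_left (by nlinarith)
      rw [hp]
      rcases le_total s 2 with h' | h'
      · have := Real.sin_nonneg_of_nonneg_of_le_pi hs (by linarith [Real.pi_gt_three])
        linarith
      · linarith [Real.neg_one_le_sin s]
  rcases le_total 0 t with h | h
  · rw [abs_of_nonneg h]; exact key t h
  · rw [abs_of_nonpos h, ← abs_neg]
    have := key (-t) (by linarith)
    rw [Real.sin_neg] at this
    convert this using 2
    ring

@[fun_prop] lemma continuous_phase (ξ : E d) : Continuous (phase ξ) := by
  unfold phase; fun_prop

lemma phase_eq (ξ x : E d) : phase ξ x = Complex.exp ((inner ℝ ξ x : ℝ) * Complex.I) := by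
  rw [phase, mul_comm]

lemma phase_re (ξ x : E d) : (phase ξ x).re = Real.cos (inner ℝ ξ x) := by
  rw [phase_eq, Complex.exp_ofReal_mul_I_re]

lemma phase_im (ξ x : E d) : (phase ξ x).im = Real.sin (inner ℝ ξ x) := by
  rw [phase_eq, Complex.exp_ofReal_mul_I_im]

@[simp] lemma norm_phase (ξ x : E d) : ‖phase ξ x‖ = 1 := by
  rw [phase_eq, Complex.norm_exp_ofReal_mul_I]

lemma phase_add_right (ξ x y : E d) : phase ξ (x + y) = phase ξ x * phase ξ y := by
  simp only [phase, inner_add_right, ← Complex.exp_add]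
  push_cast; ring_nf

lemma phase_add_left (ξ η x : E d) : phase (ξ + η) x = phase ξ x * phase η x := by
  simp only [phase, inner_add_left, ← Complex.exp_add]
  push_cast; ring_nf

@[simp] lemma phase_zero_left (x : E d) : phase 0 x = 1 := by simp [phase]

lemma phase_mul_conj (ξ x : E d) : phase ξ x * conj (phase ξ x) = 1 := by
  rw [Complex.mul_conj, Complex.normSq_eq_norm_sq]; simp

lemma norm_one_sub_phase_sq (ξ x : E d) :
    ‖1 - phase ξ x‖ ^ 2 = 2 * (1 - Real.cos (inner ℝ ξ x)) := by
  rw [← Complex.normSq_eq_norm_sq, Complex.normSq_apply]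
  simp only [Complex.sub_re, Complex.one_re, Complex.sub_im, Complex.one_im, phase_re, phase_im]
  nlinarith [Real.sin_sq_add_cos_sq (inner ℝ ξ x : ℝ)]

lemma norm_one_sub_phase_sq_le (ξ x : E d) :
    ‖1 - phase ξ x‖ ^ 2 ≤ 2 * prof (‖ξ‖ * ‖x‖) := by
  rw [norm_one_sub_phase_sq]
  have := one_sub_cos_le_prof (inner ℝ ξ x)
  have := prof_mono (abs_nonneg _) (abs_real_inner_le_norm ξ x)
  linarith

/-- The symbol `k ↦ ∫ |1 - e^{i⟨k,z⟩}|² |z|^{-d-α} dz`, as an extended number. -/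
def esymb (d : ℕ) (α : ℝ) (k : E d) : ℝ≥0∞ := ∫⁻ z, ‖1 - phase k z‖ₑ ^ 2 ∂(levyMeasure d α)

/-- The symbol `k ↦ ∫ |1 - e^{i⟨k,z⟩}|² |z|^{-d-α} dz`, a positive multiple of `|k|^α`. -/
def symb (d : ℕ) (α : ℝ) (k : E d) : ℝ := (esymb d α k).toReal

lemma enorm_sq_eq (w : ℂ) : ‖w‖ₑ ^ 2 = ENNReal.ofReal (‖w‖ ^ 2) := by
  rw [← ofReal_norm, ENNReal.ofReal_pow (norm_nonneg _)]

lemma esymb_le (hd : 1 ≤ d) {α : ℝ} (hα : 1 < α) (hα2 : α < 2) (k : E d) :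
    esymb d α k ≤ ENNReal.ofReal (2 * profInt d α * ‖k‖ ^ α) := by
  have h : esymb d α k ≤ ∫⁻ z, ENNReal.ofReal 2 * ENNReal.ofReal (prof (‖k‖ * ‖z‖)) ∂(levyMeasure d α) := by
    refine lintegral_mono fun z => ?_
    dsimp only
    rw [enorm_sq_eq, ← ENNReal.ofReal_mul (by norm_num)]
    exact ENNReal.ofReal_le_ofReal (norm_one_sub_phase_sq_le k z)
  rw [lintegral_const_mul _ (by fun_prop), lintegral_prof hd hα hα2 (norm_nonneg _)] at h
  rw [← ENNReal.ofReal_mul (by norm_num)] at h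
  convert h using 2
  ring

lemma esymb_ne_top (hd : 1 ≤ d) {α : ℝ} (hα : 1 < α) (hα2 : α < 2) (k : E d) :
    esymb d α k ≠ ⊤ := ne_top_of_le_ne_top ENNReal.ofReal_ne_top (esymb_le hd hα hα2 k)

lemma symb_nonneg (α : ℝ) (k : E d) : 0 ≤ symb d α k := ENNReal.toReal_nonneg

/-- The upper bound that matches `exists_symb_ge`. -/
lemma symb_le (hd : 1 ≤ d) {α : ℝ} (hα : 1 < α) (hα2 : α < 2) (k : E d) :
    symb d α k ≤ 2 * profInt d α * ‖k‖ ^ α :=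
  ENNReal.toReal_le_of_le_ofReal (by have := profInt_nonneg (d := d) α; positivity)
    (esymb_le hd hα hα2 k)

lemma esymb_smul (α : ℝ) {t : ℝ} (ht : 0 < t) (k : E d) :
    esymb d α (t • k) = ENNReal.ofReal (t ^ α) * esymb d α k := by
  rw [esymb, esymb, ← lintegral_levyMeasure_smul α (by fun_prop) ht]
  simp only [phase, real_inner_smul_left, real_inner_smul_right]

/-- The symbol is bounded below by a positive multiple of `|k|^α`. On a ball around `k/(2|k|)` the
phase `⟨k/|k|,z⟩` stays away from `0` and `|z| ≤ 1`, and the volume of the ball does not depend on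
the direction of `k`. -/
lemma exists_symb_ge (hd : 1 ≤ d) {α : ℝ} (hα : 1 < α) (hα2 : α < 2) :
    ∃ c > 0, ∀ k : E d, c * ‖k‖ ^ α ≤ symb d α k := by
  have hcos : Real.cos 1 < Real.cos 0 := by
    refine Real.cos_lt_cos_of_nonneg_of_le_pi le_rfl (by linarith [Real.pi_gt_three]) zero_lt_one
  have hcos4 : Real.cos (1 / 4) < Real.cos 0 := by
    refine Real.cos_lt_cos_of_nonneg_of_le_pi le_rfl (by linarith [Real.pi_gt_three]) (by norm_num)
  rw [Real.cos_zero] at hcos4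
  set V : ℝ≥0∞ := (volume : Measure (E d)) (Metric.ball 0 (1 / 4)) with hV
  have hV0 : V ≠ 0 := (Metric.measure_ball_pos _ _ (by norm_num)).ne'
  have hVt : V ≠ ⊤ := measure_ball_lt_top.ne
  set b : ℝ := 2 * (1 - Real.cos (1 / 4)) with hb
  have hb0 : 0 < b := by rw [hb]; linarith
  have unit : ∀ e : E d, ‖e‖ = 1 → ENNReal.ofReal b * V ≤ esymb d α e := by
    intro e he
    have hball : V = volume (Metric.ball ((1 / 2 : ℝ) • e) (1 / 4)) := by
      rw [hV, Measure.addHaar_ball_center volume ((1 / 2 : ℝ) • e)]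
    rw [hball, ← setLIntegral_const, esymb, lintegral_levyMeasure α (by fun_prop)]
    refine (setLIntegral_mono' Metric.isOpen_ball.measurableSet fun z hz => ?_).trans
      (setLIntegral_le_lintegral _ _)
    rw [Metric.mem_ball, dist_eq_norm] at hz
    have hz1 : ‖z‖ ≤ 1 := by
      have : ‖z‖ ≤ ‖z - (1 / 2 : ℝ) • e‖ + ‖(1 / 2 : ℝ) • e‖ := by
        simpa using norm_add_le (z - (1 / 2 : ℝ) • e) ((1 / 2 : ℝ) • e)
      rw [norm_smul, he] at this
      norm_num at this
      linarith
    have hin : |inner ℝ e (z - (1 / 2 : ℝ) • e)| ≤ 1 / 4 := by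
      refine (abs_real_inner_le_norm _ _).trans ?_
      rw [he]; linarith
    rw [inner_sub_right, real_inner_smul_right, real_inner_self_eq_norm_sq, he] at hin
    have hin' := abs_le.1 hin
    have ht1 : 1 / 4 ≤ inner ℝ e z := by norm_num at hin'; linarith [hin'.1]
    have ht2 : inner ℝ e z ≤ 1 := by norm_num at hin'; linarith [hin'.2]
    have hz0 : 0 < ‖z‖ := by
      refine norm_pos_iff.2 fun h => ?_
      rw [h, inner_zero_right] at ht1
      norm_num at ht1
    rw [enorm_sq_eq, norm_one_sub_phase_sq, ← ENNReal.ofReal_mul (by positivity)]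
    refine ENNReal.ofReal_le_ofReal ?_
    have h1 : 1 ≤ ‖z‖ ^ (-((d : ℝ) + α)) :=
      Real.one_le_rpow_of_pos_of_le_one_of_nonpos hz0 hz1 (by
        have : (0 : ℝ) ≤ d := Nat.cast_nonneg d
        linarith)
    have h2 : Real.cos (inner ℝ e z) ≤ Real.cos (1 / 4) :=
      Real.cos_le_cos_of_nonneg_of_le_pi (by norm_num) (by linarith [Real.pi_gt_three]) ht1
    have h3 : b ≤ 2 * (1 - Real.cos (inner ℝ e z)) := by rw [hb]; linarith
    nlinarith
  refine ⟨b * V.toReal, mul_pos hb0 (ENNReal.toReal_pos hV0 hVt), fun k => ?_⟩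
  rcases eq_or_ne k 0 with rfl | hk
  · simp [Real.zero_rpow (by linarith : α ≠ 0), symb_nonneg]
  have hk0 : 0 < ‖k‖ := norm_pos_iff.2 hk
  have h1 : esymb d α k = ENNReal.ofReal (‖k‖ ^ α) * esymb d α (‖k‖⁻¹ • k) := by
    rw [← esymb_smul α hk0, smul_smul, mul_inv_cancel₀ hk0.ne', one_smul]
  have h2 := unit (‖k‖⁻¹ • k) (by rw [norm_smul, norm_inv, norm_norm, inv_mul_cancel₀ hk0.ne'])
  rw [symb, h1, ENNReal.toReal_mul, ENNReal.toReal_ofReal (by positivity), mul_comm]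
  gcongr
  have h3 := ENNReal.toReal_mono (esymb_ne_top hd hα hα2 _) h2
  rwa [ENNReal.toReal_mul, ENNReal.toReal_ofReal hb0.le] at h3

/-! ### Fourier series on the cell -/

/-- The frequency `2πn` of the `n`-th character of the torus. -/
def freq (n : Fin d → ℤ) : E d := (2 * Real.pi) • latticeVec n

lemma phase_freq_latticeVec (m n : Fin d → ℤ) : phase (freq m) (latticeVec n) = 1 := by
  have h : (inner ℝ (freq m) (latticeVec n) : ℝ) = ((∑ i, m i * n i : ℤ) : ℝ) * (2 * Real.pi) := by
    rw [freq, real_inner_smul_left, PiLp.inner_apply]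
    simp only [latticeVec_apply, RCLike.inner_apply, conj_trivial]
    push_cast
    rw [Finset.sum_mul, Finset.mul_sum]
    exact Finset.sum_congr rfl fun i _ => by ring
  rw [phase_eq, h]
  have := Complex.exp_int_mul_two_pi_mul_I (∑ i, m i * n i)
  rw [← this]
  push_cast
  ring_nf

lemma phase_freq_add_latticeVec (m n : Fin d → ℤ) (x : E d) :
    phase (freq m) (x + latticeVec n) = phase (freq m) x := by
  rw [phase_add_right, phase_freq_latticeVec, mul_one]

lemma phase_freq_fractE (m : Fin d → ℤ) (x : E d) : phase (freq m) (fractE x) = phase (freq m) x := by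
  obtain ⟨n, hn⟩ := exists_fractE_eq x
  conv_rhs => rw [hn, phase_freq_add_latticeVec]

section torus

open UnitAddTorus

local instance : MeasureSpace UnitAddCircle := ⟨AddCircle.haarAddCircle⟩

/-- The projection of `ℝ^d` onto the torus. -/
def toTorus (x : E d) : UnitAddTorus (Fin d) := fun i => ((x i : ℝ) : UnitAddCircle)

/-- The section of `toTorus` with values in the cell. -/
def ofTorus (t : UnitAddTorus (Fin d)) : E d :=
  WithLp.toLp 2 fun i => (AddCircle.measurableEquivIco 1 0 (t i) : ℝ)

lemma ofTorus_toTorus {x : E d} (hx : x ∈ cell d) : ofTorus (toTorus x) = x := by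
  ext i
  exact AddCircle.equivIco_coe_of_mem (by simpa using hx i)

lemma measurable_ofTorus : Measurable (ofTorus (d := d)) := by
  unfold ofTorus
  refine (WithLp.measurable_toLp 2 _).comp (measurable_pi_lambda _ fun i => ?_)
  exact measurable_subtype_coe.comp
    ((AddCircle.measurableEquivIco 1 0).measurable.comp (measurable_pi_apply i))

lemma measurePreserving_toTorus : MeasurePreserving (toTorus (d := d)) (cm d) volume := by
  have h1 := (EuclideanSpace.volume_preserving_symm_measurableEquiv_toLp (Fin d)).restrict_preimage
    (s := Set.pi univ fun _ => Ico (0 : ℝ) 1) (MeasurableSet.univ_pi fun _ => measurableSet_Ico)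
  have h0 : (AddCircle.haarAddCircle : Measure UnitAddCircle) = (AddCircle.measureSpace 1).volume := by
    rw [AddCircle.volume_eq_smul_haarAddCircle]; simp
  have h2 := measurePreserving_pi (fun _ : Fin d => (volume : Measure ℝ).restrict (Ioc 0 (0 + 1)))
    (fun _ => (AddCircle.haarAddCircle : Measure UnitAddCircle))
    (fun i => h0 ▸ AddCircle.measurePreserving_mk 1 0)
  have h3 : (volume : Measure (Fin d → ℝ)).restrict (Set.pi univ fun _ => Ico (0 : ℝ) 1)
      = Measure.pi fun _ : Fin d => (volume : Measure ℝ).restrict (Ioc 0 (0 + 1)) := by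
    rw [volume_pi, Measure.restrict_pi_pi]
    congr! 2
    rw [zero_add, Measure.restrict_congr_set Ico_ae_eq_Ioc]
  have hc : cell d = (MeasurableEquiv.toLp 2 (Fin d → ℝ)).symm ⁻¹'
      (Set.pi univ fun _ => Ico (0 : ℝ) 1) := by
    ext x; simp [cell, Set.mem_pi]
  rw [cm, hc]
  exact h2.comp (h3 ▸ h1)

lemma measurePreserving_ofTorus : MeasurePreserving (ofTorus (d := d)) volume (cm d) := by
  refine ⟨measurable_ofTorus, ?_⟩
  rw [← measurePreserving_toTorus.map_eq,
    Measure.map_map measurable_ofTorus measurePreserving_toTorus.measurable]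
  conv_rhs => rw [← Measure.map_id (μ := cm d)]
  refine Measure.map_congr ?_
  filter_upwards [ae_restrict_mem measurableSet_cell] with x hx using ofTorus_toTorus hx

lemma mFourier_toTorus (n : Fin d → ℤ) (x : E d) : mFourier n (toTorus x) = phase (freq n) x := by
  have h : ∀ i, fourier (n i) ((x i : ℝ) : UnitAddCircle)
      = Complex.exp (2 * Real.pi * Complex.I * n i * x i) := fun i => by
    rw [fourier_coe_apply]; simp
  simp only [mFourier, ContinuousMap.coe_mk, toTorus, h]
  rw [← Complex.exp_sum, phase, freq, real_inner_smul_left, PiLp.inner_apply]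
  congr 1
  simp only [latticeVec_apply, RCLike.inner_apply, conj_trivial]
  push_cast
  rw [Finset.mul_sum, Finset.mul_sum]
  exact Finset.sum_congr rfl fun i _ => by ring

lemma memLp_phase (k : E d) : MemLp (phase k) 2 (cm d) :=
  MemLp.of_bound (continuous_phase k).aestronglyMeasurable 1 (ae_of_all _ fun x => by simp)

/-- The `n`-th character of the torus as an element of `L₂(Ω)`. -/
def expL (n : Fin d → ℤ) : L2 d := (memLp_phase (freq n)).toLp _

lemma coeFn_expL (n : Fin d → ℤ) : expL n =ᵐ[cm d] phase (freq n) := MemLp.coeFn_toLp _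

lemma inner_expL (n : Fin d → ℤ) (u : L2 d) :
    inner ℂ (expL n) u = ∫ x in cell d, conj (phase (freq n) x) * u x := by
  rw [L2.inner_def]
  refine integral_congr_ae ?_
  filter_upwards [coeFn_expL n] with x hx
  rw [hx, RCLike.inner_apply, mul_comm]

lemma integral_toTorus (f : UnitAddTorus (Fin d) → ℂ)
    (hf : AEStronglyMeasurable f volume) : ∫ t, f t = ∫ x in cell d, f (toTorus x) := by
  rw [← measurePreserving_toTorus.map_eq, integral_map measurePreserving_toTorus.aemeasurable
    (measurePreserving_toTorus.map_eq ▸ hf)]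

lemma orthonormal_expL : Orthonormal ℂ (expL (d := d)) := by
  rw [orthonormal_iff_ite]
  intro m n
  have h := orthonormal_iff_ite.1 (orthonormal_mFourier (d := Fin d)) m n
  rw [← h, ContinuousMap.inner_toLp, integral_toTorus _ (by fun_prop), inner_expL]
  refine integral_congr_ae ?_
  filter_upwards [coeFn_expL n] with x hx
  rw [hx, mFourier_toTorus, mFourier_toTorus, mul_comm]

lemma eq_zero_of_inner_expL (f : L2 d) (hf : ∀ n, inner ℂ (expL n) f = 0) : f = 0 := by
  have hF : MemLp (f ∘ ofTorus) 2 volume := (Lp.memLp f).comp_measurePreserving measurePreserving_ofTorus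
  have h0 : hF.toLp _ = 0 := by
    refine mFourierBasis.repr.injective ?_
    rw [map_zero]
    ext n
    rw [mFourierBasis.repr_apply_apply, coe_mFourierBasis, L2.inner_def,
      integral_congr_ae (g := fun t => conj (mFourier n t) * f (ofTorus t)), integral_toTorus]
    · rw [lp.coeFn_zero, Pi.zero_apply, ← hf n, inner_expL]
      refine setIntegral_congr_fun measurableSet_cell fun x hx => ?_
      simp only [mFourier_toTorus, ofTorus_toTorus hx]
    · exact (by fun_prop : AEStronglyMeasurable (fun t => conj (mFourier n t)) volume).mul
        hF.aestronglyMeasurable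
    · filter_upwards [coeFn_mFourierLp 2 n, hF.coeFn_toLp] with t h1 h2
      rw [h1, h2, RCLike.inner_apply, mul_comm]
      rfl
  rw [Lp.eq_zero_iff_ae_eq_zero] at h0 ⊢
  have h1 := hF.coeFn_toLp.symm.trans h0
  have h2 := measurePreserving_toTorus.quasiMeasurePreserving.ae h1
  filter_upwards [h2, ae_restrict_mem measurableSet_cell] with x hx hc
  simpa [ofTorus_toTorus hc] using hx

end torus

/-- The characters of the torus form a Hilbert basis of `L₂(Ω)`. -/
def expBasis (d : ℕ) : HilbertBasis (Fin d → ℤ) ℂ (L2 d) :=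
  HilbertBasis.mkOfOrthogonalEqBot orthonormal_expL (by
    rw [Submodule.eq_bot_iff]
    intro f hf
    refine eq_zero_of_inner_expL f fun n => ?_
    exact (Submodule.mem_orthogonal _ _).1 hf _ (Submodule.subset_span ⟨n, rfl⟩))

lemma expBasis_apply (n : Fin d → ℤ) : expBasis d n = expL n := by
  simp [expBasis]

/-- The Fourier coefficients of an element of `L₂(Ω)`. -/
def fc (u : L2 d) (n : Fin d → ℤ) : ℂ := inner ℂ (expL n) u

lemma fc_eq_repr (u : L2 d) (n : Fin d → ℤ) : fc u n = (expBasis d).repr u n := by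
  rw [fc, HilbertBasis.repr_apply_apply, expBasis_apply]

lemma fc_ext {u v : L2 d} (h : ∀ n, fc u n = fc v n) : u = v := by
  refine (expBasis d).repr.injective ?_
  ext n
  rw [← fc_eq_repr, ← fc_eq_repr, h]

lemma fc_add (u v : L2 d) (n : Fin d → ℤ) : fc (u + v) n = fc u n + fc v n := inner_add_right _ _ _
lemma fc_sub (u v : L2 d) (n : Fin d → ℤ) : fc (u - v) n = fc u n - fc v n := inner_sub_right _ _ _
lemma fc_smul (c : ℂ) (u : L2 d) (n : Fin d → ℤ) : fc (c • u) n = c * fc u n :=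
  inner_smul_right _ _ _

lemma fc_expL (m n : Fin d → ℤ) : fc (expL m) n = if n = m then 1 else 0 :=
  orthonormal_iff_ite.1 orthonormal_expL n m

/-- Parseval's identity. -/
lemma hasSum_inner_fc (u v : L2 d) : HasSum (fun n => conj (fc u n) * fc v n) (inner ℂ u v) := by
  have h := (expBasis d).hasSum_inner_mul_inner u v
  refine h.congr_fun fun n => ?_
  rw [fc, fc, expBasis_apply, inner_conj_symm]

lemma hasSum_norm_fc_sq (u : L2 d) : HasSum (fun n => ‖fc u n‖ ^ 2) (‖u‖ ^ 2) := by
  have h := RCLike.hasSum_re ℂ (hasSum_inner_fc u u)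
  rw [inner_self_eq_norm_sq] at h
  refine h.congr_fun fun n => ?_
  rw [RCLike.conj_mul]
  norm_cast

lemma norm_fc_le (u : L2 d) (n : Fin d → ℤ) : ‖fc u n‖ ≤ ‖u‖ := by
  have := norm_inner_le_norm (𝕜 := ℂ) (expL n) u
  rwa [orthonormal_expL.1 n, one_mul] at this

lemma tsum_enorm_fc_sq (u : L2 d) : ∑' n, ‖fc u n‖ₑ ^ 2 = ‖u‖ₑ ^ 2 := by
  have h := hasSum_norm_fc_sq u
  simp only [enorm_sq_eq]
  rw [← ENNReal.ofReal_tsum_of_nonneg (fun n => by positivity) h.summable, h.tsum_eq,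
    ← ofReal_norm, ENNReal.ofReal_pow (norm_nonneg _)]

lemma lp_enorm_sq {X : Type*} [MeasurableSpace X] {ν : Measure X} (w : Lp ℂ 2 ν) :
    ‖w‖ₑ ^ 2 = ∫⁻ x, ‖w x‖ₑ ^ 2 ∂ν := by
  rw [Lp.enorm_def, eLpNorm_eq_lintegral_rpow_enorm_toReal two_ne_zero ENNReal.ofNat_ne_top]
  rw [← ENNReal.rpow_two, ← ENNReal.rpow_mul]
  simp

lemma enorm_sq_eq_lintegral (u : L2 d) : ‖u‖ₑ ^ 2 = ∫⁻ x in cell d, ‖u x‖ₑ ^ 2 := lp_enorm_sq u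

lemma tsum_enorm_integral_sq {g : E d → ℂ} (hg : MemLp g 2 (cm d)) :
    ∑' n, ‖∫ x in cell d, conj (phase (freq n) x) * g x‖ₑ ^ 2 = ∫⁻ x in cell d, ‖g x‖ₑ ^ 2 := by
  have h := tsum_enorm_fc_sq (hg.toLp g)
  rw [enorm_sq_eq_lintegral] at h
  convert h using 1
  · refine tsum_congr fun n => ?_
    rw [fc, inner_expL]
    congr 2
    refine integral_congr_ae ?_
    filter_upwards [hg.coeFn_toLp] with x hx
    rw [hx]
  · refine lintegral_congr_ae ?_
    filter_upwards [hg.coeFn_toLp] with x hx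
    rw [hx]

lemma norm_le_of_fc_le {u w : L2 d} {B : ℝ} (hB : 0 ≤ B) (h : ∀ n, ‖fc w n‖ ≤ B * ‖fc u n‖) :
    ‖w‖ ≤ B * ‖u‖ := by
  refine abs_le_of_sq_le_sq' ?_ (by positivity) |>.2
  rw [mul_pow]
  refine hasSum_le (fun n => ?_) (hasSum_norm_fc_sq w) ((hasSum_norm_fc_sq u).mul_left (B ^ 2))
  rw [← mul_pow]
  gcongr
  exact h n

/-- A bounded sequence is the symbol of a bounded Fourier multiplier. -/
lemma exists_multiplier {τ : (Fin d → ℤ) → ℂ} {B : ℝ} (hB : ∀ n, ‖τ n‖ ≤ B) :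
    ∃ T : L2 d →L[ℂ] L2 d, ∀ u n, fc (T u) n = τ n * fc u n := by
  have hB0 : 0 ≤ B := (norm_nonneg _).trans (hB 0)
  have key : ∀ u : L2 d, ∃ w : L2 d, ∀ n, fc w n = τ n * fc u n := by
    intro u
    have hm : Memℓp (fun n => τ n * fc u n) 2 := by
      refine memℓp_gen ?_
      have h := (hasSum_norm_fc_sq u).summable.mul_left (B ^ 2)
      refine h.of_nonneg_of_le (fun n => by positivity) fun n => ?_
      simp only [ENNReal.toReal_ofNat, Real.rpow_two, norm_mul, mul_pow]
      gcongr
      exact hB n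
    refine ⟨(expBasis d).repr.symm ⟨_, hm⟩, fun n => ?_⟩
    rw [fc_eq_repr, LinearIsometryEquiv.apply_symm_apply]
  choose T hT using key
  refine ⟨LinearMap.mkContinuous
    { toFun := T
      map_add' := fun u v => fc_ext fun n => by simp only [fc_add, hT]; ring
      map_smul' := fun c u => fc_ext fun n => by
        simp only [fc_smul, hT, RingHom.id_apply]; ring } B fun u => ?_, fun u n => hT u n⟩
  change ‖T u‖ ≤ B * ‖u‖
  exact norm_le_of_fc_le hB0 fun n => by
    rw [hT, norm_mul]; exact mul_le_mul_of_nonneg_right (hB n) (norm_nonneg _)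

/-! ### Twisted differences of periodic functions -/

/-- The twisted difference `u(x) - e^{i⟨ξ,z⟩} u(x+z)` of the periodic extension of `u`. -/
def delta (ξ : E d) (u : E d → ℂ) (q : E d × E d) : ℂ :=
  perExt u q.1 - phase ξ q.2 * perExt u (q.1 + q.2)

/-- The measure `|z|^{-d-α} dx dz` on `Ω × ℝ^d`. -/
abbrev bm (d : ℕ) (α : ℝ) : Measure (E d × E d) := (cm d).prod (levyMeasure d α)

lemma bm_eq (α : ℝ) : bm d α = ((cm d).prod volume).withDensity
    fun q => ENNReal.ofReal (‖q.2‖ ^ (-((d : ℝ) + α))) :=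
  prod_withDensity_right (by fun_prop)

lemma bm_ac (α : ℝ) : bm d α ≪ (cm d).prod volume := bm_eq (d := d) α ▸ withDensity_absolutelyContinuous _ _

lemma cm_ac : cm d ≪ (volume : Measure (E d)) := Measure.absolutelyContinuous_of_le Measure.restrict_le_self

lemma quasi_fractE_fst :
    Measure.QuasiMeasurePreserving (fun q : E d × E d => fractE q.1) ((cm d).prod volume) (cm d) :=
  (quasiMeasurePreserving_fractE.mono_left cm_ac).comp Measure.quasiMeasurePreserving_fst

lemma quasi_fractE_add :
    Measure.QuasiMeasurePreserving (fun q : E d × E d => fractE (q.1 + q.2)) ((cm d).prod volume)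
      (cm d) :=
  quasiMeasurePreserving_fractE.comp (Measure.quasiMeasurePreserving_snd.comp
    (measurePreserving_prod_add (cm d) (volume : Measure (E d))).quasiMeasurePreserving)

lemma delta_congr {u v : E d → ℂ} (h : u =ᵐ[cm d] v) (ξ : E d) :
    delta ξ u =ᵐ[(cm d).prod volume] delta ξ v := by
  filter_upwards [quasi_fractE_fst.ae h, quasi_fractE_add.ae h] with q h1 h2
  simp only [delta, perExt_eq, h1, h2]

@[fun_prop]
lemma measurable_perExt (u : L2 d) : Measurable (perExt u) :=
  (Lp.stronglyMeasurable u).measurable.comp measurable_fractE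

@[fun_prop]
lemma measurable_delta (ξ : E d) (u : L2 d) : Measurable (delta ξ u) := by
  unfold delta
  fun_prop

lemma memLp_perExt_add (u : L2 d) (z : E d) : MemLp (fun x => perExt u (x + z)) 2 (cm d) :=
  (Lp.memLp u).comp_measurePreserving (measurePreserving_fractE_add z)

lemma memLp_perExt (u : L2 d) : MemLp (fun x => perExt u x) 2 (cm d) := by
  simpa using memLp_perExt_add u 0

lemma lintegral_enorm_perExt_add (u : L2 d) (z : E d) :
    ∫⁻ x in cell d, ‖perExt u (x + z)‖ₑ ^ 2 = ‖u‖ₑ ^ 2 := by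
  rw [enorm_sq_eq_lintegral]
  exact (measurePreserving_fractE_add z).lintegral_comp (f := fun x => ‖u x‖ₑ ^ 2)
    ((Lp.stronglyMeasurable u).measurable.enorm.pow_const 2)

lemma integral_conj_phase_perExt_add (u : L2 d) (n : Fin d → ℤ) (z : E d) :
    ∫ x in cell d, conj (phase (freq n) x) * perExt u (x + z) = phase (freq n) z * fc u n := by
  have h := (measurePreserving_fractE_add z).map_eq
  have h1 : fc u n = ∫ x in cell d, conj (phase (freq n) (fractE (x + z))) * perExt u (x + z) := by
    rw [fc, inner_expL]
    have h2 := integral_map (μ := cm d) (φ := fun x => fractE (x + z)) (by fun_prop)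
      (f := fun x => conj (phase (freq n) x) * u x) (by
        rw [h]
        exact ((continuous_phase _).star.aestronglyMeasurable).mul (Lp.aestronglyMeasurable u))
    rw [h] at h2
    exact h2
  rw [h1, ← integral_const_mul]
  congr 1
  ext x
  rw [phase_freq_fractE, phase_add_right, map_mul]
  linear_combination (-(conj (phase (freq n) x) * perExt u (x + z))) * phase_mul_conj (freq n) z

lemma integral_conj_phase_perExt (u : L2 d) (n : Fin d → ℤ) :
    ∫ x in cell d, conj (phase (freq n) x) * perExt u x = fc u n := by
  have := integral_conj_phase_perExt_add u n 0
  simpa [phase] using this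

lemma integrable_conj_phase_mul {g : E d → ℂ} (hg : MemLp g 2 (cm d)) (k : E d) :
    Integrable (fun x => conj (phase k x) * g x) (cm d) := by
  refine (hg.integrable (by norm_num)).bdd_mul (c := 1)
    (continuous_phase k).star.aestronglyMeasurable (ae_of_all _ fun x => ?_)
  simp

lemma memLp_delta_slice (ξ : E d) (u : L2 d) (z : E d) :
    MemLp (fun x => delta ξ u (x, z)) 2 (cm d) :=
  (memLp_perExt u).sub ((memLp_perExt_add u z).const_mul (phase ξ z))

lemma integral_conj_phase_delta (ξ : E d) (u : L2 d) (n : Fin d → ℤ) (z : E d) :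
    ∫ x in cell d, conj (phase (freq n) x) * delta ξ u (x, z)
      = (1 - phase (ξ + freq n) z) * fc u n := by
  have h : ∀ x, conj (phase (freq n) x) * delta ξ u (x, z)
      = conj (phase (freq n) x) * perExt u x
        - phase ξ z * (conj (phase (freq n) x) * perExt u (x + z)) := fun x => by
    simp only [delta]; ring
  simp only [h]
  rw [integral_sub (integrable_conj_phase_mul (memLp_perExt u) _)
    ((integrable_conj_phase_mul (memLp_perExt_add u z) _).const_mul _), integral_const_mul,
    integral_conj_phase_perExt, integral_conj_phase_perExt_add, phase_add_left]
  ring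

/-- The form with constant coefficient, diagonalized by Fourier series. -/
lemma lintegral_enorm_delta_sq (α : ℝ) (ξ : E d) (u : L2 d) :
    ∫⁻ q, ‖delta ξ u q‖ₑ ^ 2 ∂(bm d α) = ∑' n, ‖fc u n‖ₑ ^ 2 * esymb d α (ξ + freq n) := by
  rw [lintegral_prod_symm _ (by fun_prop)]
  have h : ∀ z, ∫⁻ x in cell d, ‖delta ξ u (x, z)‖ₑ ^ 2
      = ∑' n, ‖fc u n‖ₑ ^ 2 * ‖1 - phase (ξ + freq n) z‖ₑ ^ 2 := by
    intro z
    rw [← tsum_enorm_integral_sq (memLp_delta_slice ξ u z)]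
    refine tsum_congr fun n => ?_
    rw [integral_conj_phase_delta, enorm_mul, mul_pow, mul_comm]
  simp only [h]
  rw [lintegral_tsum (fun n => by fun_prop)]
  refine tsum_congr fun n => ?_
  rw [lintegral_const_mul _ (by fun_prop)]
  rfl

/-- The effect of the quasimomentum on the twisted differences is small in `L₂`. -/
lemma lintegral_enorm_delta_sub_sq (α : ℝ) (ξ : E d) (u : L2 d) :
    ∫⁻ q, ‖delta ξ u q - delta 0 u q‖ₑ ^ 2 ∂(bm d α) = esymb d α ξ * ‖u‖ₑ ^ 2 := by
  rw [lintegral_prod_symm _ (by fun_prop)]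
  have h : ∀ z, ∫⁻ x in cell d, ‖delta ξ u (x, z) - delta 0 u (x, z)‖ₑ ^ 2
      = ‖1 - phase ξ z‖ₑ ^ 2 * ‖u‖ₑ ^ 2 := by
    intro z
    rw [← lintegral_enorm_perExt_add u z, ← lintegral_const_mul _ (by fun_prop)]
    congr 1
    ext x
    rw [← mul_pow, ← enorm_mul]
    congr 2
    simp only [delta, phase_zero_left]
    ring
  simp only [h]
  rw [lintegral_mul_const _ (by fun_prop)]
  rfl

/-! ### The measure of the form -/

/-- The measure `m(x,z) |z|^{-d-α} dx dz / 2` on `Ω × ℝ^d`, in which the form `a(ξ)` is the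
inner product of twisted differences. Here `m(x,z)` stands for `μ(x,x+z)`. -/
def formMeasure (α : ℝ) (m : E d × E d → ℝ) : Measure (E d × E d) :=
  (bm d α).withDensity fun q => ENNReal.ofReal (m q / 2)

/-- A measurable coefficient with values in `[μm, μp]`. -/
structure GoodCoeff (μm μp : ℝ) (m : E d × E d → ℝ) : Prop where
  pos : 0 < μm
  measurable : Measurable m
  ge : ∀ q, μm ≤ m q
  le : ∀ q, m q ≤ μp

variable {μm μp α : ℝ} {m : E d × E d → ℝ}

lemma GoodCoeff.pos' (hm : GoodCoeff μm μp m) : 0 < μp :=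
  hm.pos.trans_le ((hm.ge 0).trans (hm.le 0))

lemma formMeasure_ac (α : ℝ) (m : E d × E d → ℝ) : formMeasure α m ≪ (cm d).prod volume :=
  (withDensity_absolutelyContinuous _ _).trans (bm_ac α)

lemma lintegral_formMeasure_le (hm : GoodCoeff μm μp m) (f : E d × E d → ℝ≥0∞) :
    ∫⁻ q, f q ∂(formMeasure α m) ≤ ENNReal.ofReal (μp / 2) * ∫⁻ q, f q ∂(bm d α) := by
  have h : formMeasure α m ≤ ENNReal.ofReal (μp / 2) • bm d α := by
    rw [← withDensity_const]
    refine withDensity_mono (ae_of_all _ fun q => ENNReal.ofReal_le_ofReal ?_)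
    linarith [hm.le q]
  refine (lintegral_mono' h le_rfl).trans ?_
  rw [lintegral_smul_measure, smul_eq_mul]

lemma le_lintegral_formMeasure (hm : GoodCoeff μm μp m) (f : E d × E d → ℝ≥0∞) :
    ENNReal.ofReal (μm / 2) * ∫⁻ q, f q ∂(bm d α) ≤ ∫⁻ q, f q ∂(formMeasure α m) := by
  have h : ENNReal.ofReal (μm / 2) • bm d α ≤ formMeasure α m := by
    rw [← withDensity_const]
    refine withDensity_mono (ae_of_all _ fun q => ENNReal.ofReal_le_ofReal ?_)
    linarith [hm.ge q]
  refine le_trans ?_ (lintegral_mono' h le_rfl)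
  rw [lintegral_smul_measure, smul_eq_mul]

lemma integral_formMeasure {F : Type*} [NormedAddCommGroup F] [NormedSpace ℝ F]
    (hm : GoodCoeff μm μp m) (g : E d × E d → F) :
    ∫ q, g q ∂(formMeasure α m)
      = ∫ q, (m q / 2 * ‖q.2‖ ^ (-((d : ℝ) + α))) • g q ∂((cm d).prod volume) := by
  have hmm := hm.measurable
  rw [formMeasure, integral_withDensity_eq_integral_toReal_smul (by fun_prop)
    (ae_of_all _ fun _ => ENNReal.ofReal_lt_top), bm_eq,
    integral_withDensity_eq_integral_toReal_smul (by fun_prop)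
    (ae_of_all _ fun _ => ENNReal.ofReal_lt_top)]
  refine integral_congr_ae (ae_of_all _ fun q => ?_)
  have h1 : 0 ≤ m q / 2 := by have := hm.ge q; have := hm.pos; linarith
  dsimp only
  rw [ENNReal.toReal_ofReal (by positivity), ENNReal.toReal_ofReal h1, smul_smul, mul_comm]

/-- The change of variables `y = x + z`. -/
lemma integral_cellProd_eq {F : Type*} [NormedAddCommGroup F] [NormedSpace ℝ F]
    (hm : GoodCoeff μm μp m) {μ : E d → E d → ℝ}
    (hμ : ∀ᵐ q ∂((cm d).prod volume), μ q.1 (q.1 + q.2) = m q) (G : E d × E d → F) :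
    ∫ p, (μ p.1 p.2 / ‖p.1 - p.2‖ ^ ((d : ℝ) + α)) • G p ∂(cellProd d)
      = (2 : ℝ) • ∫ q, G (q.1, q.1 + q.2) ∂(formMeasure α m) := by
  rw [integral_formMeasure hm, ← integral_smul]
  have h := (measurePreserving_prod_add (cm d) (volume : Measure (E d))).integral_comp
    (MeasurableEquiv.shearAddRight (E d)).measurableEmbedding
    (fun p : E d × E d => (μ p.1 p.2 / ‖p.1 - p.2‖ ^ ((d : ℝ) + α)) • G p)
  rw [cellProd, ← h]
  refine integral_congr_ae ?_
  filter_upwards [hμ] with q hq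
  rw [hq, smul_smul, sub_add_cancel_left, norm_neg, Real.rpow_neg (norm_nonneg _)]
  congr 1
  rw [div_eq_mul_inv]; ring

/-! ### The form domain -/

lemma delta_add_ae (ξ : E d) (u v : L2 d) :
    delta ξ (u + v : L2 d) =ᵐ[(cm d).prod volume] delta ξ u + delta ξ v := by
  refine (delta_congr (Lp.coeFn_add u v) ξ).trans (ae_of_all _ fun q => ?_)
  simp only [delta, perExt, Pi.add_apply]
  ring

lemma delta_smul_ae (ξ : E d) (c : ℂ) (u : L2 d) :
    delta ξ (c • u : L2 d) =ᵐ[(cm d).prod volume] c • delta ξ u := by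
  refine (delta_congr (Lp.coeFn_smul c u) ξ).trans (ae_of_all _ fun q => ?_)
  simp only [delta, perExt, Pi.smul_apply, smul_eq_mul]
  ring

lemma delta_zero_ae (ξ : E d) : delta ξ (0 : L2 d) =ᵐ[(cm d).prod volume] 0 := by
  refine (delta_congr (Lp.coeFn_zero ℂ 2 _) ξ).trans (ae_of_all _ fun q => ?_)
  simp [delta, perExt]

/-- The domain of the forms `a(ξ)`; it does not depend on `ξ`, and coincides with
`H̃^{α/2}(Ω)` (`mem_formDom_iff_memHper`). -/
def formDom (α : ℝ) (m : E d × E d → ℝ) : Submodule ℂ (L2 d) where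
  carrier := {u | ∀ ξ, MemLp (delta ξ u) 2 (formMeasure α m)}
  add_mem' {u v} hu hv ξ :=
    ((hu ξ).add (hv ξ)).ae_eq ((formMeasure_ac α m).ae_eq (delta_add_ae ξ u v)).symm
  zero_mem' ξ := (MemLp.zero (p := 2)).ae_eq ((formMeasure_ac α m).ae_eq (delta_zero_ae ξ)).symm
  smul_mem' c u hu ξ :=
    ((hu ξ).const_smul c).ae_eq ((formMeasure_ac α m).ae_eq (delta_smul_ae ξ c u)).symm

/-- The map taking `u` to its twisted difference in `L₂` of the form measure. The form `a(ξ)[u,v]`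
is the inner product of the images of `u` and `v`. -/
def fmap (α : ℝ) (m : E d × E d → ℝ) (ξ : E d) :
    formDom α m →ₗ[ℂ] Lp ℂ 2 (formMeasure α m) where
  toFun u := (u.2 ξ).toLp _
  map_add' u v := by
    rw [← MemLp.toLp_add]
    exact MemLp.toLp_congr _ _ ((formMeasure_ac α m).ae_eq (delta_add_ae ξ u v))
  map_smul' c u := by
    rw [RingHom.id_apply, ← MemLp.toLp_const_smul]
    exact MemLp.toLp_congr _ _ ((formMeasure_ac α m).ae_eq (delta_smul_ae ξ c u))

lemma coeFn_fmap (ξ : E d) (u : formDom α m) :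
    fmap α m ξ u =ᵐ[formMeasure α m] delta ξ (u : L2 d) := MemLp.coeFn_toLp (u.2 ξ)

lemma inner_fmap (ξ η : E d) (u v : formDom α m) :
    inner ℂ (fmap α m ξ v) (fmap α m η u)
      = ∫ q, delta η (u : L2 d) q * conj (delta ξ (v : L2 d) q) ∂(formMeasure α m) := by
  rw [L2.inner_def]
  refine integral_congr_ae ?_
  filter_upwards [coeFn_fmap ξ v, coeFn_fmap η u] with q h1 h2
  rw [h1, h2, RCLike.inner_apply]

lemma integrable_delta_mul (ξ η : E d) (u v : formDom α m) :
    Integrable (fun q => delta η (u : L2 d) q * conj (delta ξ (v : L2 d) q)) (formMeasure α m) :=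
  (MemLp.integrable_mul (u.2 η) (v.2 ξ).star)

lemma enorm_fmap_sq (ξ : E d) (u : formDom α m) :
    ‖fmap α m ξ u‖ₑ ^ 2 = ∫⁻ q, ‖delta ξ (u : L2 d) q‖ₑ ^ 2 ∂(formMeasure α m) := by
  rw [lp_enorm_sq]
  refine lintegral_congr_ae ?_
  filter_upwards [coeFn_fmap ξ u] with q h1
  rw [h1]

lemma memLp_two_iff {X : Type*} [MeasurableSpace X] {ν : Measure X} {g : X → ℂ}
    (hg : AEStronglyMeasurable g ν) : MemLp g 2 ν ↔ ∫⁻ x, ‖g x‖ₑ ^ 2 ∂ν < ⊤ := by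
  rw [MemLp, and_iff_right hg, eLpNorm_lt_top_iff_lintegral_rpow_enorm_lt_top two_ne_zero
    ENNReal.ofNat_ne_top]
  simp

lemma enorm_add_sq_le (a b : ℂ) : ‖a + b‖ₑ ^ 2 ≤ 2 * (‖a‖ₑ ^ 2 + ‖b‖ₑ ^ 2) := by
  have h : ‖a + b‖ ^ 2 ≤ 2 * (‖a‖ ^ 2 + ‖b‖ ^ 2) := by
    have := norm_add_le a b
    nlinarith [sq_nonneg (‖a‖ - ‖b‖), norm_nonneg (a + b), norm_nonneg a, norm_nonneg b]
  simp only [enorm_sq_eq]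
  rw [← ENNReal.ofReal_add (by positivity) (by positivity),
    ← ENNReal.ofReal_ofNat, ← ENNReal.ofReal_mul (by norm_num)]
  exact ENNReal.ofReal_le_ofReal h

lemma mem_formDom_iff (hd : 1 ≤ d) (hα : 1 < α) (hα2 : α < 2) (hm : GoodCoeff μm μp m) (u : L2 d) :
    u ∈ formDom α m ↔ ∫⁻ q, ‖delta 0 u q‖ₑ ^ 2 ∂(bm d α) < ⊤ := by
  constructor
  · intro h
    have h0 := (memLp_two_iff (measurable_delta 0 u).aestronglyMeasurable).1 (h 0)
    have h1 := (le_lintegral_formMeasure (α := α) hm _).trans_lt h0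
    by_contra hc
    rw [not_lt_top_iff] at hc
    rw [hc, ENNReal.mul_top] at h1
    · exact lt_irrefl _ h1
    · have := hm.pos
      simp [this]
  · intro h ξ
    refine (memLp_two_iff (measurable_delta ξ u).aestronglyMeasurable).2 ?_
    refine (lintegral_formMeasure_le hm _).trans_lt (ENNReal.mul_lt_top ENNReal.ofReal_lt_top ?_)
    have h2 : ∫⁻ q, ‖delta ξ u q‖ₑ ^ 2 ∂(bm d α)
        ≤ ∫⁻ q, 2 * (‖delta ξ u q - delta 0 u q‖ₑ ^ 2 + ‖delta 0 u q‖ₑ ^ 2) ∂(bm d α) := by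
      refine lintegral_mono fun q => ?_
      have := enorm_add_sq_le (delta ξ u q - delta 0 u q) (delta 0 u q)
      rwa [sub_add_cancel] at this
    refine h2.trans_lt ?_
    rw [lintegral_const_mul _ (by fun_prop), lintegral_add_left (by fun_prop),
      lintegral_enorm_delta_sub_sq]
    refine ENNReal.mul_lt_top ENNReal.ofNat_lt_top (ENNReal.add_lt_top.2 ⟨?_, h⟩)
    refine ENNReal.mul_lt_top (esymb_ne_top hd hα hα2 ξ).lt_top ?_
    exact ENNReal.pow_lt_top enorm_lt_top

/-- The graph of `fmap` is closed, since convergence in `L₂` gives convergence almost everywhere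
along a subsequence. -/
lemma isClosed_graph_fmap (hd : 1 ≤ d) (hα : 1 < α) (hα2 : α < 2) (hm : GoodCoeff μm μp m)
    (ξ : E d) : IsClosed {p : L2 d × Lp ℂ 2 (formMeasure α m) |
      ∃ h : p.1 ∈ formDom α m, fmap α m ξ ⟨p.1, h⟩ = p.2} := by
  refine IsSeqClosed.isClosed fun p q hp hq => ?_
  have h1 : Tendsto (fun n => (p n).1) atTop (𝓝 q.1) := (continuous_fst.tendsto q).comp hq
  have h2 : Tendsto (fun n => (p n).2) atTop (𝓝 q.2) := (continuous_snd.tendsto q).comp hq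
  obtain ⟨ns, hns, hae⟩ := (tendstoInMeasure_of_tendsto_Lp h1).exists_seq_tendsto_ae
  have h2' := h2.comp hns.tendsto_atTop
  obtain ⟨ms, hms, hae2⟩ := (tendstoInMeasure_of_tendsto_Lp h2').exists_seq_tendsto_ae
  have key : q.2 =ᵐ[formMeasure α m] delta ξ q.1 := by
    have a1 := (formMeasure_ac α m).ae_le (quasi_fractE_fst.ae hae)
    have a2 := (formMeasure_ac α m).ae_le (quasi_fractE_add.ae hae)
    have a3 : ∀ᵐ x ∂(formMeasure α m), ∀ n, (p (ns (ms n))).2 x = delta ξ (p (ns (ms n))).1 x := by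
      rw [ae_all_iff]
      intro n
      obtain ⟨h, hh⟩ := hp (ns (ms n))
      rw [← hh]
      exact coeFn_fmap ξ ⟨_, h⟩
    filter_upwards [a1, a2, a3, hae2] with x b1 b2 b3 b4
    refine tendsto_nhds_unique b4 ?_
    have b5 : Tendsto (fun n => delta ξ (p (ns (ms n))).1 x) atTop (𝓝 (delta ξ q.1 x)) := by
      have c1 := b1.comp hms.tendsto_atTop
      have c2 := b2.comp hms.tendsto_atTop
      exact c1.sub (c2.const_mul _)
    refine b5.congr fun n => ?_
    rw [← b3 n]
    rfl
  have hmem : MemLp (delta ξ q.1) 2 (formMeasure α m) := (Lp.memLp q.2).ae_eq key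
  have hdom : q.1 ∈ formDom α m := by
    rw [mem_formDom_iff hd hα hα2 hm]
    have h0 := (memLp_two_iff (measurable_delta ξ q.1).aestronglyMeasurable).1 hmem
    have h1 : ∫⁻ q', ‖delta ξ q.1 q'‖ₑ ^ 2 ∂(bm d α) < ⊤ := by
      have h1 := (le_lintegral_formMeasure (α := α) hm _).trans_lt h0
      by_contra hc
      rw [not_lt_top_iff] at hc
      rw [hc, ENNReal.mul_top (by have := hm.pos; simp [this])] at h1
      exact lt_irrefl _ h1
    have h2 : ∫⁻ q', ‖delta 0 q.1 q'‖ₑ ^ 2 ∂(bm d α)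
        ≤ ∫⁻ q', 2 * (‖delta ξ q.1 q' - delta 0 q.1 q'‖ₑ ^ 2 + ‖delta ξ q.1 q'‖ₑ ^ 2) ∂(bm d α) := by
      refine lintegral_mono fun q' => ?_
      have := enorm_add_sq_le (delta 0 q.1 q' - delta ξ q.1 q') (delta ξ q.1 q')
      rwa [sub_add_cancel, enorm_sub_rev] at this
    refine h2.trans_lt ?_
    rw [lintegral_const_mul _ (by fun_prop), lintegral_add_left (by fun_prop),
      lintegral_enorm_delta_sub_sq]
    refine ENNReal.mul_lt_top ENNReal.ofNat_lt_top (ENNReal.add_lt_top.2 ⟨?_, h1⟩)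
    refine ENNReal.mul_lt_top (esymb_ne_top hd hα hα2 ξ).lt_top ?_
    exact ENNReal.pow_lt_top enorm_lt_top
  refine ⟨hdom, ?_⟩
  refine Lp.ext ?_
  exact (coeFn_fmap ξ ⟨q.1, hdom⟩).trans key.symm

/-! ### Abstract closed forms -/

section abstract

variable {X K : Type*} [NormedAddCommGroup X] [InnerProductSpace ℂ X] [CompleteSpace X]
  [NormedAddCommGroup K] [InnerProductSpace ℂ K] [CompleteSpace K]

/-- The resolvent at `-κ < 0` of the nonnegative operator generated by the closed form
`⟨D u, D v⟩`. -/
lemma exists_form_resolvent (H : Submodule ℂ X) (D : H →ₗ[ℂ] K)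
    (hD : IsClosed {p : X × K | ∃ h : p.1 ∈ H, D ⟨p.1, h⟩ = p.2}) {κ : ℝ} (hκ : 0 < κ) :
    ∃ R : X →L[ℂ] X, ∀ f, ∃ h : R f ∈ H, ∀ v : H,
      inner ℂ (D v) (D ⟨R f, h⟩) + κ * inner ℂ (v : X) (R f) = inner ℂ (v : X) f := by
  -- the graph of `√κ⁻¹ D`, a Hilbert space with the scalar product `⟨u,v⟩ + κ⁻¹ ⟨D u, D v⟩`
  set c : ℂ := ((√κ : ℝ) : ℂ) with hc
  have hc0 : c ≠ 0 := by simp [hc, (Real.sqrt_pos.2 hκ).ne']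
  let Γ : Submodule ℂ (WithLp 2 (X × K)) :=
    { carrier := {p | ∃ h : p.fst ∈ H, D ⟨p.fst, h⟩ = c • p.snd}
      add_mem' := by
        rintro p q ⟨h1, e1⟩ ⟨h2, e2⟩
        refine ⟨H.add_mem h1 h2, ?_⟩
        have : (⟨(p + q).fst, H.add_mem h1 h2⟩ : H) = ⟨p.fst, h1⟩ + ⟨q.fst, h2⟩ := rfl
        rw [this, map_add, e1, e2, ← smul_add]
        rfl
      zero_mem' := by
        refine ⟨H.zero_mem, ?_⟩
        have : (⟨(0 : WithLp 2 (X × K)).fst, H.zero_mem⟩ : H) = 0 := rfl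
        rw [this, map_zero]
        simp
      smul_mem' := by
        rintro a p ⟨h1, e1⟩
        refine ⟨H.smul_mem a h1, ?_⟩
        have : (⟨(a • p).fst, H.smul_mem a h1⟩ : H) = a • ⟨p.fst, h1⟩ := rfl
        rw [this, map_smul, e1, smul_comm]
        rfl }
  have hcl : IsClosed (Γ : Set (WithLp 2 (X × K))) := by
    have hcont : Continuous fun p : WithLp 2 (X × K) => (p.fst, c • p.snd) := by fun_prop
    exact hD.preimage hcont
  have : CompleteSpace Γ := hcl.completeSpace_coe
  let T : Γ →L[ℂ] X := (WithLp.fstL 2 ℂ X K).comp Γ.subtypeL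
  refine ⟨((κ : ℂ)⁻¹) • (T.comp (ContinuousLinearMap.adjoint T)), fun f => ?_⟩
  set p := ContinuousLinearMap.adjoint T f with hp
  obtain ⟨h1, e1⟩ := p.2
  have hR : (((κ : ℂ)⁻¹) • (T.comp (ContinuousLinearMap.adjoint T))) f
      = ((κ : ℂ)⁻¹) • (p : WithLp 2 (X × K)).fst := rfl
  have h2 : ((κ : ℂ)⁻¹) • (p : WithLp 2 (X × K)).fst ∈ H := H.smul_mem _ h1
  refine ⟨hR ▸ h2, fun v => ?_⟩
  have e2 : (⟨_, hR ▸ h2⟩ : H) = ((κ : ℂ)⁻¹) • ⟨(p : WithLp 2 (X × K)).fst, h1⟩ := Subtype.ext hR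
  have hv : (WithLp.toLp 2 ((v : X), c⁻¹ • D v) : WithLp 2 (X × K)) ∈ Γ := by
    refine ⟨v.2, ?_⟩
    rw [WithLp.toLp_snd, smul_smul, mul_inv_cancel₀ hc0, one_smul]
    rfl
  have e3 := ContinuousLinearMap.adjoint_inner_right T ⟨_, hv⟩ f
  rw [← hp, Submodule.coe_inner, WithLp.prod_inner_apply] at e3
  have e4 : T ⟨_, hv⟩ = (v : X) := rfl
  rw [e4] at e3
  rw [← e3, e2, hR, map_smul, e1, inner_smul_right, inner_smul_right, inner_smul_right]
  change _ = inner ℂ (v : X) (p : WithLp 2 (X × K)).fst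
    + inner ℂ (c⁻¹ • D v) (p : WithLp 2 (X × K)).snd
  rw [inner_smul_left]
  have hcc : c * c = κ := by
    rw [hc, ← Complex.ofReal_mul, Real.mul_self_sqrt hκ.le]
  have hκ0 : (κ : ℂ) ≠ 0 := by exact_mod_cast hκ.ne'
  have hconj : conj c⁻¹ = c⁻¹ := by rw [map_inv₀, hc, Complex.conj_ofReal]
  rw [hconj, ← hcc]
  field_simp
  ring

/-- Solvability of the equation `⟨D v, D u⟩ = ℓ(v)` for a closed form that is coercive on the
closed subspace `Y`. -/
lemma exists_form_solution (H : Submodule ℂ X) (D : H →ₗ[ℂ] K)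
    (hD : IsClosed {p : X × K | ∃ h : p.1 ∈ H, D ⟨p.1, h⟩ = p.2})
    (Y : Submodule ℂ X) (hY : IsClosed (Y : Set X)) {C : ℝ}
    (hC : ∀ u : H, (u : X) ∈ Y → ‖(u : X)‖ ≤ C * ‖D u‖)
    (l : H →ₗ[ℂ] ℂ) {B : ℝ} (hl : ∀ u : H, (u : X) ∈ Y → ‖l u‖ ≤ B * ‖D u‖) :
    ∃ u : H, (u : X) ∈ Y ∧ ∀ v : H, (v : X) ∈ Y → inner ℂ (D u) (D v) = l v := by
  let HY : Submodule ℂ H := Y.comap H.subtype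
  let DY : HY →ₗ[ℂ] K := D.comp HY.subtype
  let W : Submodule ℂ K := LinearMap.range DY
  have hinj : Function.Injective DY := by
    rw [← LinearMap.ker_eq_bot, LinearMap.ker_eq_bot']
    intro u hu
    have h1 := hC u.1 u.2
    have h2 : D u.1 = 0 := hu
    rw [h2, norm_zero, mul_zero] at h1
    exact Subtype.ext (Subtype.ext (norm_le_zero_iff.1 h1))
  have hW : IsClosed (W : Set K) := by
    refine IsSeqClosed.isClosed fun w k hw hk => ?_
    choose u hu using hw
    have hcau : CauchySeq fun n => ((u n : H) : X) := by
      have hk' := hk.cauchySeq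
      rw [Metric.cauchySeq_iff] at hk' ⊢
      intro ε hε
      obtain ⟨N, hN⟩ := hk' (ε / (|C| + 1)) (by positivity)
      refine ⟨N, fun a ha b hb => ?_⟩
      have h1 := hN a ha b hb
      have h2 := hC (u a - u b : HY).1 (u a - u b : HY).2
      have h3 : D (u a - u b : HY).1 = w a - w b := by
        rw [← hu a, ← hu b, ← map_sub]; rfl
      rw [h3] at h2
      rw [dist_eq_norm] at h1 ⊢
      have h4 : ((u a : H) : X) - ((u b : H) : X) = ((u a - u b : HY).1 : X) := rfl
      rw [h4]
      refine h2.trans_lt ?_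
      rw [lt_div_iff₀ (by positivity)] at h1
      have h5 : C * ‖w a - w b‖ ≤ |C| * ‖w a - w b‖ :=
        mul_le_mul_of_nonneg_right (le_abs_self C) (norm_nonneg _)
      nlinarith [norm_nonneg (w a - w b)]
    obtain ⟨x, hx⟩ := cauchySeq_tendsto_of_complete hcau
    have hxY : x ∈ Y := hY.mem_of_tendsto hx (Eventually.of_forall fun n => (u n).2)
    have hgr := hD.mem_of_tendsto (hx.prodMk_nhds hk) (Eventually.of_forall fun n =>
      (⟨(u n).1.2, hu n⟩ : _ ∈ {p : X × K | ∃ h : p.1 ∈ H, D ⟨p.1, h⟩ = p.2}))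
    obtain ⟨h, hh⟩ := hgr
    exact ⟨⟨⟨x, h⟩, hxY⟩, hh⟩
  have : CompleteSpace W := hW.completeSpace_coe
  let e : HY ≃ₗ[ℂ] W := LinearEquiv.ofInjective DY hinj
  let L : W →L[ℂ] ℂ := LinearMap.mkContinuous ((l.comp HY.subtype).comp e.symm.toLinearMap) B (by
    intro w
    have h1 := hl (e.symm w).1 (e.symm w).2
    have h2 : D (e.symm w).1 = (w : K) := congrArg Subtype.val (e.apply_symm_apply w)
    rw [h2] at h1
    exact h1)
  let g : W := (InnerProductSpace.toDual ℂ W).symm L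
  refine ⟨(e.symm g).1, (e.symm g).2, fun v hv => ?_⟩
  have h2 : D (e.symm g).1 = (g : K) := congrArg Subtype.val (e.apply_symm_apply g)
  have h3 : inner ℂ g (e ⟨v, hv⟩) = L (e ⟨v, hv⟩) := InnerProductSpace.toDual_symm_apply
  rw [h2]
  rw [Submodule.coe_inner] at h3
  have h4 : ((e ⟨v, hv⟩ : W) : K) = D v := rfl
  rw [h4] at h3
  rw [h3]
  change l (e.symm (e ⟨v, hv⟩)).1 = l v
  rw [e.symm_apply_apply]

end abstract

/-! ### The form domain as a Sobolev space -/

/-- The integrand of the Gagliardo seminorm of order `α/2`. -/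
def gag (α : ℝ) (u : L2 d) (p : E d × E d) : ℝ≥0∞ :=
  ENNReal.ofReal (‖perExt u p.1 - perExt u p.2‖ ^ 2 / ‖p.1 - p.2‖ ^ ((d : ℝ) + α))

lemma measurable_gag (α : ℝ) (u : L2 d) : Measurable (gag α u) := by
  unfold gag; fun_prop

lemma gag_add_latticeVec (α : ℝ) (u : L2 d) (p : E d × E d) (n : Fin d → ℤ) :
    gag α u (p.1 + latticeVec n, p.2 + latticeVec n) = gag α u p := by
  simp only [gag, perExt_add_latticeVec, add_sub_add_right_eq_sub]

lemma gag_shear (α : ℝ) (u : L2 d) (q : E d × E d) :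
    gag α u (q.1, q.1 + q.2) = ENNReal.ofReal (‖q.2‖ ^ (-((d : ℝ) + α))) * ‖delta 0 u q‖ₑ ^ 2 := by
  rw [gag, enorm_sq_eq, ← ENNReal.ofReal_mul (by positivity), Real.rpow_neg (norm_nonneg _)]
  simp only [delta, phase_zero_left, one_mul, sub_add_cancel_left, norm_neg]
  rw [div_eq_inv_mul]

lemma lintegral_gag (α : ℝ) (u : L2 d) :
    ∫⁻ p, gag α u p ∂(cellProd d) = ∫⁻ q, ‖delta 0 u q‖ₑ ^ 2 ∂(bm d α) := by
  have h := (measurePreserving_prod_add (cm d) (volume : Measure (E d))).lintegral_comp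
    (measurable_gag α u)
  rw [cellProd, ← h, bm_eq, lintegral_withDensity_eq_lintegral_mul _ (by fun_prop) (by fun_prop)]
  exact lintegral_congr fun q => gag_shear α u q

lemma cellProd_eq (d : ℕ) : cellProd d = volume.restrict (cell d ×ˢ univ) := by
  rw [cellProd, Measure.volume_eq_prod, ← Measure.prod_restrict, Measure.restrict_univ]

lemma setLIntegral_gag_shiftedCell (α : ℝ) (u : L2 d) (n : Fin d → ℤ) :
    ∫⁻ p in shiftedCell n ×ˢ univ, gag α u p = ∫⁻ p, gag α u p ∂(cellProd d) := by
  have hinv : (volume : Measure (E d × E d)).IsAddRightInvariant := by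
    rw [Measure.volume_eq_prod]; infer_instance
  have h := (measurePreserving_add_right (volume : Measure (E d × E d))
    (latticeVec n, latticeVec n))
  have h2 := h.setLIntegral_comp_preimage_emb (MeasurableEquiv.addRight _).measurableEmbedding
    (gag α u) (shiftedCell n ×ˢ univ)
  rw [← h2, cellProd_eq]
  have h3 : (fun p : E d × E d => p + (latticeVec n, latticeVec n)) ⁻¹' (shiftedCell n ×ˢ univ)
      = cell d ×ˢ univ := by
    rw [shiftedCell_eq_preimage]
    ext p
    simp only [mem_preimage, mem_prod, mem_univ, and_true, Prod.fst_add]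
    congr! 1
    ext i; simp
  rw [h3]
  exact lintegral_congr fun p => gag_add_latticeVec α u p n

lemma norm_le_of_mem_cell {x : E d} (hx : x ∈ cell d) : ‖x‖ ≤ d := by
  refine (norm_le_sum_norm_apply x).trans ?_
  have : ∑ i, ‖x i‖ ≤ ∑ _i : Fin d, (1 : ℝ) := Finset.sum_le_sum fun i _ => by
    rw [Real.norm_of_nonneg (hx i).1]; exact (hx i).2.le
  simpa using this

lemma levyMeasure_compl_ball_lt_top (hd : 1 ≤ d) (hα : 1 < α) (hα2 : α < 2) :
    levyMeasure d α (Metric.ball 0 1)ᶜ < ⊤ := by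
  rw [← lintegral_indicator_one Metric.isOpen_ball.measurableSet.compl]
  refine lt_of_le_of_lt (lintegral_mono fun z => ?_)
    ((lintegral_prof_one hd hα hα2).trans_lt ENNReal.ofReal_lt_top)
  by_cases hz : z ∈ (Metric.ball (0 : E d) 1)ᶜ
  · rw [indicator_of_mem hz, Pi.one_apply, ← ENNReal.ofReal_one]
    refine ENNReal.ofReal_le_ofReal ?_
    simp only [mem_compl_iff, Metric.mem_ball, dist_zero_right, not_lt] at hz
    exact le_min hz (by nlinarith)
  · rw [indicator_of_notMem hz]; exact zero_le

lemma memHper_iff (hd : 1 ≤ d) (hα : 1 < α) (hα2 : α < 2) (u : L2 d) :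
    MemHper (α / 2) u ↔ ∫⁻ q, ‖delta 0 u q‖ₑ ^ 2 ∂(bm d α) < ⊤ := by
  have he : (d : ℝ) + 2 * (α / 2) = d + α := by ring
  have hM : MemHper (α / 2) u ↔
      ∀ r : ℝ, ∫⁻ p in Metric.ball (0 : E d) r ×ˢ Metric.ball (0 : E d) r, gag α u p < ⊤ := by
    simp only [MemHper, he, gag]
  rw [hM]
  constructor
  · intro h
    have hnear : MeasurableSet {q : E d × E d | ‖q.2‖ < 1} :=
      measurableSet_lt (by fun_prop) measurable_const
    rw [← lintegral_add_compl _ hnear]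
    refine ENNReal.add_lt_top.2 ⟨?_, ?_⟩
    · -- the part near the diagonal is seen by a ball
      refine lt_of_le_of_lt ?_ (h (d + 2))
      have h1 := (measurePreserving_prod_add (cm d) (volume : Measure (E d))).setLIntegral_comp_preimage_emb
        (MeasurableEquiv.shearAddRight (E d)).measurableEmbedding (gag α u)
        {p : E d × E d | ‖p.2 - p.1‖ < 1}
      have h2 : ∫⁻ q in {q : E d × E d | ‖q.2‖ < 1}, ‖delta 0 u q‖ₑ ^ 2 ∂(bm d α)
          = ∫⁻ p in {p : E d × E d | ‖p.2 - p.1‖ < 1}, gag α u p ∂(cellProd d) := by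
        rw [cellProd, ← h1, bm_eq, setLIntegral_withDensity_eq_setLIntegral_mul _ (by fun_prop)
          (by fun_prop) hnear]
        have h3 : (fun q : E d × E d => (q.1, q.1 + q.2)) ⁻¹' {p : E d × E d | ‖p.2 - p.1‖ < 1}
            = {q : E d × E d | ‖q.2‖ < 1} := by
          ext q; simp
        rw [h3]
        exact (lintegral_congr fun q => gag_shear α u q).symm
      rw [h2, cellProd_eq, Measure.restrict_restrict
        (measurableSet_lt (by fun_prop) measurable_const)]
      refine lintegral_mono_set ?_
      rintro ⟨x, y⟩ ⟨hxy, hx, -⟩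
      simp only [mem_ofPred_eq] at hxy
      have h3 := norm_le_of_mem_cell hx
      have h4 : ‖y‖ ≤ ‖y - x‖ + ‖x‖ := by simpa using norm_add_le (y - x) x
      simp only [mem_prod, Metric.mem_ball, dist_zero_right]
      dsimp only at h3
      constructor <;> linarith
    · -- the part far from the diagonal is controlled by the norm in `L₂`
      have hfar : {q : E d × E d | ‖q.2‖ < 1}ᶜ = univ ×ˢ (Metric.ball (0 : E d) 1)ᶜ := by
        ext q; simp
      rw [hfar]
      have h0 : ∫⁻ q in univ ×ˢ (Metric.ball (0 : E d) 1)ᶜ, ‖delta 0 u q‖ₑ ^ 2 ∂(bm d α)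
          ≤ ∫⁻ q in univ ×ˢ (Metric.ball (0 : E d) 1)ᶜ,
            2 * (‖perExt u q.1‖ₑ ^ 2 + ‖perExt u (q.1 + q.2)‖ₑ ^ 2) ∂(bm d α) := by
        refine lintegral_mono fun q => ?_
        have := enorm_add_sq_le (perExt u q.1) (-perExt u (q.1 + q.2))
        rw [enorm_neg] at this
        simpa [delta, sub_eq_add_neg] using this
      refine h0.trans_lt ?_
      rw [bm, ← Measure.prod_restrict, Measure.restrict_univ, lintegral_prod_symm _ (by fun_prop)]
      have h1 : ∀ z : E d, ∫⁻ x in cell d, 2 * (‖perExt u x‖ₑ ^ 2 + ‖perExt u (x + z)‖ₑ ^ 2)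
          = 4 * ‖u‖ₑ ^ 2 := by
        intro z
        rw [lintegral_const_mul _ (by fun_prop), lintegral_add_left (by fun_prop),
          lintegral_enorm_perExt_add]
        have := lintegral_enorm_perExt_add u 0
        simp only [add_zero] at this
        rw [this]
        ring
      simp only [h1]
      rw [lintegral_const, Measure.restrict_apply_univ]
      refine ENNReal.mul_lt_top (ENNReal.mul_lt_top (by simp) ?_)
        (levyMeasure_compl_ball_lt_top hd hα hα2)
      exact ENNReal.pow_lt_top enorm_lt_top
  · intro h r
    rw [← lintegral_gag] at h
    -- a ball meets finitely many cells
    set F : Finset (Fin d → ℤ) := Fintype.piFinset fun _ => Finset.Icc (-(⌈r⌉ + 1)) (⌈r⌉ + 1) with hF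
    have hsub : Metric.ball (0 : E d) r ×ˢ Metric.ball (0 : E d) r
        ⊆ ⋃ n ∈ F, shiftedCell n ×ˢ univ := by
      rintro ⟨x, y⟩ ⟨hx, -⟩
      simp only [Metric.mem_ball, dist_zero_right] at hx
      simp only [mem_iUnion]
      refine ⟨fun i => ⌊x i⌋, ?_, fun i => ⟨Int.floor_le _, Int.lt_floor_add_one _⟩, trivial⟩
      rw [hF, Fintype.mem_piFinset]
      intro i
      have h1 : |x i| ≤ ‖x‖ := PiLp.norm_apply_le x i
      have h2 := abs_le.1 h1
      have h3 := Int.le_ceil r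
      rw [Finset.mem_Icc]
      constructor
      · rw [Int.le_floor]; push_cast; linarith [h2.1]
      · have : ((⌊x i⌋ : ℤ) : ℝ) ≤ ((⌈r⌉ + 1 : ℤ) : ℝ) := by
          push_cast; linarith [h2.2, Int.floor_le (x i)]
        exact_mod_cast this
    refine (lintegral_mono_set hsub).trans_lt ?_
    rw [lintegral_biUnion_finset (fun m _ n _ hmn => Disjoint.set_prod_left
      (pairwise_disjoint_shiftedCell hmn) _ _)
      fun n _ => (measurableSet_shiftedCell n).prod MeasurableSet.univ]
    refine ENNReal.sum_lt_top.2 fun n _ => ?_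
    rw [setLIntegral_gag_shiftedCell]
    exact h

lemma mem_formDom_iff_memHper (hd : 1 ≤ d) (hα : 1 < α) (hα2 : α < 2) (hm : GoodCoeff μm μp m)
    (u : L2 d) : u ∈ formDom α m ↔ MemHper (α / 2) u := by
  rw [mem_formDom_iff hd hα hα2 hm, memHper_iff hd hα hα2]

/-! ### The form and its lower bounds -/

lemma levyForm_eq_inner (hm : GoodCoeff μm μp m) {μ : E d → E d → ℝ}
    (hμ : ∀ᵐ q ∂((cm d).prod volume), μ q.1 (q.1 + q.2) = m q) (ξ : E d) (u v : formDom α m) :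
    levyForm α μ ξ u v = inner ℂ (fmap α m ξ v) (fmap α m ξ u) := by
  have h := integral_cellProd_eq (α := α) hm hμ (fun p : E d × E d =>
    (phase ξ p.1 * perExt (u : L2 d) p.1 - phase ξ p.2 * perExt (u : L2 d) p.2) *
        conj (phase ξ p.1 * perExt (v : L2 d) p.1 - phase ξ p.2 * perExt (v : L2 d) p.2))
  simp only [Complex.real_smul] at h
  rw [levyForm, h, inner_fmap, ← mul_assoc]
  have h2 : (1 / 2 : ℂ) * ((2 : ℝ) : ℂ) = 1 := by norm_num
  rw [h2, one_mul]
  congr 1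
  ext q
  have h1 : ∀ w : L2 d, phase ξ q.1 * perExt w q.1 - phase ξ (q.1 + q.2) * perExt w (q.1 + q.2)
      = phase ξ q.1 * delta ξ w q := fun w => by
    rw [phase_add_right, delta]; ring
  rw [h1, h1, map_mul]
  linear_combination (delta ξ (u : L2 d) q * conj (delta ξ (v : L2 d) q)) * phase_mul_conj ξ q.1

/-- Away from the zeroth mode the frequencies are bounded below on the dual cell. -/
lemma norm_freq_add_ge {ξ : E d} (hξ : ξ ∈ dualCell d) {n : Fin d → ℤ} (hn : n ≠ 0) :
    Real.pi ≤ ‖ξ + freq n‖ := by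
  obtain ⟨i, hi⟩ := Function.ne_iff.1 hn
  refine le_trans ?_ (PiLp.norm_apply_le _ i)
  have h1 : (ξ + freq n) i = ξ i + 2 * Real.pi * n i := by simp [freq]
  rw [h1, Real.norm_eq_abs]
  have h2 := hξ i
  have hp := Real.pi_pos
  rcases lt_or_gt_of_ne hi with h | h
  · have : (n i : ℝ) ≤ -1 := by exact_mod_cast Int.le_sub_one_of_lt h
    rw [le_abs]; right
    nlinarith [h2.1, h2.2]
  · have : (1 : ℝ) ≤ n i := by exact_mod_cast h
    rw [le_abs]; left
    nlinarith [h2.1, h2.2]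

lemma le_enorm_fmap_sq (hm : GoodCoeff μm μp m) (ξ : E d) (u : formDom α m) :
    ENNReal.ofReal (μm / 2) * ∑' n, ‖fc (u : L2 d) n‖ₑ ^ 2 * esymb d α (ξ + freq n)
      ≤ ‖fmap α m ξ u‖ₑ ^ 2 := by
  rw [enorm_fmap_sq, ← lintegral_enorm_delta_sq]
  exact le_lintegral_formMeasure hm _

lemma le_norm_fmap_sq_of_enorm {ξ : E d} {u : formDom α m} {a : ℝ}
    (h : ENNReal.ofReal a ≤ ‖fmap α m ξ u‖ₑ ^ 2) : a ≤ ‖fmap α m ξ u‖ ^ 2 := by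
  rw [← ofReal_norm, ← ENNReal.ofReal_pow (norm_nonneg _)] at h
  exact (ENNReal.ofReal_le_ofReal_iff (by positivity)).1 h

/-- The Poincaré inequality for functions of mean value zero. -/
lemma poincare (hm : GoodCoeff μm μp m) {c : ℝ} (hc0 : 0 ≤ c)
    (hc : ∀ k : E d, c * ‖k‖ ^ α ≤ symb d α k) (hα : 1 < α) {ξ : E d} (hξ : ξ ∈ dualCell d)
    (u : formDom α m) (hu : fc (u : L2 d) 0 = 0) :
    μm / 2 * (c * ‖(u : L2 d)‖ ^ 2) ≤ ‖fmap α m ξ u‖ ^ 2 := by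
  refine le_norm_fmap_sq_of_enorm (le_trans ?_ (le_enorm_fmap_sq hm ξ u))
  have := hm.pos
  rw [ENNReal.ofReal_mul (by positivity), ENNReal.ofReal_mul (by positivity),
    ENNReal.ofReal_pow (norm_nonneg _), ofReal_norm, ← tsum_enorm_fc_sq, ← ENNReal.tsum_mul_left]
  refine mul_le_mul' le_rfl (ENNReal.tsum_le_tsum fun n => ?_)
  rcases eq_or_ne n 0 with rfl | hn
  · simp [hu]
  · rw [mul_comm]
    gcongr
    refine ENNReal.ofReal_le_of_le_toReal (le_trans ?_ (hc _))
    have h1 : (1 : ℝ) ≤ ‖ξ + freq n‖ ^ α := Real.one_le_rpow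
      (by linarith [norm_freq_add_ge hξ hn, Real.pi_gt_three]) (by linarith)
    nlinarith

/-- The effect of the quasimomentum on `fmap` is small in comparison with the form itself: it is
controlled by the norm in `L₂`. -/
lemma norm_fmap_sub_sq_le (hm : GoodCoeff μm μp m) (hd : 1 ≤ d) (hα : 1 < α) (hα2 : α < 2)
    (ξ : E d) (u : formDom α m) :
    ‖fmap α m ξ u - fmap α m 0 u‖ ^ 2 ≤ μp / 2 * (symb d α ξ * ‖(u : L2 d)‖ ^ 2) := by
  have h : ‖fmap α m ξ u - fmap α m 0 u‖ₑ ^ 2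
      ≤ ENNReal.ofReal (μp / 2) * (esymb d α ξ * ‖(u : L2 d)‖ₑ ^ 2) := by
    rw [← lintegral_enorm_delta_sub_sq]
    refine le_trans (le_of_eq ?_) (lintegral_formMeasure_le hm _)
    rw [lp_enorm_sq]
    refine lintegral_congr_ae ?_
    filter_upwards [coeFn_fmap ξ u, coeFn_fmap 0 u, Lp.coeFn_sub (fmap α m ξ u) (fmap α m 0 u)]
      with q h1 h2 h3
    rw [h3, Pi.sub_apply, h1, h2]
  have hp := hm.pos'
  have hs := symb_nonneg (d := d) α ξ
  rw [← ENNReal.ofReal_toReal (esymb_ne_top hd hα hα2 ξ), ← ofReal_norm, ← ofReal_norm,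
    ← ENNReal.ofReal_pow (norm_nonneg _), ← ENNReal.ofReal_pow (norm_nonneg _),
    ← ENNReal.ofReal_mul (by exact hs), ← ENNReal.ofReal_mul (by positivity)] at h
  exact (ENNReal.ofReal_le_ofReal_iff (by have : 0 ≤ (esymb d α ξ).toReal := hs; positivity)).1 h

/-! ### The resolvents -/

lemma exists_isResolvent (hd : 1 ≤ d) (hα : 1 < α) (hα2 : α < 2) (hm : GoodCoeff μm μp m)
    {μ : E d → E d → ℝ} (hμ : ∀ᵐ q ∂((cm d).prod volume), μ q.1 (q.1 + q.2) = m q) (ξ : E d)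
    {κ : ℝ} (hκ : 0 < κ) : ∃ R, IsResolvent (levyOp α μ ξ) κ R := by
  obtain ⟨R, hR⟩ := exists_form_resolvent (formDom α m) (fmap α m ξ)
    (isClosed_graph_fmap hd hα hα2 hm ξ) hκ
  refine ⟨R, fun f u => ⟨?_, ?_⟩⟩
  · rintro rfl
    obtain ⟨h, hh⟩ := hR f
    refine ⟨(mem_formDom_iff_memHper hd hα hα2 hm _).1 h, fun v hv => ?_⟩
    have hv' := (mem_formDom_iff_memHper hd hα hα2 hm _).2 hv
    have e := levyForm_eq_inner hm hμ ξ ⟨R f, h⟩ ⟨v, hv'⟩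
    dsimp only at e ⊢
    rw [e, inner_sub_right, inner_smul_right, ← hh ⟨v, hv'⟩, add_sub_cancel_right]
  · rintro ⟨h1, h2⟩
    obtain ⟨h, hh⟩ := hR f
    have h1' := (mem_formDom_iff_memHper hd hα hα2 hm _).2 h1
    -- the difference of two solutions has energy zero
    set w : formDom α m := ⟨R f, h⟩ - ⟨u, h1'⟩ with hw
    have e1 := hh w
    have e2 := h2 w ((mem_formDom_iff_memHper hd hα hα2 hm _).1 w.2)
    dsimp only at e2
    rw [levyForm_eq_inner hm hμ ξ ⟨u, h1'⟩ w, inner_sub_right, inner_smul_right] at e2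
    have e3 : inner ℂ (fmap α m ξ w) (fmap α m ξ w) + κ * inner ℂ (w : L2 d) (w : L2 d) = 0 := by
      have a1 : fmap α m ξ w = fmap α m ξ ⟨R f, h⟩ - fmap α m ξ ⟨u, h1'⟩ := map_sub _ _ _
      have a2 : (w : L2 d) = R f - u := rfl
      conv_lhs =>
        congr
        · rw [a1, inner_sub_right, ← a1]
        · rw [a2, inner_sub_right, ← a2]
      linear_combination e1 - e2
    have e4 : ‖fmap α m ξ w‖ ^ 2 + κ * ‖(w : L2 d)‖ ^ 2 = 0 := by
      have r1 : (inner ℂ (fmap α m ξ w) (fmap α m ξ w)).re = _ := inner_self_eq_norm_sq (𝕜 := ℂ) _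
      have r2 : (inner ℂ (w : L2 d) (w : L2 d)).re = _ := inner_self_eq_norm_sq (𝕜 := ℂ) _
      rw [← r1, ← r2, ← Complex.re_ofReal_mul, ← Complex.add_re, e3, Complex.zero_re]
    have e5 : ‖(w : L2 d)‖ ^ 2 = 0 := by
      nlinarith [sq_nonneg ‖fmap α m ξ w‖, sq_nonneg ‖(w : L2 d)‖]
    have e6 : (w : L2 d) = 0 := norm_eq_zero.1 (pow_eq_zero_iff two_ne_zero |>.1 e5)
    exact sub_eq_zero.1 e6

/-- The equation solved by the values of the resolvent. -/
lemma IsResolvent.form_eq (hd : 1 ≤ d) (hα : 1 < α) (hα2 : α < 2) (hm : GoodCoeff μm μp m)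
    {μ : E d → E d → ℝ} (hμ : ∀ᵐ q ∂((cm d).prod volume), μ q.1 (q.1 + q.2) = m q) {ξ : E d}
    {κ : ℝ} {R : L2 d →L[ℂ] L2 d} (hR : IsResolvent (levyOp α μ ξ) κ R) (f : L2 d) :
    ∃ h : R f ∈ formDom α m, ∀ v : formDom α m,
      inner ℂ (fmap α m ξ v) (fmap α m ξ ⟨R f, h⟩) + κ * inner ℂ (v : L2 d) (R f)
        = inner ℂ (v : L2 d) f := by
  obtain ⟨h1, h2⟩ := (hR f (R f)).1 rfl
  have h := (mem_formDom_iff_memHper hd hα hα2 hm _).2 h1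
  refine ⟨h, fun v => ?_⟩
  have e2 := h2 v ((mem_formDom_iff_memHper hd hα hα2 hm _).1 v.2)
  dsimp only at e2
  rw [levyForm_eq_inner hm hμ ξ ⟨R f, h⟩ v, inner_sub_right, inner_smul_right] at e2
  rw [e2]
  ring

/-! ### The operator with constant coefficient -/

lemma goodCoeff_const {c₀ : ℝ} (hc : 0 < c₀) : GoodCoeff c₀ c₀ (fun _ : E d × E d => c₀) :=
  ⟨hc, measurable_const, fun _ => le_rfl, fun _ => le_rfl⟩

lemma expL_mem_formDom (hd : 1 ≤ d) (hα : 1 < α) (hα2 : α < 2) (hm : GoodCoeff μm μp m)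
    (n : Fin d → ℤ) : expL n ∈ formDom α m := by
  rw [mem_formDom_iff hd hα hα2 hm, lintegral_enorm_delta_sq, tsum_eq_single n]
  · exact ENNReal.mul_lt_top (ENNReal.pow_lt_top enorm_lt_top) (esymb_ne_top hd hα hα2 _).lt_top
  · intro k hk
    simp [fc_expL, hk]

lemma delta_expL_ae (ξ : E d) (n : Fin d → ℤ) :
    delta ξ (expL n) =ᵐ[(cm d).prod volume]
      fun q => (1 - phase (ξ + freq n) q.2) * phase (freq n) q.1 := by
  refine (delta_congr (coeFn_expL n) ξ).trans (ae_of_all _ fun q => ?_)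
  simp only [delta, perExt_eq, phase_freq_fractE, phase_add_right, phase_add_left]
  ring

lemma integral_norm_one_sub_phase_sq (α : ℝ) (k : E d) :
    ∫ z, ‖1 - phase k z‖ ^ 2 ∂(levyMeasure d α) = symb d α k := by
  rw [integral_eq_lintegral_of_nonneg_ae (ae_of_all _ fun z => by positivity)
    (by fun_prop), symb, esymb]
  simp only [enorm_sq_eq]

/-- The form with constant coefficient is diagonal in the Fourier basis. -/
lemma inner_fmap_expL (hd : 1 ≤ d) (hα : 1 < α) (hα2 : α < 2) {c₀ : ℝ} (hc : 0 < c₀) (ξ : E d)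
    (n : Fin d → ℤ) (u : formDom α (fun _ : E d × E d => c₀)) :
    inner ℂ (fmap α _ ξ ⟨expL n, expL_mem_formDom hd hα hα2 (goodCoeff_const hc) n⟩) (fmap α _ ξ u)
      = ((c₀ / 2 * symb d α (ξ + freq n) : ℝ) : ℂ) * fc (u : L2 d) n := by
  have hint := integrable_delta_mul ξ ξ u
    ⟨expL n, expL_mem_formDom hd hα hα2 (goodCoeff_const hc) n⟩
  rw [inner_fmap]
  have hfm : formMeasure α (fun _ : E d × E d => c₀) = ENNReal.ofReal (c₀ / 2) • bm d α := by
    rw [formMeasure, withDensity_const]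
  rw [hfm] at hint ⊢
  have hint' := (integrable_smul_measure (by simpa using hc) ENNReal.ofReal_ne_top).1 hint
  have hae := (bm_ac α).ae_le (delta_expL_ae ξ n)
  rw [integral_smul_measure, integral_congr_ae (g := fun q => conj (1 - phase (ξ + freq n) q.2) *
    (conj (phase (freq n) q.1) * delta ξ (u : L2 d) q))]
  · rw [integral_prod_symm]
    · simp only [integral_const_mul, integral_conj_phase_delta]
      have h : ∀ z : E d, conj (1 - phase (ξ + freq n) z) *
          ((1 - phase (ξ + freq n) z) * fc (u : L2 d) n)
          = ((‖1 - phase (ξ + freq n) z‖ ^ 2 : ℝ) : ℂ) * fc (u : L2 d) n := fun z => by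
        rw [← mul_assoc, ← Complex.normSq_eq_conj_mul_self, Complex.normSq_eq_norm_sq]
      simp only [h]
      rw [integral_mul_const, integral_complex_ofReal, integral_norm_one_sub_phase_sq,
        ENNReal.toReal_ofReal (by positivity), Complex.real_smul]
      push_cast
      ring
    · refine hint'.congr ?_
      filter_upwards [hae] with q hq
      rw [hq, map_mul]; ring
  · filter_upwards [hae] with q hq
    rw [hq, map_mul]; ring

/-- The resolvent of the operator with constant coefficient is a Fourier multiplier. -/
lemma IsResolvent.fc_const (hd : 1 ≤ d) (hα : 1 < α) (hα2 : α < 2) {c₀ : ℝ} (hc : 0 < c₀) {ξ : E d}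
    {κ : ℝ} {R : L2 d →L[ℂ] L2 d} (hR : IsResolvent (levyOp α (fun _ _ => c₀) ξ) κ R)
    (f : L2 d) (n : Fin d → ℤ) :
    ((c₀ / 2 * symb d α (ξ + freq n) + κ : ℝ) : ℂ) * fc (R f) n = fc f n := by
  obtain ⟨h, hh⟩ := hR.form_eq hd hα hα2 (goodCoeff_const hc) (ae_of_all _ fun q => rfl) f
  have e := hh ⟨expL n, expL_mem_formDom hd hα hα2 (goodCoeff_const hc) n⟩
  rw [inner_fmap_expL hd hα hα2 hc] at e
  change _ + κ * fc (R f) n = fc f n at e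
  rw [← e]
  push_cast
  ring

/-! ### Differential operators with constant coefficients on the torus -/

/-- The quadratic form `⟨g k, k⟩`. -/
def qform (g : Fin d → Fin d → ℝ) (k : E d) : ℝ := ∑ j, ∑ l, g j l * (k j * k l)

lemma exists_bound_of_periodic {F : Type*} [NormedAddCommGroup F] {g : E d → F}
    (hg : Continuous g) (hper : ∀ (n : Fin d → ℤ) (x : E d), g (x + latticeVec n) = g x) :
    ∃ B, ∀ x, ‖g x‖ ≤ B := by
  obtain ⟨B, hB⟩ := (isCompact_closedBall (0 : E d) d).exists_bound_of_continuousOn hg.continuousOn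
  refine ⟨B, fun x => ?_⟩
  obtain ⟨n, hn⟩ := exists_fractE_eq x
  rw [hn, hper]
  exact hB _ (by simpa using norm_le_of_mem_cell (fractE_mem_cell x))

lemma integral_cell_add {g : E d → ℂ} (hg : Continuous g)
    (hper : ∀ (n : Fin d → ℤ) (x : E d), g (x + latticeVec n) = g x) (z : E d) :
    ∫ x in cell d, g (x + z) = ∫ x in cell d, g x := by
  have h := (measurePreserving_fractE_add z).map_eq
  have h2 := integral_map (μ := cm d) (φ := fun x => fractE (x + z)) (by fun_prop)
      (f := g) hg.aestronglyMeasurable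
  rw [h] at h2
  rw [cm] at h2
  rw [h2]
  congr 1
  ext x
  obtain ⟨n, hn⟩ := exists_fractE_eq (x + z)
  conv_lhs => rw [hn, hper]

/-- The integral of a derivative of a periodic function over the cell vanishes, since the integrals
of its translates do not depend on the translation. -/
lemma integral_cell_fderiv {g : E d → ℂ} (hg : ContDiff ℝ 1 g)
    (hper : ∀ (n : Fin d → ℤ) (x : E d), g (x + latticeVec n) = g x) (e : E d) :
    ∫ x in cell d, fderiv ℝ g x e = 0 := by
  have hg' : Continuous fun x => fderiv ℝ g x e := by
    have := hg.continuous_fderiv one_ne_zero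
    fun_prop
  have hper' : ∀ (n : Fin d → ℤ) (x : E d), fderiv ℝ g (x + latticeVec n) e = fderiv ℝ g x e := by
    intro n x
    rw [← fderiv_comp_add_right]
    congr 2
    ext y
    exact hper n y
  obtain ⟨B, hB⟩ := exists_bound_of_periodic hg' hper'
  obtain ⟨B', hB'⟩ := exists_bound_of_periodic hg.continuous hper
  have h := hasDerivAt_integral_of_dominated_loc_of_deriv_le (μ := cm d)
    (F := fun (t : ℝ) x => g (x + t • e)) (F' := fun t x => fderiv ℝ g (x + t • e) e) (x₀ := 0)
    (s := univ) (bound := fun _ => B) univ_mem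
    (Eventually.of_forall fun t => (hg.continuous.comp (by fun_prop)).aestronglyMeasurable)
    (Integrable.of_bound (hg.continuous.comp (by fun_prop)).aestronglyMeasurable B'
      (ae_of_all _ fun x => hB' _))
    (hg'.comp (by fun_prop)).aestronglyMeasurable
    (ae_of_all _ fun x t _ => hB _) (integrable_const B)
    (ae_of_all _ fun x t _ => by
      have h1 : HasDerivAt (fun t : ℝ => x + t • e) e t := by
        simpa using ((hasDerivAt_id t).smul_const e).const_add x
      exact ((hg.differentiable one_ne_zero _).hasFDerivAt).comp_hasDerivAt t h1)
  have h2 : (fun t : ℝ => ∫ x in cell d, g (x + t • e)) = fun _ => ∫ x in cell d, g x := by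
    ext t
    exact integral_cell_add hg.continuous hper _
  have h3 := h.2
  rw [h2] at h3
  have h4 := h3.unique (hasDerivAt_const (0 : ℝ) _)
  simpa using h4

lemma contDiff_phase (k : E d) : ContDiff ℝ ∞ (phase k) := by
  exact (contDiff_const.mul (Complex.ofRealCLM.comp (innerSL ℝ k)).contDiff).cexp

lemma hasFDerivAt_phase (k x : E d) :
    HasFDerivAt (phase k) (phase k x • (Complex.I • Complex.ofRealCLM.comp (innerSL ℝ k))) x := by
  have h1 : HasFDerivAt (fun x : E d => ((inner ℝ k x : ℝ) : ℂ))
      (Complex.ofRealCLM.comp (innerSL ℝ k)) x :=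
    (Complex.ofRealCLM.comp (innerSL ℝ k)).hasFDerivAt
  exact (h1.const_mul Complex.I).cexp

lemma fderiv_phase (k x : E d) (j : Fin d) :
    fderiv ℝ (phase k) x (EuclideanSpace.single j (1 : ℝ)) = Complex.I * k j * phase k x := by
  rw [(hasFDerivAt_phase k x).fderiv]
  simp [EuclideanSpace.inner_single_right]
  ring

lemma shiftedD_phase (ξ k x : E d) (j : Fin d) :
    shiftedD ξ j (phase k) x = ((ξ + k) j : ℝ) * phase k x := by
  rw [shiftedD, fderiv_phase, PiLp.add_apply]
  push_cast
  linear_combination (-(k j) * phase k x : ℂ) * Complex.I_sq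

lemma shiftedD_const_mul {ξ : E d} {j : Fin d} {φ : E d → ℂ} (hφ : Differentiable ℝ φ) (c : ℂ)
    (x : E d) : shiftedD ξ j (fun y => c * φ y) x = c * shiftedD ξ j φ x := by
  rw [shiftedD, shiftedD, fderiv_const_mul (hφ x)]
  simp only [_root_.smul_apply, smul_eq_mul]
  ring

lemma diffExpr_phase (g : Fin d → Fin d → ℝ) (ξ k x : E d) :
    diffExpr g ξ (phase k) x = qform g (ξ + k) * phase k x := by
  have h : ∀ l : Fin d, shiftedD ξ l (phase k) = fun y => ((ξ + k) l : ℝ) * phase k y := fun l => by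
    ext y; rw [shiftedD_phase]
  simp only [diffExpr, h, qform]
  push_cast
  rw [Finset.sum_mul]
  refine Finset.sum_congr rfl fun j _ => ?_
  rw [Finset.sum_mul]
  refine Finset.sum_congr rfl fun l _ => ?_
  rw [shiftedD_const_mul ((contDiff_phase k).differentiable (by simp)), shiftedD_phase]
  ring

/-- Smooth `ℤ^d`-periodic functions. -/
def SmoothPer (φ : E d → ℂ) : Prop :=
  ContDiff ℝ ∞ φ ∧ ∀ (n : Fin d → ℤ) (x : E d), φ (x + latticeVec n) = φ x

lemma smoothPer_phase (n : Fin d → ℤ) : SmoothPer (phase (freq n)) :=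
  ⟨contDiff_phase _, fun k x => phase_freq_add_latticeVec n k x⟩

lemma SmoothPer.shiftedD {φ : E d → ℂ} (h : SmoothPer φ) (ξ : E d) (j : Fin d) :
    SmoothPer (shiftedD ξ j φ) := by
  refine ⟨?_, fun n x => ?_⟩
  · have h1 : ContDiff ℝ ∞ fun x => fderiv ℝ φ x (EuclideanSpace.single j (1 : ℝ)) :=
      (h.1.fderiv_right (by simp)).clm_apply contDiff_const
    exact (contDiff_const.mul h1).add (contDiff_const.mul h.1)
  · simp only [LevyHomog.shiftedD]
    rw [h.2, ← fderiv_comp_add_right]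
    congr 4
    ext y
    exact h.2 n y

lemma SmoothPer.memLp {φ : E d → ℂ} (h : SmoothPer φ) : MemLp φ 2 (cm d) := by
  obtain ⟨B, hB⟩ := exists_bound_of_periodic h.1.continuous h.2
  exact MemLp.of_bound h.1.continuous.aestronglyMeasurable B (ae_of_all _ hB)

/-- Integration by parts on the torus. -/
lemma SmoothPer.integral_shiftedD {φ : E d → ℂ} (h : SmoothPer φ) (ξ : E d) (j : Fin d)
    (n : Fin d → ℤ) :
    ∫ x in cell d, conj (phase (freq n) x) * LevyHomog.shiftedD ξ j φ x
      = ((ξ + freq n) j : ℝ) * ∫ x in cell d, conj (phase (freq n) x) * φ x := by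
  set e : E d := EuclideanSpace.single j (1 : ℝ) with he
  have hconj : ∀ x : E d, conj (phase (freq n) x) = phase (-freq n) x := fun x => by
    rw [phase, phase, ← Complex.exp_conj, map_mul, Complex.conj_I, Complex.conj_ofReal,
      inner_neg_left]
    push_cast; ring_nf
  have hper : ∀ (k : Fin d → ℤ) (x : E d), phase (-freq n) (x + latticeVec k) = phase (-freq n) x := by
    intro k x
    rw [← hconj, ← hconj, phase_freq_add_latticeVec]
  have h0 := integral_cell_fderiv (g := fun x => phase (-freq n) x * φ x)
    (((contDiff_phase _).mul h.1).of_le (by simp)) (fun k x => by rw [hper, h.2]) e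
  have hd1 : Differentiable ℝ (phase (-freq n)) := (contDiff_phase _).differentiable (by simp)
  have hd2 : Differentiable ℝ φ := h.1.differentiable (by simp)
  have h1 : ∀ x, fderiv ℝ (fun x => phase (-freq n) x * φ x) x e
      = Complex.I * (conj (phase (freq n) x) * LevyHomog.shiftedD ξ j φ x
        - ((ξ + freq n) j : ℝ) * (conj (phase (freq n) x) * φ x)) := by
    intro x
    rw [fderiv_fun_mul (hd1 x) (hd2 x)]
    simp only [_root_.add_apply, _root_.smul_apply, smul_eq_mul]
    rw [he, fderiv_phase, LevyHomog.shiftedD, hconj]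
    simp only [PiLp.neg_apply, PiLp.add_apply]
    push_cast
    linear_combination (phase (-freq n) x * fderiv ℝ φ x (EuclideanSpace.single j 1)) * Complex.I_sq
  simp only [h1] at h0
  rw [integral_const_mul, integral_sub, integral_const_mul] at h0
  · have := (mul_eq_zero.1 h0).resolve_left Complex.I_ne_zero
    exact sub_eq_zero.1 this
  · exact integrable_conj_phase_mul (h.shiftedD ξ j).memLp _
  · exact (integrable_conj_phase_mul h.memLp _).const_mul _

lemma SmoothPer.diffExpr {φ : E d → ℂ} (h : SmoothPer φ) (g : Fin d → Fin d → ℝ) (ξ : E d) :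
    MemLp (diffExpr g ξ φ) 2 (cm d) := by
  unfold LevyHomog.diffExpr
  refine memLp_finsetSum _ fun j _ => memLp_finsetSum _ fun k _ => ?_
  exact ((h.shiftedD ξ k).shiftedD ξ j).memLp.const_mul _

lemma SmoothPer.integral_diffExpr {φ : E d → ℂ} (h : SmoothPer φ) (g : Fin d → Fin d → ℝ) (ξ : E d)
    (n : Fin d → ℤ) :
    ∫ x in cell d, conj (phase (freq n) x) * LevyHomog.diffExpr g ξ φ x
      = qform g (ξ + freq n) * ∫ x in cell d, conj (phase (freq n) x) * φ x := by
  have hint : ∀ j k, Integrable (fun x => conj (phase (freq n) x) *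
      ((g j k : ℂ) * LevyHomog.shiftedD ξ j (LevyHomog.shiftedD ξ k φ) x)) (cm d) := fun j k =>
    integrable_conj_phase_mul (((h.shiftedD ξ k).shiftedD ξ j).memLp.const_mul _) _
  simp only [LevyHomog.diffExpr, Finset.mul_sum]
  rw [integral_finsetSum _ fun j _ => integrable_finsetSum _ fun k _ => hint j k]
  simp only [qform]
  push_cast
  rw [Finset.sum_mul]
  refine Finset.sum_congr rfl fun j _ => ?_
  rw [integral_finsetSum _ fun k _ => hint j k, Finset.sum_mul]
  refine Finset.sum_congr rfl fun k _ => ?_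
  have e : ∀ x, conj (phase (freq n) x) *
      ((g j k : ℂ) * LevyHomog.shiftedD ξ j (LevyHomog.shiftedD ξ k φ) x)
      = (g j k : ℂ) * (conj (phase (freq n) x) *
        LevyHomog.shiftedD ξ j (LevyHomog.shiftedD ξ k φ) x) := fun x => by ring
  simp only [e]
  rw [integral_const_mul, (h.shiftedD ξ k).integral_shiftedD, h.integral_shiftedD]
  push_cast
  ring

lemma fc_toLp {φ : E d → ℂ} (h : MemLp φ 2 (cm d)) (n : Fin d → ℤ) :
    fc (h.toLp φ) n = ∫ x in cell d, conj (phase (freq n) x) * φ x := by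
  rw [fc, inner_expL]
  refine integral_congr_ae ?_
  filter_upwards [h.coeFn_toLp] with x hx
  rw [hx]

lemma inner_toLp {φ : E d → ℂ} (h : MemLp φ 2 (cm d)) (u : L2 d) :
    inner ℂ (h.toLp φ) u = ∫ x in cell d, u x * conj (φ x) := by
  rw [L2.inner_def]
  refine integral_congr_ae ?_
  filter_upwards [h.coeFn_toLp] with x hx
  rw [hx, RCLike.inner_apply]

/-- The operator `(D+ξ)^* g (D+ξ)` on its maximal domain is the Fourier multiplier with symbol
`⟨g k, k⟩`, `k = ξ + 2πn`. -/
lemma mem_diffOp_iff (g : Fin d → Fin d → ℝ) (ξ : E d) (u w : L2 d) :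
    (u, w) ∈ diffOp g ξ ↔ ∀ n, fc w n = qform g (ξ + freq n) * fc u n := by
  constructor
  · intro h n
    have h1 := h _ (smoothPer_phase n).1 (smoothPer_phase n).2
    dsimp only at h1
    rw [fc, fc, inner_expL, inner_expL, ← integral_const_mul]
    rw [integral_congr_ae (ae_of_all _ fun x => mul_comm _ _), ← h1]
    refine integral_congr_ae (ae_of_all _ fun x => ?_)
    dsimp only
    rw [diffExpr_phase, map_mul, Complex.conj_ofReal]
    ring
  · intro h φ h1 h2
    have hφ : SmoothPer φ := ⟨h1, h2⟩
    dsimp only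
    rw [← inner_toLp hφ.memLp, ← inner_toLp (hφ.diffExpr g ξ)]
    refine (hasSum_inner_fc _ _).unique ?_
    refine (hasSum_inner_fc _ _).congr_fun fun n => ?_
    rw [fc_toLp, fc_toLp, hφ.integral_diffExpr, h n, map_mul, Complex.conj_ofReal]
    ring

lemma fc_of_mem_graphPow (g : Fin d → Fin d → ℝ) (ξ : E d) (m : ℕ) {u w : L2 d}
    (h : (u, w) ∈ graphPow (diffOp g ξ) m) (n : Fin d → ℤ) :
    fc w n = (qform g (ξ + freq n) : ℂ) ^ m * fc u n := by
  induction m generalizing w with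
  | zero =>
    have : u = w := h
    rw [this, pow_zero, one_mul]
  | succ m ih =>
    obtain ⟨y, h1, h2⟩ := h
    rw [(mem_diffOp_iff g ξ y w).1 h2 n, ih h1, pow_succ]
    ring

lemma mem_graphPow_of_fc (g : Fin d → Fin d → ℝ) (ξ : E d) (m : ℕ) (w : ℕ → L2 d)
    (h : ∀ j, j ≤ m → ∀ n, fc (w j) n = (qform g (ξ + freq n) : ℂ) ^ j * fc (w 0) n) :
    (w 0, w m) ∈ graphPow (diffOp g ξ) m := by
  induction m with
  | zero => rfl
  | succ m ih =>
    refine ⟨w m, ih fun j hj => h j (by omega), (mem_diffOp_iff _ _ _ _).2 fun n => ?_⟩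
    rw [h _ le_rfl, h m (by omega), pow_succ]
    ring

lemma abs_coord_le (k : E d) (i : Fin d) : |k i| ≤ ‖k‖ := PiLp.norm_apply_le k i

lemma abs_qform_le (g : Fin d → Fin d → ℝ) (k : E d) :
    |qform g k| ≤ (∑ j, ∑ l, |g j l|) * ‖k‖ ^ 2 := by
  rw [qform, Finset.sum_mul]
  refine (Finset.abs_sum_le_sum_abs _ _).trans (Finset.sum_le_sum fun j _ => ?_)
  rw [Finset.sum_mul]
  refine (Finset.abs_sum_le_sum_abs _ _).trans (Finset.sum_le_sum fun l _ => ?_)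
  rw [abs_mul, abs_mul, sq]
  have := abs_coord_le k j
  have := abs_coord_le k l
  gcongr

/-! ### The correctors -/

/-- The property of `R₀` of being the Fourier multiplier with the symbol `1 / L(ξ + 2πn)`. -/
def IsMultInv (L : E d → ℝ) (ξ : E d) (R₀ : L2 d →L[ℂ] L2 d) : Prop :=
  ∀ f n, (L (ξ + freq n) : ℂ) * fc (R₀ f) n = fc f n

lemma IsMultInv.fc_eq {L : E d → ℝ} {ξ : E d} {R₀ : L2 d →L[ℂ] L2 d} (h : IsMultInv L ξ R₀)
    (hL : ∀ k, 0 < L k) (f : L2 d) (n : Fin d → ℤ) :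
    fc (R₀ f) n = (L (ξ + freq n) : ℂ)⁻¹ * fc f n := by
  have h0 : (L (ξ + freq n) : ℂ) ≠ 0 := by exact_mod_cast (hL _).ne'
  rw [← h f n, inv_mul_cancel_left₀ h0]

lemma IsMultInv.fc_pow {L : E d → ℝ} {ξ : E d} {R₀ : L2 d →L[ℂ] L2 d} (h : IsMultInv L ξ R₀)
    (hL : ∀ k, 0 < L k) (m : ℕ) (f : L2 d) (n : Fin d → ℤ) :
    fc ((R₀ ^ m) f) n = ((L (ξ + freq n) : ℂ)⁻¹) ^ m * fc f n := by
  induction m with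
  | zero => simp
  | succ m ih =>
    rw [pow_succ', mul_apply_eq_comp, h.fc_eq hL, ih, pow_succ]
    ring

lemma IsCorrector.fc_eq {L : E d → ℝ} {ξ : E d} {R₀ : L2 d →L[ℂ] L2 d} (h : IsMultInv L ξ R₀)
    (hL : ∀ k, 0 < L k) {g : Fin d → Fin d → ℝ} {m : ℕ} {K : L2 d →L[ℂ] L2 d}
    (hK : IsCorrector (diffOp g ξ) R₀ m K) (f : L2 d) (n : Fin d → ℤ) :
    fc (K f) n = (((-qform g (ξ + freq n)) ^ m / L (ξ + freq n) ^ (m + 1) : ℝ) : ℂ) * fc f n := by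
  obtain ⟨w, hw, hKw⟩ := hK f
  rw [hKw, fc_smul, fc_of_mem_graphPow g ξ m hw, h.fc_pow hL, neg_pow]
  push_cast
  rw [inv_pow, div_eq_mul_inv]
  ring

/-- The correctors exist if the symbol `q^m / L^(m+1)` is bounded, where `q` is of order `2` and `L`
of order `α`. -/
lemma exists_isCorrector {L : E d → ℝ} {ξ : E d} {R₀ : L2 d →L[ℂ] L2 d} (h : IsMultInv L ξ R₀)
    {c κ : ℝ} (hc : 0 < c) (hκ : 0 < κ) (hL : ∀ k, c * ‖k‖ ^ α + κ ≤ L k)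
    (g : Fin d → Fin d → ℝ) {m : ℕ} (hm : 2 * (m : ℝ) ≤ α * (m + 1)) :
    ∃ K, IsCorrector (diffOp g ξ) R₀ m K := by
  have hLκ : ∀ k, κ ≤ L k := fun k => by
    have := hL k
    have : 0 ≤ c * ‖k‖ ^ α := by positivity
    linarith
  have hL0 : ∀ k, 0 < L k := fun k => hκ.trans_le (hLκ k)
  set G : ℝ := ∑ j, ∑ l, |g j l| with hG
  have hG0 : 0 ≤ G := Finset.sum_nonneg fun j _ => Finset.sum_nonneg fun l _ => abs_nonneg _
  -- the symbols `q^j / L^(m+1)` with `j ≤ m` are bounded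
  have key : ∀ j ≤ m, ∀ k : E d,
      |qform g k ^ j / L k ^ (m + 1)| ≤ G ^ j * (1 / κ ^ (m + 1) + 1 / c ^ (m + 1)) := by
    intro j hj k
    rw [abs_div, abs_pow, abs_of_pos (pow_pos (hL0 k) _)]
    have h1 : |qform g k| ^ j ≤ G ^ j * (‖k‖ ^ 2) ^ j := by
      rw [← mul_pow]
      exact pow_le_pow_left₀ (abs_nonneg _) (abs_qform_le g k) _
    rw [div_le_iff₀ (pow_pos (hL0 k) _), mul_assoc]
    refine h1.trans (mul_le_mul_of_nonneg_left ?_ (pow_nonneg hG0 _))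
    rcases le_total ‖k‖ 1 with hk | hk
    · have h2 : (‖k‖ ^ 2) ^ j ≤ 1 := pow_le_one₀ (by positivity) (pow_le_one₀ (norm_nonneg _) hk)
      have h3 : 1 ≤ 1 / κ ^ (m + 1) * L k ^ (m + 1) := by
        rw [one_div, ← inv_pow, ← mul_pow]
        refine one_le_pow₀ ?_
        rw [← div_eq_inv_mul, le_div_iff₀ hκ, one_mul]
        exact hLκ k
      have h4 : 0 ≤ 1 / c ^ (m + 1) * L k ^ (m + 1) := by have := hL0 k; positivity
      rw [add_mul]; linarith
    · have hk0 : 0 < ‖k‖ := by linarith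
      have h2 : (‖k‖ ^ 2) ^ j ≤ (‖k‖ ^ α) ^ (m + 1) := by
        rw [← pow_mul, ← Real.rpow_natCast, ← Real.rpow_mul_natCast hk0.le]
        refine Real.rpow_le_rpow_of_exponent_le hk ?_
        have : (j : ℝ) ≤ m := by exact_mod_cast hj
        push_cast
        linarith
      have h3 : (‖k‖ ^ α) ^ (m + 1) ≤ 1 / c ^ (m + 1) * L k ^ (m + 1) := by
        rw [one_div, ← inv_pow, ← mul_pow]
        refine pow_le_pow_left₀ (by positivity) ?_ _
        rw [← div_eq_inv_mul, le_div_iff₀ hc]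
        have := hL k
        nlinarith
      have h4 : 0 ≤ 1 / κ ^ (m + 1) * L k ^ (m + 1) := by have := hL0 k; positivity
      rw [add_mul]; linarith
  have hT : ∀ j, ∃ T : L2 d →L[ℂ] L2 d, j ≤ m → ∀ u n, fc (T u) n
      = ((qform g (ξ + freq n) ^ j / L (ξ + freq n) ^ (m + 1) : ℝ) : ℂ) * fc u n := by
    intro j
    by_cases hj : j ≤ m
    · obtain ⟨T, hT⟩ := exists_multiplier
        (τ := fun n => ((qform g (ξ + freq n) ^ j / L (ξ + freq n) ^ (m + 1) : ℝ) : ℂ))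
        (B := G ^ j * (1 / κ ^ (m + 1) + 1 / c ^ (m + 1))) (fun n => by
          rw [Complex.norm_real]; exact key j hj _)
      exact ⟨T, fun _ => hT⟩
    · exact ⟨0, fun h => absurd h hj⟩
  choose T hT using hT
  refine ⟨((-1 : ℂ) ^ m) • T m, fun f => ⟨T m f, ?_, rfl⟩⟩
  have h0 : (R₀ ^ (m + 1)) f = T 0 f := fc_ext fun n => by
    rw [h.fc_pow hL0, hT 0 (Nat.zero_le _)]
    push_cast
    simp
  rw [h0]
  refine mem_graphPow_of_fc g ξ m (fun j => T j f) fun j hj n => ?_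
  rw [hT j hj, hT 0 (Nat.zero_le _)]
  push_cast
  ring

/-! ### Sums over the lattice -/

lemma norm_sub_le_of_mem_shiftedCell {n : Fin d → ℤ} {z z' : E d} (hz : z ∈ shiftedCell n)
    (hz' : z' ∈ shiftedCell n) : ‖z - z'‖ ≤ d := by
  refine (norm_le_sum_norm_apply _).trans ?_
  have : ∑ i, ‖(z - z') i‖ ≤ ∑ _i : Fin d, (1 : ℝ) := Finset.sum_le_sum fun i _ => by
    rw [Real.norm_eq_abs, PiLp.sub_apply, abs_le]
    constructor <;> linarith [(hz i).1, (hz i).2, (hz' i).1, (hz' i).2]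
  simpa using this

lemma hasSum_integral_shiftedCell {f : E d → ℝ} (hf : Integrable f) :
    HasSum (fun n : Fin d → ℤ => ∫ z in shiftedCell n, f z) (∫ z, f z) := by
  have h := hasSum_integral_iUnion (μ := (volume : Measure (E d))) (f := f)
    measurableSet_shiftedCell pairwise_disjoint_shiftedCell hf.integrableOn
  rwa [iUnion_shiftedCell, Measure.restrict_univ] at h

instance (n : Fin d → ℤ) : IsProbabilityMeasure ((volume : Measure (E d)).restrict (shiftedCell n)) :=
  ⟨by rw [Measure.restrict_apply_univ, volume_shiftedCell]⟩

/-- A weight with mean value zero over each cell gains one derivative: the sum over the lattice of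
the integrals of `w h` is controlled by the modulus of continuity of `h` in `L₁`. -/
lemma lattice_sum_bound {w h G : E d → ℝ} {W A : ℝ} (hwm : Measurable w) (hw : ∀ z, |w z| ≤ W)
    (hw0 : ∀ n : Fin d → ℤ, ∫ z in shiftedCell n, w z = 0) (hhm : Measurable h) (hA : 0 ≤ A)
    (hG : Integrable G) (hh : ∀ z z', |h z - h z'| ≤ A * ‖z - z'‖ * (G z + G z'))
    (hG0 : ∀ z, 0 ≤ G z) :
    (∀ n : Fin d → ℤ, IntegrableOn h (shiftedCell n)) ∧
    (Summable fun n : Fin d → ℤ => ∫ z in shiftedCell n, w z * h z) ∧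
    |∑' n : Fin d → ℤ, ∫ z in shiftedCell n, w z * h z| ≤ 2 * W * A * d * ∫ z, G z := by
  have hW : 0 ≤ W := (abs_nonneg _).trans (hw 0)
  have hcell : ∀ (n : Fin d → ℤ), ∀ z ∈ shiftedCell n, ∀ z' ∈ shiftedCell n,
      |h z - h z'| ≤ A * d * (G z + G z') := fun n z hz z' hz' => by
    refine (hh z z').trans ?_
    have := norm_sub_le_of_mem_shiftedCell hz hz'
    have := hG0 z
    have := hG0 z'
    gcongr
  have hsub : ∀ (n : Fin d → ℤ), ∀ z' ∈ shiftedCell n,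
      IntegrableOn (fun z => h z - h z') (shiftedCell n) := fun n z' hz' => by
    refine Integrable.mono' (g := fun z => A * d * (G z + G z')) ?_
      (hhm.sub_const _).aestronglyMeasurable ?_
    · exact (hG.integrableOn.add (integrable_const _)).const_mul _
    · filter_upwards [ae_restrict_mem (measurableSet_shiftedCell n)] with z hz
      exact hcell n z hz z' hz'
  have hne : ∀ n : Fin d → ℤ, (shiftedCell n).Nonempty := fun n =>
    ⟨latticeVec n, fun i => by simp⟩
  have hint : ∀ n : Fin d → ℤ, IntegrableOn h (shiftedCell n) := fun n => by
    obtain ⟨z', hz'⟩ := hne n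
    have := (hsub n z' hz').add (integrable_const (h z'))
    refine this.congr (ae_of_all _ fun z => ?_)
    simp
  have hwint : ∀ n : Fin d → ℤ, IntegrableOn w (shiftedCell n) := fun n =>
    Integrable.of_bound hwm.aestronglyMeasurable W (ae_of_all _ fun z => hw z)
  have hbound : ∀ n : Fin d → ℤ, |∫ z in shiftedCell n, w z * h z|
      ≤ 2 * W * A * d * ∫ z in shiftedCell n, G z := by
    intro n
    have h1 : ∀ z' ∈ shiftedCell n, |∫ z in shiftedCell n, w z * h z|
        ≤ W * (A * d) * ((∫ z in shiftedCell n, G z) + G z') := by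
      intro z' hz'
      have e1 : ∫ z in shiftedCell n, w z * h z = ∫ z in shiftedCell n, w z * (h z - h z') := by
        simp only [mul_sub]
        rw [integral_sub, integral_mul_const, hw0, zero_mul, sub_zero]
        · exact (hint n).bdd_mul hwm.aestronglyMeasurable (ae_of_all _ fun z => hw z)
        · exact (hwint n).mul_const _
      have e2 : (∫ z in shiftedCell n, G z) + G z' = ∫ z in shiftedCell n, (G z + G z') := by
        rw [integral_add hG.integrableOn (integrable_const _)]
        simp
      rw [e1, e2, ← integral_const_mul, ← Real.norm_eq_abs]
      refine norm_integral_le_of_norm_le ((hG.integrableOn.add (integrable_const _)).const_mul _) ?_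
      filter_upwards [ae_restrict_mem (measurableSet_shiftedCell n)] with z hz
      rw [norm_mul, Real.norm_eq_abs, Real.norm_eq_abs, mul_assoc]
      exact mul_le_mul (hw z) (hcell n z hz z' hz') (abs_nonneg _) hW
    have h2 : ∫ _z' in shiftedCell n, |∫ z in shiftedCell n, w z * h z|
        ≤ ∫ z' in shiftedCell n, W * (A * d) * ((∫ z in shiftedCell n, G z) + G z') := by
      refine integral_mono_ae (integrable_const _)
        (((integrable_const _).add hG.integrableOn).const_mul _) ?_
      filter_upwards [ae_restrict_mem (measurableSet_shiftedCell n)] with z' hz' using h1 z' hz'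
    rw [integral_const, integral_const_mul, integral_add (integrable_const _) hG.integrableOn,
      integral_const] at h2
    simp only [probReal_univ, one_smul] at h2
    linarith
  have hsum := (hasSum_integral_shiftedCell hG).mul_left (2 * W * A * d)
  refine ⟨hint, ?_, ?_⟩
  · exact Summable.of_norm_bounded hsum.summable fun n => hbound n
  · rw [← hsum.tsum_eq, ← Real.norm_eq_abs]
    exact tsum_of_norm_bounded hsum.summable.hasSum fun n => hbound n

/-! ### The remainder of the second order Taylor expansion of the symbol -/

/-- The function `ψ(t) = 1 - cos t - t²/2`. -/
def psi (t : ℝ) : ℝ := 1 - Real.cos t - t ^ 2 / 2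

lemma abs_psi_sub_le {a b R : ℝ} (ha : |a| ≤ R) (hb : |b| ≤ R) :
    |psi a - psi b| ≤ 2 * prof R * |a - b| := by
  have hder : ∀ t : ℝ, HasDerivAt psi (Real.sin t - t) t := fun t => by
    have h1 := ((Real.hasDerivAt_cos t).const_sub 1).sub (((hasDerivAt_id t).pow 2).div_const 2)
    refine h1.congr_deriv ?_
    simp
  have h := Convex.norm_image_sub_le_of_norm_hasDerivWithin_le (s := Icc (-R) R) (f := psi)
    (C := 2 * prof R) (fun t _ => (hder t).hasDerivWithinAt) (fun t ht => by
      rw [Real.norm_eq_abs]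
      refine (abs_sin_sub_le_prof t).trans ?_
      have := prof_mono (abs_nonneg t) (abs_le.2 ht)
      linarith) (convex_Icc _ _) (abs_le.1 hb) (abs_le.1 ha)
  simpa [Real.norm_eq_abs] using h

lemma abs_psi_le (a : ℝ) : |psi a| ≤ 2 * prof |a| * |a| := by
  have h := abs_psi_sub_le (a := a) (b := 0) le_rfl (by simp)
  simpa [psi] using h

lemma rpow_neg_sub_le {p r s : ℝ} (hp : 0 ≤ p) (hr : 0 < r) (hrs : r ≤ s) :
    r * |r ^ (-p) - s ^ (-p)| ≤ p * r ^ (-p) * (s - r) := by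
  have hs : 0 < s := hr.trans_le hrs
  have h0 : s ^ (-p) ≤ r ^ (-p) := Real.rpow_le_rpow_of_nonpos hr hrs (by linarith)
  rw [abs_of_nonneg (by linarith)]
  have hx : 0 < s / r := by positivity
  have h1 : 1 - p * (s / r - 1) ≤ (s / r) ^ (-p) := by
    rw [Real.rpow_def_of_pos hx]
    have h2 := Real.add_one_le_exp (Real.log (s / r) * -p)
    have h3 := Real.log_le_sub_one_of_pos hx
    nlinarith
  have h2 : s ^ (-p) = r ^ (-p) * (s / r) ^ (-p) := by
    rw [← Real.mul_rpow hr.le hx.le, mul_div_cancel₀ _ hr.ne']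
  have hrp : 0 < r ^ (-p) := by positivity
  rw [h2]
  have h4 : r * (s / r - 1) = s - r := by field_simp
  calc r * (r ^ (-p) - r ^ (-p) * (s / r) ^ (-p)) = r * r ^ (-p) * (1 - (s / r) ^ (-p)) := by ring
    _ ≤ r * r ^ (-p) * (p * (s / r - 1)) := by
      apply mul_le_mul_of_nonneg_left _ (by positivity)
      linarith
    _ = p * r ^ (-p) * (r * (s / r - 1)) := by ring
    _ = p * r ^ (-p) * (s - r) := by rw [h4]

/-- The function `(1 - cos⟨ξ,z⟩ - ⟨ξ,z⟩²/2) |z|^{-d-α}`. -/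
def remFun (α : ℝ) (ξ z : E d) : ℝ := psi (inner ℝ ξ z) * ‖z‖ ^ (-((d : ℝ) + α))

/-- A majorant, up to a constant, for the gradient of `remFun`. It is integrable, since each
derivative of `ψ(⟨ξ,z⟩)` brings a factor `|ξ|` and `ψ'(t) = sin t - t` is controlled by
`min(|t|, t²)`. -/
def remMaj (α : ℝ) (ξ z : E d) : ℝ :=
  2 * ‖ξ‖ * (prof (‖ξ‖ * ‖z‖) * ‖z‖ ^ (-((d : ℝ) + α)))

lemma remMaj_nonneg (α : ℝ) (ξ z : E d) : 0 ≤ remMaj α ξ z := by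
  have := prof_nonneg (mul_nonneg (norm_nonneg ξ) (norm_nonneg z))
  unfold remMaj; positivity

lemma abs_remFun_sub_le (hα : 0 ≤ α) (ξ z z' : E d) :
    |remFun α ξ z - remFun α ξ z'|
      ≤ (1 + (d + α)) * ‖z - z'‖ * (remMaj α ξ z + remMaj α ξ z') := by
  wlog hzz : ‖z‖ ≤ ‖z'‖ generalizing z z'
  · have := this z' z (le_of_not_ge hzz)
    rwa [abs_sub_comm, norm_sub_rev, add_comm (remMaj α ξ z)]
  have hp : 0 ≤ (d : ℝ) + α := by positivity
  set p : ℝ := d + α with hpdef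
  have e : remFun α ξ z - remFun α ξ z' = (psi (inner ℝ ξ z) - psi (inner ℝ ξ z')) * ‖z'‖ ^ (-p)
      + psi (inner ℝ ξ z) * (‖z‖ ^ (-p) - ‖z'‖ ^ (-p)) := by
    simp only [remFun, ← hpdef]; ring
  have h1 : |(psi (inner ℝ ξ z) - psi (inner ℝ ξ z')) * ‖z'‖ ^ (-p)|
      ≤ ‖z - z'‖ * remMaj α ξ z' := by
    rw [abs_mul, abs_of_nonneg (by positivity : 0 ≤ ‖z'‖ ^ (-p))]
    have a1 : |(inner ℝ ξ z : ℝ)| ≤ ‖ξ‖ * ‖z'‖ := (abs_real_inner_le_norm ξ z).trans (by gcongr)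
    have a2 := abs_psi_sub_le a1 (abs_real_inner_le_norm ξ z')
    rw [← inner_sub_right] at a2
    have a3 := abs_real_inner_le_norm ξ (z - z')
    have a4 := prof_nonneg (mul_nonneg (norm_nonneg ξ) (norm_nonneg z'))
    calc _ ≤ (2 * prof (‖ξ‖ * ‖z'‖) * (‖ξ‖ * ‖z - z'‖)) * ‖z'‖ ^ (-p) := by
          gcongr
          exact a2.trans (by gcongr)
      _ = _ := by simp only [remMaj, ← hpdef]; ring
  have h2 : |psi (inner ℝ ξ z) * (‖z‖ ^ (-p) - ‖z'‖ ^ (-p))| ≤ p * ‖z - z'‖ * remMaj α ξ z := by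
    rcases eq_or_ne z 0 with rfl | hz
    · simp only [inner_zero_right, psi, Real.cos_zero]
      have := remMaj_nonneg α ξ (0 : E d)
      simp only [sub_self, ne_eq, OfNat.ofNat_ne_zero, not_false_eq_true, zero_pow, zero_div,
        zero_mul, abs_zero]
      positivity
    have hz0 : 0 < ‖z‖ := norm_pos_iff.2 hz
    have b0 := prof_nonneg (mul_nonneg (norm_nonneg ξ) (norm_nonneg z))
    have b1 : |psi (inner ℝ ξ z)| ≤ 2 * prof (‖ξ‖ * ‖z‖) * (‖ξ‖ * ‖z‖) := by
      refine (abs_psi_le _).trans ?_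
      have := prof_mono (abs_nonneg _) (abs_real_inner_le_norm ξ z)
      have := abs_real_inner_le_norm ξ z
      have := prof_nonneg (abs_nonneg (inner ℝ ξ z))
      gcongr
    have b2 := rpow_neg_sub_le hp hz0 hzz
    have b3 : ‖z'‖ - ‖z‖ ≤ ‖z - z'‖ := by
      rw [norm_sub_rev]; exact norm_sub_norm_le _ _
    rw [abs_mul]
    calc _ ≤ 2 * prof (‖ξ‖ * ‖z‖) * (‖ξ‖ * ‖z‖) * |‖z‖ ^ (-p) - ‖z'‖ ^ (-p)| := by gcongr
      _ = 2 * prof (‖ξ‖ * ‖z‖) * ‖ξ‖ * (‖z‖ * |‖z‖ ^ (-p) - ‖z'‖ ^ (-p)|) := by ring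
      _ ≤ 2 * prof (‖ξ‖ * ‖z‖) * ‖ξ‖ * (p * ‖z‖ ^ (-p) * (‖z'‖ - ‖z‖)) := by gcongr
      _ ≤ 2 * prof (‖ξ‖ * ‖z‖) * ‖ξ‖ * (p * ‖z‖ ^ (-p) * ‖z - z'‖) := by gcongr
      _ = _ := by simp only [remMaj, ← hpdef]; ring
  rw [e]
  refine (abs_add_le _ _).trans ((add_le_add h1 h2).trans ?_)
  have := remMaj_nonneg α ξ z
  have := remMaj_nonneg α ξ z'
  have c1 : 0 ≤ ‖z - z'‖ * remMaj α ξ z := by positivity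
  have c2 : 0 ≤ p * (‖z - z'‖ * remMaj α ξ z') := by positivity
  nlinarith

lemma integrable_of_levyMeasure {f : E d → ℝ} (hf : Measurable f) (hf0 : ∀ z, 0 ≤ f z)
    (h : ∫⁻ z, ENNReal.ofReal (f z) ∂(levyMeasure d α) ≠ ⊤) :
    Integrable (fun z => f z * ‖z‖ ^ (-((d : ℝ) + α))) ∧
      ∫ z, f z * ‖z‖ ^ (-((d : ℝ) + α))
        = (∫⁻ z, ENNReal.ofReal (f z) ∂(levyMeasure d α)).toReal := by
  have e : ∫⁻ z, ENNReal.ofReal (f z) ∂(levyMeasure d α)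
      = ∫⁻ z, ENNReal.ofReal (f z * ‖z‖ ^ (-((d : ℝ) + α))) := by
    rw [lintegral_levyMeasure α (by fun_prop)]
    refine lintegral_congr fun z => ?_
    rw [mul_comm (f z), ENNReal.ofReal_mul (by positivity)]
  have h0 : ∀ z : E d, 0 ≤ f z * ‖z‖ ^ (-((d : ℝ) + α)) := fun z => by
    have := hf0 z; positivity
  refine ⟨?_, ?_⟩
  · rw [e] at h
    exact (lintegral_ofReal_ne_top_iff_integrable (by fun_prop) (ae_of_all _ h0)).1 h
  · rw [e, integral_eq_lintegral_of_nonneg_ae (ae_of_all _ h0) (by fun_prop)]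

lemma integrable_remMaj (hd : 1 ≤ d) (hα : 1 < α) (hα2 : α < 2) (ξ : E d) :
    Integrable (remMaj α ξ) ∧ ∫ z, remMaj α ξ z = 2 * profInt d α * ‖ξ‖ ^ (1 + α) := by
  have h1 := lintegral_prof hd hα hα2 (norm_nonneg ξ)
  obtain ⟨h2, h3⟩ := integrable_of_levyMeasure (α := α) (f := fun z : E d => prof (‖ξ‖ * ‖z‖))
    (by fun_prop) (fun z => prof_nonneg (by positivity)) (by rw [h1]; exact ENNReal.ofReal_ne_top)
  have hP := profInt_nonneg (d := d) α
  refine ⟨h2.const_mul _, ?_⟩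
  unfold remMaj
  rw [integral_const_mul, h3, h1, ENNReal.toReal_ofReal (by positivity),
    Real.rpow_add' (norm_nonneg _) (by linarith), Real.rpow_one]
  ring

/-- The function `(1 - cos⟨ξ,z⟩) |z|^{-d-α}`. -/
def symbFun (α : ℝ) (ξ z : E d) : ℝ := (1 - Real.cos (inner ℝ ξ z)) * ‖z‖ ^ (-((d : ℝ) + α))

lemma integrable_symbFun (hd : 1 ≤ d) (hα : 1 < α) (hα2 : α < 2) (ξ : E d) :
    Integrable (symbFun α ξ) ∧ ∫ z, symbFun α ξ z = symb d α ξ / 2 := by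
  have e : ∫⁻ z, ENNReal.ofReal (2 * (1 - Real.cos (inner ℝ ξ z))) ∂(levyMeasure d α)
      = esymb d α ξ := by
    refine lintegral_congr fun z => ?_
    rw [enorm_sq_eq, norm_one_sub_phase_sq]
  obtain ⟨h2, h3⟩ := integrable_of_levyMeasure (α := α)
    (f := fun z : E d => 2 * (1 - Real.cos (inner ℝ ξ z)))
    (by fun_prop) (fun z => by linarith [Real.cos_le_one (inner ℝ ξ z)])
    (by rw [e]; exact esymb_ne_top hd hα hα2 ξ)
  have h4 : symbFun α ξ = fun z => 1 / 2 *
      (2 * (1 - Real.cos (inner ℝ ξ z)) * ‖z‖ ^ (-((d : ℝ) + α))) := by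
    ext z; unfold symbFun; ring
  rw [h4]
  refine ⟨h2.const_mul _, ?_⟩
  rw [integral_const_mul, h3, e, symb]
  ring

/-- The function `⟨ξ,z⟩² |z|^{-d-α} / 2`. -/
def quadFun (α : ℝ) (ξ z : E d) : ℝ := inner ℝ ξ z ^ 2 / 2 * ‖z‖ ^ (-((d : ℝ) + α))

lemma quadFun_eq (α : ℝ) (ξ z : E d) : quadFun α ξ z = symbFun α ξ z - remFun α ξ z := by
  unfold quadFun symbFun remFun psi; ring

/-- The Taylor expansion of the lattice sum with a weight of mean value zero over the cells. -/
lemma lattice_taylor (hd : 1 ≤ d) (hα : 1 < α) (hα2 : α < 2) {w : E d → ℝ} {W : ℝ}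
    (hwm : Measurable w) (hw : ∀ z, |w z| ≤ W)
    (hw0 : ∀ n : Fin d → ℤ, ∫ z in shiftedCell n, w z = 0) (ξ : E d) :
    (∀ n : Fin d → ℤ, IntegrableOn (quadFun α ξ) (shiftedCell n)) ∧
    ∃ T : ℝ, |T| ≤ 4 * W * (1 + (d + α)) * d * profInt d α * ‖ξ‖ ^ (1 + α) ∧
      HasSum (fun n : Fin d → ℤ => ∫ z in shiftedCell n, w z * quadFun α ξ z)
        ((∫ z, w z * symbFun α ξ z) - T) := by
  obtain ⟨hG, hGint⟩ := integrable_remMaj hd hα hα2 ξ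
  have hmeas : Measurable (remFun α ξ) := by unfold remFun psi; fun_prop
  obtain ⟨h1, h2, h3⟩ := lattice_sum_bound hwm hw hw0 hmeas (by positivity) hG
    (abs_remFun_sub_le (by linarith) ξ) (remMaj_nonneg α ξ)
  obtain ⟨h4, -⟩ := integrable_symbFun hd hα hα2 ξ
  have hq : quadFun α ξ = fun z => symbFun α ξ z - remFun α ξ z := funext (quadFun_eq α ξ)
  have h5 : Integrable fun z => w z * symbFun α ξ z :=
    h4.bdd_mul hwm.aestronglyMeasurable (ae_of_all _ fun z => hw z)
  refine ⟨fun n => hq ▸ h4.integrableOn.sub (h1 n),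
    ∑' n : Fin d → ℤ, ∫ z in shiftedCell n, w z * remFun α ξ z, ?_, ?_⟩
  · refine h3.trans (le_of_eq ?_)
    rw [hGint]; ring
  · refine ((hasSum_integral_shiftedCell h5).sub h2.hasSum).congr_fun fun n => ?_
    rw [← integral_sub]
    · refine integral_congr_ae (ae_of_all _ fun z => ?_)
      dsimp only
      rw [hq]; ring
    · exact h5.integrableOn
    · exact (h1 n).bdd_mul hwm.aestronglyMeasurable (ae_of_all _ fun z => hw z)

/-! ### Averages of the coefficient -/

/-- The average `∫_Ω m(x,z) dx`, equal to `μ_*(z) + μ⁰`. -/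
def avgCoeff (m : E d × E d → ℝ) (z : E d) : ℝ := ∫ x in cell d, m (x, z)

/-- What is used of a coefficient `μ`: it is given, in the coordinates `(x, z) = (x, y - x)`, by a
bounded measurable function `m`, and `μ_*` has mean value zero over every cell. -/
structure CoeffData (μm μp : ℝ) (μ : E d → E d → ℝ) (m : E d × E d → ℝ) : Prop where
  good : GoodCoeff μm μp m
  ae_eq : ∀ᵐ q ∂((cm d).prod volume), μ q.1 (q.1 + q.2) = m q
  mean : ∀ n : Fin d → ℤ, ∫ z in shiftedCell n, avgCoeff m z = meanCoeff μ

lemma GoodCoeff.bound (hm : GoodCoeff μm μp m) (q : E d × E d) : ‖m q‖ ≤ μp := by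
  rw [Real.norm_eq_abs, abs_of_pos (hm.pos.trans_le (hm.ge q))]
  exact hm.le q

lemma GoodCoeff.measurable_avg (hm : GoodCoeff μm μp m) : Measurable (avgCoeff m) := by
  exact (StronglyMeasurable.integral_prod_left (μ := cm d) (f := fun x z => m (x, z))
    hm.measurable.stronglyMeasurable).measurable

lemma GoodCoeff.integrable_slice (hm : GoodCoeff μm μp m) (z : E d) :
    Integrable (fun x => m (x, z)) (cm d) :=
  Integrable.of_bound (hm.measurable.comp (by fun_prop)).aestronglyMeasurable μp
    (ae_of_all _ fun x => hm.bound _)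

lemma GoodCoeff.avg_mem (hm : GoodCoeff μm μp m) (z : E d) : avgCoeff m z ∈ Icc μm μp := by
  constructor
  · have := integral_mono (μ := cm d) (integrable_const μm) (hm.integrable_slice z)
      fun x => hm.ge (x, z)
    simpa [avgCoeff] using this
  · have := integral_mono (μ := cm d) (hm.integrable_slice z) (integrable_const μp)
      fun x => hm.le (x, z)
    simpa [avgCoeff] using this

lemma CoeffData.meanCoeff_mem {μ : E d → E d → ℝ} (h : CoeffData μm μp μ m) :
    meanCoeff μ ∈ Icc μm μp := by
  rw [← h.mean 0]
  have hint : IntegrableOn (avgCoeff m) (shiftedCell 0) :=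
    Integrable.of_bound h.good.measurable_avg.aestronglyMeasurable μp (ae_of_all _ fun z => by
      have := h.good.avg_mem z
      rw [Real.norm_eq_abs, abs_of_pos (h.good.pos.trans_le this.1)]
      exact this.2)
  constructor
  · have := integral_mono (μ := volume.restrict (shiftedCell (0 : Fin d → ℤ)))
      (integrable_const μm) hint fun z => (h.good.avg_mem z).1
    simpa using this
  · have := integral_mono (μ := volume.restrict (shiftedCell (0 : Fin d → ℤ)))
      hint (integrable_const μp) fun z => (h.good.avg_mem z).2
    simpa using this

lemma CoeffData.muStar_ae {μ : E d → E d → ℝ} (h : CoeffData μm μp μ m) :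
    ∀ᵐ z : E d, muStar μ z = avgCoeff m z - meanCoeff μ := by
  have h1 : ∀ᵐ q ∂((volume : Measure (E d)).prod (cm d)), μ q.2 (q.2 + q.1) = m (q.2, q.1) :=
    (Measure.measurePreserving_swap (μ := (volume : Measure (E d)))
      (ν := cm d)).quasiMeasurePreserving.ae h.ae_eq
  filter_upwards [Measure.ae_ae_of_ae_prod h1] with z hz
  rw [muStar, avgCoeff]
  congr 1
  refine integral_congr_ae ?_
  filter_upwards [hz] with x hx
  rw [add_comm, hx]

/-- A coefficient has a representative in the coordinates `(x, y - x)` that satisfies the bounds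
everywhere. The periodicity gives the mean value of `μ_*` over each cell. -/
lemma exists_coeffData (hμm : 0 < μm) {μ : E d → E d → ℝ} (h : IsCoefficient μm μp μ) :
    ∃ m, CoeffData μm μp μ m := by
  have hle : μm ≤ μp := by
    obtain ⟨p, hp⟩ := h.bounds.exists
    exact hp.1.trans hp.2
  obtain ⟨F, hF, hFμ⟩ := h.aemeasurable
  set F' : E d × E d → ℝ := fun p => max μm (min μp (F p)) with hF'
  have hF'm : Measurable F' := by fun_prop
  have hF'μ : ∀ᵐ p : E d × E d, μ p.1 p.2 = F' p := by
    filter_upwards [hFμ, h.bounds] with p h1 h2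
    simp only [hF', ← h1]
    rw [min_eq_right h2.2, max_eq_right h2.1]
  have hac : (cm d).prod (volume : Measure (E d)) ≪ volume :=
    cm_ac.prod Measure.AbsolutelyContinuous.rfl
  have hper : ∀ᵐ p : E d × E d, ∀ n : Fin d → ℤ, μ p.1 (p.2 + latticeVec n) = μ p.1 p.2 := by
    rw [ae_all_iff]
    intro n
    filter_upwards [h.periodic 0 n] with p hp
    have h0 : p.1 + latticeVec (0 : Fin d → ℤ) = p.1 := by ext i; simp
    rw [← hp, h0]
  have hfr : Measure.QuasiMeasurePreserving (fun p : E d × E d => (p.1, fractE p.2))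
      ((cm d).prod volume) ((cm d).prod (cm d)) :=
    MeasureTheory.QuasiMeasurePreserving.prodMap (Measure.QuasiMeasurePreserving.id _) quasiMeasurePreserving_fractE
  have hac2 : (cm d).prod (cm d) ≪ volume := cm_ac.prod cm_ac
  -- by periodicity the coefficient on `Ω × ℝ^d` is given by its values on `Ω × Ω`
  have hxy : ∀ᵐ p ∂((cm d).prod (volume : Measure (E d))), μ p.1 p.2 = F' (p.1, fractE p.2) := by
    have a1 := hfr.ae (hac2.ae_le (hF'μ.and hper))
    filter_upwards [a1] with p hp
    obtain ⟨n, hn⟩ := exists_fractE_eq p.2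
    rw [← hp.1, ← hp.2 n]
    rw [← hn]
  set m : E d × E d → ℝ := fun q => F' (q.1, fractE (q.1 + q.2)) with hm
  have hmm : Measurable m := by
    have : Measurable fun q : E d × E d => (q.1, fractE (q.1 + q.2)) := by fun_prop
    exact hF'm.comp this
  have hgood : GoodCoeff μm μp m :=
    ⟨hμm, hmm, fun q => le_max_left _ _, fun q => max_le hle (min_le_left _ _)⟩
  refine ⟨m, hgood, ?_, fun n => ?_⟩
  · exact (measurePreserving_prod_add (cm d) (volume : Measure (E d))).quasiMeasurePreserving.ae hxy
  · have hmean : meanCoeff μ = ∫ x in cell d, ∫ y in cell d, F' (x, y) := by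
      rw [meanCoeff, Measure.volume_eq_prod, ← Measure.prod_restrict,
        integral_congr_ae (hac2.ae_le hF'μ), integral_prod]
      exact Integrable.of_bound hF'm.aestronglyMeasurable μp (ae_of_all _ fun p => by
        have h1 : μm ≤ F' p := le_max_left _ _
        rw [Real.norm_eq_abs, abs_of_pos (hμm.trans_le h1)]
        exact max_le hle (min_le_left _ _))
    have hswap : ∫ z in shiftedCell n, avgCoeff m z
        = ∫ x in cell d, ∫ z in shiftedCell n, m (x, z) := by
      unfold avgCoeff
      refine integral_integral_swap (f := fun z x => m (x, z)) ?_
      exact Integrable.of_bound (hmm.comp (by fun_prop)).aestronglyMeasurable μp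
        (ae_of_all _ fun p => hgood.bound _)
    rw [hswap, hmean]
    congr 1
    ext x
    have e1 := (measurePreserving_add_right (volume : Measure (E d))
      (latticeVec n)).setIntegral_preimage_emb (MeasurableEquiv.addRight _).measurableEmbedding
      (fun z => m (x, z)) (shiftedCell n)
    have e2 : (fun z : E d => z + latticeVec n) ⁻¹' shiftedCell n = cell d := by
      rw [shiftedCell_eq_preimage]
      ext z
      simp only [mem_preimage]
      congr! 1
      ext i; simp
    rw [e2] at e1
    rw [← e1]
    have e3 := (measurePreserving_fractE_add x).map_eq
    have e4 := integral_map (μ := cm d) (φ := fun z => fractE (z + x)) (by fun_prop)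
      (f := fun y => F' (x, y)) (hF'm.comp (by fun_prop)).aestronglyMeasurable
    rw [e3] at e4
    rw [e4]
    congr 1
    ext z
    simp only [hm]
    congr 2
    rw [← fractE_add_latticeVec (z + x) n]
    congr 1
    abel

/-! ### The second part of the effective matrix -/

/-- The second term `∑_n ∫_{Ω+n} μ_*(z) z_j z_k / (2 |z|^{d+α}) dz` of the effective matrix. -/
def starMatrix (α : ℝ) (μ : E d → E d → ℝ) (j k : Fin d) : ℝ :=
  ∑' n : Fin d → ℤ, ∫ z in shiftedCell n, muStar μ z * z j * z k / (2 * ‖z‖ ^ ((d : ℝ) + α))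

lemma inner_sq_eq (ξ z : E d) : (inner ℝ ξ z : ℝ) ^ 2 = ∑ j, ∑ k, ξ j * ξ k * (z j * z k) := by
  rw [PiLp.inner_apply, sq, Finset.sum_mul_sum]
  refine Finset.sum_congr rfl fun j _ => Finset.sum_congr rfl fun k _ => ?_
  simp only [RCLike.inner_apply, conj_trivial]
  ring

/-- The expansion of `∫ μ_*(z) (1 - cos⟨ξ,z⟩) |z|^{-d-α} dz` for small `ξ`. -/
lemma CoeffData.expansion (hd : 1 ≤ d) (hα : 1 < α) (hα2 : α < 2) {μ : E d → E d → ℝ}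
    (h : CoeffData μm μp μ m) (ξ : E d) :
    |(∫ z, (avgCoeff m z - meanCoeff μ) * symbFun α ξ z) - qform (starMatrix α μ) ξ|
      ≤ 4 * μp * (1 + (d + α)) * d * profInt d α * ‖ξ‖ ^ (1 + α) := by
  set w : E d → ℝ := fun z => avgCoeff m z - meanCoeff μ with hw
  have hwm : Measurable w := h.good.measurable_avg.sub_const _
  have hwb : ∀ z, |w z| ≤ μp := fun z => by
    have h1 := h.good.avg_mem z
    have h2 := h.meanCoeff_mem
    have := h.good.pos
    rw [abs_le]
    constructor <;> simp only [hw] <;> linarith [h1.1, h1.2, h2.1, h2.2]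
  have hw0 : ∀ n : Fin d → ℤ, ∫ z in shiftedCell n, w z = 0 := fun n => by
    rw [hw, integral_sub, h.mean n]
    · simp
    · exact Integrable.of_bound h.good.measurable_avg.aestronglyMeasurable μp (ae_of_all _ fun z => by
        have := h.good.avg_mem z
        rw [Real.norm_eq_abs, abs_of_pos (h.good.pos.trans_le this.1)]
        exact this.2)
    · exact integrable_const _
  have key := fun ξ : E d => lattice_taylor hd hα hα2 hwm hwb hw0 ξ
  set b : Fin d → E d := fun j => EuclideanSpace.single j (1 : ℝ) with hb
  have hb' : ∀ j (z : E d), inner ℝ (b j) z = z j := fun j z => by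
    simp [hb, EuclideanSpace.inner_single_left]
  -- the entries of the matrix, by polarization
  have hpol : ∀ j k (z : E d), w z * z j * z k / (2 * ‖z‖ ^ ((d : ℝ) + α))
      = 1 / 2 * (w z * quadFun α (b j + b k) z - w z * quadFun α (b j) z
        - w z * quadFun α (b k) z) := fun j k z => by
    simp only [quadFun, inner_add_left, hb']
    rw [Real.rpow_neg (norm_nonneg _), div_eq_mul_inv, mul_inv]
    ring
  have hqint : ∀ (ξ : E d) (n : Fin d → ℤ),
      IntegrableOn (fun z => w z * quadFun α ξ z) (shiftedCell n) := fun ξ n =>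
    ((key ξ).1 n).bdd_mul hwm.aestronglyMeasurable (ae_of_all _ fun z => hwb z)
  have hjkint : ∀ j k (n : Fin d → ℤ),
      IntegrableOn (fun z => w z * z j * z k / (2 * ‖z‖ ^ ((d : ℝ) + α))) (shiftedCell n) :=
    fun j k n => by
      simp only [hpol]
      exact (((hqint _ n).sub (hqint _ n)).sub (hqint _ n)).const_mul _
  have hsumm : ∀ j k, Summable fun n : Fin d → ℤ =>
      ∫ z in shiftedCell n, w z * z j * z k / (2 * ‖z‖ ^ ((d : ℝ) + α)) := fun j k => by
    obtain ⟨T1, -, h1⟩ := (key (b j + b k)).2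
    obtain ⟨T2, -, h2⟩ := (key (b j)).2
    obtain ⟨T3, -, h3⟩ := (key (b k)).2
    refine (((h1.summable.sub h2.summable).sub h3.summable).mul_left (1 / 2)).congr fun n => ?_
    simp only [hpol]
    have i1 : IntegrableOn (fun z => w z * quadFun α (b j + b k) z - w z * quadFun α (b j) z)
      (shiftedCell n) := (hqint _ n).sub (hqint _ n)
    rw [integral_const_mul, integral_sub i1 (hqint _ n), integral_sub (hqint _ n) (hqint _ n)]
  have hstar : ∀ j k, HasSum (fun n : Fin d → ℤ =>
      ∫ z in shiftedCell n, w z * z j * z k / (2 * ‖z‖ ^ ((d : ℝ) + α))) (starMatrix α μ j k) := by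
    intro j k
    have e : starMatrix α μ j k = ∑' n : Fin d → ℤ,
        ∫ z in shiftedCell n, w z * z j * z k / (2 * ‖z‖ ^ ((d : ℝ) + α)) := by
      refine tsum_congr fun n => integral_congr_ae ?_
      filter_upwards [ae_restrict_of_ae h.muStar_ae] with z hz
      rw [hz]
    rw [e]
    exact (hsumm j k).hasSum
  have hq : HasSum (fun n : Fin d → ℤ => ∫ z in shiftedCell n, w z * quadFun α ξ z)
      (qform (starMatrix α μ) ξ) := by
    have h1 : HasSum (fun n : Fin d → ℤ => ∑ j, ∑ k, (ξ j * ξ k) *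
        ∫ z in shiftedCell n, w z * z j * z k / (2 * ‖z‖ ^ ((d : ℝ) + α)))
        (∑ j, ∑ k, (ξ j * ξ k) * starMatrix α μ j k) :=
      hasSum_sum fun j _ => hasSum_sum fun k _ => (hstar j k).mul_left _
    have e1 : qform (starMatrix α μ) ξ = ∑ j, ∑ k, (ξ j * ξ k) * starMatrix α μ j k := by
      simp only [qform]
      refine Finset.sum_congr rfl fun j _ => Finset.sum_congr rfl fun k _ => by ring
    rw [e1]
    refine h1.congr_fun fun n => ?_
    simp only [← integral_const_mul]
    rw [← integral_congr_ae (ae_of_all _ fun z => ?_),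
      integral_finsetSum _ fun j _ => integrable_finsetSum _ fun k _ => (hjkint j k n).const_mul _]
    · refine Finset.sum_congr rfl fun j _ => ?_
      rw [integral_finsetSum _ fun k _ => (hjkint j k n).const_mul _]
    · simp only [quadFun, inner_sq_eq, Finset.sum_div, Finset.sum_mul, Finset.mul_sum]
      refine Finset.sum_congr rfl fun j _ => Finset.sum_congr rfl fun k _ => ?_
      rw [Real.rpow_neg (norm_nonneg _), div_eq_mul_inv, mul_inv]
      ring
  obtain ⟨T, hT, hsum⟩ := (key ξ).2
  rw [hq.unique hsum, sub_sub_cancel]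
  exact hT

/-- The quadratic form of the second part of the effective matrix is bounded; the bound on the
unit sphere comes from the expansion. -/
lemma CoeffData.abs_qform_starMatrix_le (hd : 1 ≤ d) (hα : 1 < α) (hα2 : α < 2)
    {μ : E d → E d → ℝ} (h : CoeffData μm μp μ m) (ξ : E d) :
    |qform (starMatrix α μ) ξ|
      ≤ (μp + 4 * μp * (1 + (d + α)) * d) * profInt d α * ‖ξ‖ ^ 2 := by
  have hP := profInt_nonneg (d := d) α
  have hμp := h.good.pos'
  have unit : ∀ e : E d, ‖e‖ = 1 → |qform (starMatrix α μ) e|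
      ≤ (μp + 4 * μp * (1 + (d + α)) * d) * profInt d α := by
    intro e he
    have h1 := h.expansion hd hα hα2 e
    obtain ⟨h2, h3⟩ := integrable_symbFun hd hα hα2 e
    have h4 : |∫ z, (avgCoeff m z - meanCoeff μ) * symbFun α e z| ≤ μp * (symb d α e / 2) := by
      rw [← h3, ← integral_const_mul, ← Real.norm_eq_abs]
      refine norm_integral_le_of_norm_le (h2.const_mul _) (ae_of_all _ fun z => ?_)
      have h0 : 0 ≤ symbFun α e z := mul_nonneg
        (by linarith [Real.cos_le_one (inner ℝ e z)]) (by positivity)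
      rw [norm_mul, Real.norm_of_nonneg h0, Real.norm_eq_abs]
      refine mul_le_mul_of_nonneg_right ?_ h0
      have a1 := h.good.avg_mem z
      have a2 := h.meanCoeff_mem
      have := h.good.pos
      rw [abs_le]
      constructor <;> linarith [a1.1, a1.2, a2.1, a2.2]
    have h5 := symb_le hd hα hα2 e
    rw [he, Real.one_rpow, mul_one] at h1 h5
    have h6 : |qform (starMatrix α μ) e| ≤ |∫ z, (avgCoeff m z - meanCoeff μ) * symbFun α e z|
        + |(∫ z, (avgCoeff m z - meanCoeff μ) * symbFun α e z) - qform (starMatrix α μ) e| := by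
      have := abs_sub (∫ z, (avgCoeff m z - meanCoeff μ) * symbFun α e z)
        ((∫ z, (avgCoeff m z - meanCoeff μ) * symbFun α e z) - qform (starMatrix α μ) e)
      rwa [sub_sub_cancel] at this
    nlinarith
  rcases eq_or_ne ξ 0 with rfl | hξ
  · simp [qform]
  · have hξ0 : 0 < ‖ξ‖ := norm_pos_iff.2 hξ
    have h1 := unit (‖ξ‖⁻¹ • ξ) (by rw [norm_smul, norm_inv, norm_norm, inv_mul_cancel₀ hξ0.ne'])
    have h2 : qform (starMatrix α μ) ξ = ‖ξ‖ ^ 2 * qform (starMatrix α μ) (‖ξ‖⁻¹ • ξ) := by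
      simp only [qform, Finset.mul_sum, PiLp.smul_apply, smul_eq_mul]
      refine Finset.sum_congr rfl fun j _ => Finset.sum_congr rfl fun k _ => ?_
      field_simp
    rw [h2, abs_mul, abs_of_nonneg (by positivity), mul_comm]
    gcongr

/-! ### The form on the constants -/

lemma freq_zero : freq (0 : Fin d → ℤ) = 0 := by ext i; simp [freq]

lemma delta_one_ae (ξ : E d) :
    delta ξ (expL (0 : Fin d → ℤ)) =ᵐ[(cm d).prod volume] fun q => 1 - phase ξ q.2 := by
  refine (delta_expL_ae ξ 0).trans (ae_of_all _ fun q => ?_)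
  simp [freq_zero]

lemma fmap_zero_one {e : formDom α m} (he : (e : L2 d) = expL 0) : fmap α m 0 e = 0 := by
  refine Lp.ext ?_
  filter_upwards [coeFn_fmap 0 e, (formMeasure_ac α m).ae_le (delta_one_ae (d := d) 0),
    Lp.coeFn_zero ℂ 2 (formMeasure α m)] with q h1 h2 h3
  rw [h1, h3, he, h2]
  simp

lemma fmap_one_norm_sq (hd : 1 ≤ d) (hα : 1 < α) (hα2 : α < 2) (hm : GoodCoeff μm μp m)
    {e : formDom α m} (he : (e : L2 d) = expL 0) (ξ : E d) :
    inner ℂ (fmap α m ξ e) (fmap α m ξ e) = ((∫ z, avgCoeff m z * symbFun α ξ z : ℝ) : ℂ) := by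
  have h1 : inner ℂ (fmap α m ξ e) (fmap α m ξ e)
      = ∫ q, ((2 * (1 - Real.cos (inner ℝ ξ q.2)) : ℝ) : ℂ) ∂(formMeasure α m) := by
    rw [inner_fmap]
    refine integral_congr_ae ?_
    filter_upwards [(formMeasure_ac α m).ae_le (delta_one_ae ξ)] with q hq
    rw [he, hq, Complex.mul_conj, Complex.normSq_eq_norm_sq, norm_one_sub_phase_sq]
  rw [h1, integral_complex_ofReal, integral_formMeasure hm]
  congr 1
  obtain ⟨hs, -⟩ := integrable_symbFun hd hα hα2 ξ
  have h2 : ∀ q : E d × E d, (m q / 2 * ‖q.2‖ ^ (-((d : ℝ) + α))) •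
      (2 * (1 - Real.cos (inner ℝ ξ q.2))) = m q * symbFun α ξ q.2 := fun q => by
    rw [symbFun, smul_eq_mul]; ring
  simp only [h2]
  rw [integral_prod_symm]
  · refine integral_congr_ae (ae_of_all _ fun z => ?_)
    dsimp only
    rw [integral_mul_const, avgCoeff]
  · exact (hs.comp_snd (cm d)).bdd_mul hm.measurable.aestronglyMeasurable
      (ae_of_all _ fun q => hm.bound q)

/-- A bound for `‖𝒟_ξ u - 𝒟_0 u‖`, where `𝒟_ξ` stands for `fmap`. -/
lemma norm_fmap_sub_le (hm : GoodCoeff μm μp m) (hd : 1 ≤ d) (hα : 1 < α) (hα2 : α < 2)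
    (ξ : E d) (u : formDom α m) :
    ‖fmap α m ξ u - fmap α m 0 u‖ ≤ √(μp * profInt d α) * ‖ξ‖ ^ (α / 2) * ‖(u : L2 d)‖ := by
  have h1 := norm_fmap_sub_sq_le hm hd hα hα2 ξ u
  have h2 := symb_le hd hα hα2 ξ
  have h3 := hm.pos'
  have h4 := profInt_nonneg (d := d) α
  refine abs_le_of_sq_le_sq' ?_ (by positivity) |>.2
  rw [mul_pow, mul_pow, Real.sq_sqrt (by positivity), ← Real.rpow_mul_natCast (norm_nonneg _)]
  have e : α / 2 * ((2 : ℕ) : ℝ) = α := by push_cast; ring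
  rw [e]
  refine h1.trans ?_
  calc μp / 2 * (symb d α ξ * ‖(u : L2 d)‖ ^ 2)
      ≤ μp / 2 * (2 * profInt d α * ‖ξ‖ ^ α * ‖(u : L2 d)‖ ^ 2) := by gcongr
    _ = _ := by ring

/-! ### The functional of the cell problem -/

/-- The linear functional `η ↦ ½ ∫∫ μ(x,x+z) ⟨ξ,z⟩ (η(x) - η(x+z)) |z|^{-d-α} dx dz`. -/
def cellFun (α : ℝ) (m : E d × E d → ℝ) (ξ : E d) (η : L2 d) : ℂ :=
  ∫ q, ((inner ℝ ξ q.2 : ℝ) : ℂ) * delta 0 η q ∂(formMeasure α m)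

/-- The error in replacing `conj (1 - e^{i⟨ξ,z⟩}) · 𝒟_ξ η` by `i⟨ξ,z⟩ · 𝒟_0 η`. -/
def cellRem (ξ : E d) (η : L2 d) (q : E d × E d) : ℂ :=
  conj (1 - phase ξ q.2) * delta ξ η q - Complex.I * (((inner ℝ ξ q.2 : ℝ) : ℂ) * delta 0 η q)

lemma norm_cellRem_le (ξ : E d) (η : L2 d) (q : E d × E d) :
    ‖cellRem ξ η q‖
      ≤ 3 * prof (‖ξ‖ * ‖q.2‖) * (‖perExt η q.1‖ + ‖perExt η (q.1 + q.2)‖) := by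
  set t : ℝ := inner ℝ ξ q.2 with ht
  have hp : phase ξ q.2 = (Real.cos t : ℂ) + (Real.sin t : ℂ) * Complex.I := by
    rw [phase_eq, Complex.exp_mul_I, Complex.ofReal_cos, Complex.ofReal_sin]
  have hpc : conj (phase ξ q.2) = (Real.cos t : ℂ) - (Real.sin t : ℂ) * Complex.I := by
    rw [hp, map_add, map_mul, Complex.conj_ofReal, Complex.conj_ofReal, Complex.conj_I]
    ring
  have e : cellRem ξ η q = ((1 - Real.cos t : ℝ) : ℂ) * (perExt η q.1 + perExt η (q.1 + q.2))
      + Complex.I * ((Real.sin t - t : ℝ) : ℂ) * (perExt η q.1 - perExt η (q.1 + q.2)) := by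
    have h1 := phase_mul_conj ξ q.2
    simp only [cellRem, delta, phase_zero_left, map_sub, map_one, ← ht]
    have h2 : (1 - conj (phase ξ q.2)) * (perExt η q.1 - phase ξ q.2 * perExt η (q.1 + q.2))
        = perExt η q.1 - phase ξ q.2 * perExt η (q.1 + q.2) - conj (phase ξ q.2) * perExt η q.1
          + perExt η (q.1 + q.2) := by
      linear_combination perExt η (q.1 + q.2) * h1
    rw [h2, hpc, hp]
    push_cast
    ring
  have h1 := one_sub_cos_le_prof t
  have h2 := abs_sin_sub_le_prof t
  have h3 := prof_mono (abs_nonneg _) (abs_real_inner_le_norm ξ q.2)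
  rw [← ht] at h3
  have h4 : |1 - Real.cos t| = 1 - Real.cos t := abs_of_nonneg (by linarith [Real.cos_le_one t])
  rw [e]
  refine (norm_add_le _ _).trans ?_
  rw [norm_mul, norm_mul, norm_mul, Complex.norm_real, Complex.norm_real, Complex.norm_I, one_mul,
    Real.norm_eq_abs, Real.norm_eq_abs, h4]
  have h5 := norm_add_le (perExt η q.1) (perExt η (q.1 + q.2))
  have h6 := norm_sub_le (perExt η q.1) (perExt η (q.1 + q.2))
  have h7 : 0 ≤ prof (‖ξ‖ * ‖q.2‖) := prof_nonneg (by positivity)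
  have h8 : |Real.sin t - t| ≤ 2 * prof (‖ξ‖ * ‖q.2‖) := by linarith
  calc _ ≤ prof (‖ξ‖ * ‖q.2‖) * (‖perExt η q.1‖ + ‖perExt η (q.1 + q.2)‖)
        + 2 * prof (‖ξ‖ * ‖q.2‖) * (‖perExt η q.1‖ + ‖perExt η (q.1 + q.2)‖) := by
        gcongr
        linarith
    _ = _ := by ring

lemma lintegral_enorm_perExt_add_le (η : L2 d) (z : E d) :
    ∫⁻ x in cell d, ‖perExt η (x + z)‖ₑ ≤ ‖η‖ₑ := by
  have h1 := (measurePreserving_fractE_add z).lintegral_comp (f := fun x => ‖η x‖ₑ)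
    (Lp.stronglyMeasurable η).measurable.enorm
  refine (le_of_eq h1).trans ?_
  rw [← eLpNorm_one_eq_lintegral_enorm, Lp.enorm_def]
  exact eLpNorm_le_eLpNorm_of_exponent_le (by norm_num) (Lp.aestronglyMeasurable η)

@[fun_prop]
lemma measurable_cellRem (ξ : E d) (η : L2 d) : Measurable (cellRem ξ η) := by
  unfold cellRem
  have : Measurable fun q : E d × E d => conj (1 - phase ξ q.2) :=
    Complex.continuous_conj.measurable.comp (by fun_prop)
  fun_prop

lemma lintegral_cellRem_le (hd : 1 ≤ d) (hα : 1 < α) (hα2 : α < 2) (hm : GoodCoeff μm μp m)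
    (ξ : E d) (η : L2 d) : ∫⁻ q, ‖cellRem ξ η q‖ₑ ∂(formMeasure α m)
      ≤ ENNReal.ofReal (3 * (μp * profInt d α) * ‖ξ‖ ^ α * ‖η‖) := by
  have hP := profInt_nonneg (d := d) α
  have hμ := hm.pos'
  refine (lintegral_formMeasure_le hm _).trans ?_
  have h1 : ∫⁻ q, ‖cellRem ξ η q‖ₑ ∂(bm d α) ≤ ∫⁻ q, ENNReal.ofReal 3 *
      (ENNReal.ofReal (prof (‖ξ‖ * ‖q.2‖)) * (‖perExt η q.1‖ₑ + ‖perExt η (q.1 + q.2)‖ₑ))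
        ∂(bm d α) := by
    refine lintegral_mono fun q => ?_
    have h0 := norm_cellRem_le ξ η q
    have h2 : 0 ≤ prof (‖ξ‖ * ‖q.2‖) := prof_nonneg (by positivity)
    rw [← ofReal_norm, ← ofReal_norm, ← ofReal_norm, ← ENNReal.ofReal_add (by positivity)
      (by positivity), ← ENNReal.ofReal_mul h2, ← ENNReal.ofReal_mul (by norm_num), ← mul_assoc]
    exact ENNReal.ofReal_le_ofReal h0
  have h2 : ∫⁻ q, (ENNReal.ofReal (prof (‖ξ‖ * ‖q.2‖)) *
      (‖perExt η q.1‖ₑ + ‖perExt η (q.1 + q.2)‖ₑ)) ∂(bm d α)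
      ≤ ENNReal.ofReal (‖ξ‖ ^ α * profInt d α) * (2 * ‖η‖ₑ) := by
    rw [lintegral_prod_symm _ (by fun_prop), ← lintegral_prof hd hα hα2 (norm_nonneg ξ),
      ← lintegral_mul_const _ (by fun_prop)]
    refine lintegral_mono fun z => ?_
    dsimp only
    rw [lintegral_const_mul _ (by fun_prop), lintegral_add_left (by fun_prop), two_mul]
    gcongr
    · simpa using lintegral_enorm_perExt_add_le η 0
    · exact lintegral_enorm_perExt_add_le η z
  rw [lintegral_const_mul _ (by fun_prop)] at h1
  calc _ ≤ ENNReal.ofReal (μp / 2) * (ENNReal.ofReal 3 *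
        (ENNReal.ofReal (‖ξ‖ ^ α * profInt d α) * (2 * ‖η‖ₑ))) := by
        gcongr
        exact h1.trans (by gcongr)
    _ = _ := by
        have e2 : 2 * ‖η‖ₑ = ENNReal.ofReal (2 * ‖η‖) := by
          rw [ENNReal.ofReal_mul (by norm_num), ofReal_norm]; simp
        rw [e2, ← ENNReal.ofReal_mul (by positivity), ← ENNReal.ofReal_mul (by positivity),
          ← ENNReal.ofReal_mul (by positivity)]
        congr 1
        ring

lemma integrable_cellRem (hd : 1 ≤ d) (hα : 1 < α) (hα2 : α < 2) (hm : GoodCoeff μm μp m)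
    (ξ : E d) (η : L2 d) : Integrable (cellRem ξ η) (formMeasure α m) :=
  ⟨(measurable_cellRem ξ η).aestronglyMeasurable,
    (lintegral_cellRem_le hd hα hα2 hm ξ η).trans_lt ENNReal.ofReal_lt_top⟩

lemma cellRem_eq_ae {e : formDom α m} (he : (e : L2 d) = expL 0) (ξ : E d) (η : L2 d) :
    ∀ᵐ q ∂(formMeasure α m), Complex.I * (((inner ℝ ξ q.2 : ℝ) : ℂ) * delta 0 η q)
      = delta ξ η q * conj (delta ξ (e : L2 d) q) - cellRem ξ η q := by
  filter_upwards [(formMeasure_ac α m).ae_le (delta_one_ae ξ)] with q hq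
  rw [he, hq, cellRem]
  ring

/-- The integral that defines the functional of the cell problem converges, due to a cancellation
for large `z`: the integrand differs from that of `⟨𝒟_ξ 1, 𝒟_ξ η⟩` by an integrable function. -/
lemma integrable_cellFun (hd : 1 ≤ d) (hα : 1 < α) (hα2 : α < 2) (hm : GoodCoeff μm μp m)
    (ξ : E d) (η : formDom α m) :
    Integrable (fun q => ((inner ℝ ξ q.2 : ℝ) : ℂ) * delta 0 (η : L2 d) q) (formMeasure α m) := by
  have h1 := (integrable_delta_mul ξ ξ η ⟨expL 0, expL_mem_formDom hd hα hα2 hm 0⟩).sub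
    (integrable_cellRem hd hα hα2 hm ξ (η : L2 d))
  have h2 : Integrable (fun q => Complex.I * (((inner ℝ ξ q.2 : ℝ) : ℂ) * delta 0 (η : L2 d) q))
      (formMeasure α m) := h1.congr (by
    filter_upwards [cellRem_eq_ae (e := ⟨expL 0, expL_mem_formDom hd hα hα2 hm 0⟩) rfl ξ (η : L2 d)]
      with q hq
    rw [hq, Pi.sub_apply])
  refine (h2.const_mul (-Complex.I)).congr (ae_of_all _ fun q => ?_)
  dsimp only
  rw [← mul_assoc, neg_mul, Complex.I_mul_I, neg_neg, one_mul]

/-- To leading order the form `a(ξ)[η,1]` is the functional of the cell problem. -/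
lemma norm_inner_fmap_one_sub_le (hd : 1 ≤ d) (hα : 1 < α) (hα2 : α < 2) (hm : GoodCoeff μm μp m)
    {e : formDom α m} (he : (e : L2 d) = expL 0) (ξ : E d) (η : formDom α m) :
    ‖inner ℂ (fmap α m ξ e) (fmap α m ξ η) - Complex.I * cellFun α m ξ η‖
      ≤ 3 * (μp * profInt d α) * ‖ξ‖ ^ α * ‖(η : L2 d)‖ := by
  have hP := profInt_nonneg (d := d) α
  have hμ := hm.pos'
  have h1 : inner ℂ (fmap α m ξ e) (fmap α m ξ η) - Complex.I * cellFun α m ξ η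
      = ∫ q, cellRem ξ (η : L2 d) q ∂(formMeasure α m) := by
    rw [inner_fmap, cellFun, ← integral_const_mul, integral_congr_ae (cellRem_eq_ae he ξ η),
      integral_sub (integrable_delta_mul ξ ξ η e) (integrable_cellRem hd hα hα2 hm ξ _)]
    ring
  rw [h1, ← ENNReal.ofReal_le_ofReal_iff (by positivity), ofReal_norm]
  exact (enorm_integral_le_lintegral_enorm _).trans (lintegral_cellRem_le hd hα hα2 hm ξ _)

lemma cellFun_smul (α : ℝ) (m : E d × E d → ℝ) (t : ℝ) (ξ : E d) (η : L2 d) :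
    cellFun α m (t • ξ) η = t * cellFun α m ξ η := by
  rw [cellFun, cellFun, ← integral_const_mul]
  congr 1
  ext q
  rw [real_inner_smul_left]
  push_cast
  ring

lemma norm_cellFun_le (hd : 1 ≤ d) (hα : 1 < α) (hα2 : α < 2) (hm : GoodCoeff μm μp m)
    (ξ : E d) (η : formDom α m) :
    ‖cellFun α m ξ η‖ ≤ ‖ξ‖ * (√(μp * profInt d α) * ‖fmap α m 0 η‖
      + 4 * (μp * profInt d α) * ‖(η : L2 d)‖) := by
  have hP := profInt_nonneg (d := d) α
  have hμ := hm.pos'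
  set K : ℝ := μp * profInt d α with hK
  have hK0 : 0 ≤ K := by positivity
  have unit : ∀ b : E d, ‖b‖ = 1 → ‖cellFun α m b η‖ ≤ √K * ‖fmap α m 0 η‖
      + 4 * K * ‖(η : L2 d)‖ := by
    intro b hb
    set e : formDom α m := ⟨expL 0, expL_mem_formDom hd hα hα2 hm 0⟩ with he
    have h1 := norm_inner_fmap_one_sub_le hd hα hα2 hm (e := e) rfl b η
    have h2 := norm_fmap_sub_le hm hd hα hα2 b e
    have h3 := norm_fmap_sub_le hm hd hα hα2 b η
    rw [fmap_zero_one (e := e) rfl, sub_zero] at h2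
    rw [hb, Real.one_rpow, mul_one, ← hK] at h1 h2 h3
    have he1 : ‖(e : L2 d)‖ = 1 := (orthonormal_expL (d := d)).1 0
    rw [he1, mul_one] at h2
    have h4 : ‖fmap α m b η‖ ≤ ‖fmap α m 0 η‖ + √K * ‖(η : L2 d)‖ := by
      have := norm_sub_norm_le (fmap α m b η) (fmap α m 0 η)
      linarith
    have h5 : ‖Complex.I * cellFun α m b η‖ ≤ ‖inner ℂ (fmap α m b e) (fmap α m b η)‖
        + 3 * K * ‖(η : L2 d)‖ := by
      have := norm_sub_norm_le (Complex.I * cellFun α m b η)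
        (inner ℂ (fmap α m b e) (fmap α m b η))
      rw [norm_sub_rev] at this
      linarith
    rw [norm_mul, Complex.norm_I, one_mul] at h5
    have h6 : ‖inner ℂ (fmap α m b e) (fmap α m b η)‖
        ≤ √K * (‖fmap α m 0 η‖ + √K * ‖(η : L2 d)‖) :=
      (norm_inner_le_norm _ _).trans (by gcongr)
    have h7 := Real.mul_self_sqrt hK0
    nlinarith [norm_nonneg (η : L2 d)]
  rcases eq_or_ne ξ 0 with rfl | hξ
  · simp [cellFun]
  · have hξ0 : 0 < ‖ξ‖ := norm_pos_iff.2 hξ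
    have h1 := unit (‖ξ‖⁻¹ • ξ) (by rw [norm_smul, norm_inv, norm_norm, inv_mul_cancel₀ hξ0.ne'])
    have h2 : cellFun α m ξ η = ‖ξ‖ * cellFun α m (‖ξ‖⁻¹ • ξ) η := by
      rw [cellFun_smul]
      push_cast
      rw [mul_inv_cancel_left₀]
      exact_mod_cast hξ0.ne'
    rw [h2, norm_mul, Complex.norm_real, norm_norm]
    gcongr

/-! ### The cell problem -/

lemma fc_zero_eq (u : L2 d) : fc u 0 = ∫ x in cell d, u x := by
  rw [fc, inner_expL]
  simp [freq_zero]

lemma isCellSolution_iff (hd : 1 ≤ d) (hα : 1 < α) (hα2 : α < 2) (hm : GoodCoeff μm μp m)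
    {μ : E d → E d → ℝ} (hμ : ∀ᵐ q ∂((cm d).prod volume), μ q.1 (q.1 + q.2) = m q)
    (k : Fin d) (v : L2 d) :
    IsCellSolution α μ k v ↔ ∃ h : v ∈ formDom α m, fc v 0 = 0 ∧ ∀ η : formDom α m,
      inner ℂ (fmap α m 0 ⟨v, h⟩) (fmap α m 0 η)
        = cellFun α m (EuclideanSpace.single k 1) η := by
  have key : ∀ (h : v ∈ formDom α m) (η : formDom α m),
      (∫ p : E d × E d, ((μ p.1 p.2 / ‖p.1 - p.2‖ ^ ((d : ℝ) + α) : ℝ) : ℂ) *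
        ((perExt v p.1 - perExt v p.2 + ((p.1 k - p.2 k : ℝ) : ℂ)) *
          conj (perExt η p.1 - perExt η p.2)) ∂(cellProd d) = 0) ↔
      inner ℂ (fmap α m 0 ⟨v, h⟩) (fmap α m 0 η)
        = cellFun α m (EuclideanSpace.single k 1) η := by
    intro h η
    have e1 := integral_cellProd_eq (α := α) hm hμ (fun p : E d × E d =>
      (perExt v p.1 - perExt v p.2 + ((p.1 k - p.2 k : ℝ) : ℂ)) *
          conj (perExt (η : L2 d) p.1 - perExt (η : L2 d) p.2))
    simp only [Complex.real_smul] at e1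
    have hi := integrable_cellFun hd hα hα2 hm (EuclideanSpace.single k 1) η
    have e2 : ∫ q, (perExt v q.1 - perExt v (q.1 + q.2) + ((q.1 k - (q.1 + q.2) k : ℝ) : ℂ)) *
          conj (perExt (η : L2 d) q.1 - perExt (η : L2 d) (q.1 + q.2)) ∂(formMeasure α m)
        = conj (inner ℂ (fmap α m 0 ⟨v, h⟩) (fmap α m 0 η)
          - cellFun α m (EuclideanSpace.single k 1) η) := by
      have hi' : Integrable (fun q => conj (((inner ℝ (EuclideanSpace.single k (1 : ℝ)) q.2 : ℝ) : ℂ)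
          * delta 0 (η : L2 d) q)) (formMeasure α m) :=
        Complex.conjCLE.toContinuousLinearMap.integrable_comp hi
      rw [map_sub, inner_conj_symm, inner_fmap, cellFun, ← integral_conj, ← integral_sub
        (integrable_delta_mul 0 0 ⟨v, h⟩ η) hi']
      refine integral_congr_ae (ae_of_all _ fun q => ?_)
      simp only [delta, phase_zero_left, one_mul, map_mul, Complex.conj_ofReal,
        EuclideanSpace.inner_single_left, map_one, PiLp.add_apply]
      push_cast
      ring
    rw [e1, e2, ← sub_eq_zero (b := cellFun α m _ _), mul_eq_zero_iff_left (by norm_num),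
      map_eq_zero]
  rw [IsCellSolution, ← mem_formDom_iff_memHper hd hα hα2 hm, ← fc_zero_eq]
  constructor
  · rintro ⟨h1, h2, h3⟩
    exact ⟨h1, h2, fun η => (key h1 η).1
      (h3 η ((mem_formDom_iff_memHper hd hα hα2 hm _).1 η.2))⟩
  · rintro ⟨h1, h2, h3⟩
    exact ⟨h1, h2, fun η hη => (key h1 ⟨η, (mem_formDom_iff_memHper hd hα hα2 hm _).2 hη⟩).2 (h3 _)⟩

/-- The Poincaré inequality on functions of mean value zero, with a constant that depends on the
coefficient only through its lower bound. -/
lemma exists_poincare (hd : 1 ≤ d) (hα : 1 < α) (hα2 : α < 2) (hμm : 0 < μm) :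
    ∃ P > 0, ∀ (μp : ℝ) (m : E d × E d → ℝ), GoodCoeff μm μp m → ∀ ξ ∈ dualCell d,
      ∀ u : formDom α m, fc (u : L2 d) 0 = 0 → ‖(u : L2 d)‖ ≤ P * ‖fmap α m ξ u‖ := by
  obtain ⟨c, hc, hcs⟩ := exists_symb_ge hd hα hα2
  refine ⟨(√(μm / 2 * c))⁻¹, by positivity, fun μp m hm ξ hξ u hu => ?_⟩
  have h1 := poincare hm hc.le hcs hα hξ u hu
  have h2 : √(μm / 2 * c) * ‖(u : L2 d)‖ ≤ ‖fmap α m ξ u‖ := by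
    refine abs_le_of_sq_le_sq' ?_ (norm_nonneg _) |>.2
    rw [mul_pow, Real.sq_sqrt (by positivity)]
    linarith
  rw [inv_mul_eq_div, le_div_iff₀ (by positivity), mul_comm]
  exact h2

lemma zero_mem_dualCell : (0 : E d) ∈ dualCell d := fun i => by
  have := Real.pi_pos
  simp [this, this.le]

lemma exists_isCellSolution (hd : 1 ≤ d) (hα : 1 < α) (hα2 : α < 2) (hm : GoodCoeff μm μp m)
    {μ : E d → E d → ℝ} (hμ : ∀ᵐ q ∂((cm d).prod volume), μ q.1 (q.1 + q.2) = m q)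
    (k : Fin d) : ∃ v, IsCellSolution α μ k v := by
  obtain ⟨P, hP, hPoin⟩ := exists_poincare hd hα hα2 hm.pos
  set b : E d := EuclideanSpace.single k 1 with hb
  have hb1 : ‖b‖ = 1 := by simp [hb]
  let l : formDom α m →ₗ[ℂ] ℂ :=
    { toFun := fun η => cellFun α m b η
      map_add' := fun u v => by
        simp only [cellFun]
        rw [← integral_add (integrable_cellFun hd hα hα2 hm b u)
          (integrable_cellFun hd hα hα2 hm b v)]
        refine integral_congr_ae ?_
        filter_upwards [(formMeasure_ac α m).ae_le (delta_add_ae 0 (u : L2 d) v)] with q hq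
        rw [Submodule.coe_add, hq, Pi.add_apply]
        ring
      map_smul' := fun c u => by
        simp only [cellFun]
        rw [RingHom.id_apply, smul_eq_mul, ← integral_const_mul]
        refine integral_congr_ae ?_
        filter_upwards [(formMeasure_ac α m).ae_le (delta_smul_ae 0 c (u : L2 d))] with q hq
        rw [Submodule.coe_smul, hq, Pi.smul_apply, smul_eq_mul]
        ring }
  have hl : ∀ η, l η = cellFun α m b η := fun η => rfl
  -- functions of mean value zero
  let Y : Submodule ℂ (L2 d) := LinearMap.ker (innerSL ℂ (expL (0 : Fin d → ℤ))).toLinearMap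
  have hYmem : ∀ u : L2 d, u ∈ Y ↔ fc u 0 = 0 := fun u => by
    simp only [Y, LinearMap.mem_ker]; rfl
  have hY : IsClosed (Y : Set (L2 d)) := by
    have : (Y : Set (L2 d)) = (innerSL ℂ (expL (0 : Fin d → ℤ))) ⁻¹' {0} := by
      ext u; simp only [SetLike.mem_coe, hYmem]; rfl
    rw [this]
    exact isClosed_singleton.preimage (innerSL ℂ _).continuous
  obtain ⟨u, hu, hsol⟩ := exists_form_solution (formDom α m) (fmap α m 0)
    (isClosed_graph_fmap hd hα hα2 hm 0) Y hY (C := P)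
    (fun u hu => hPoin μp m hm 0 zero_mem_dualCell u ((hYmem _).1 hu)) l
    (B := √(μp * profInt d α) + 4 * (μp * profInt d α) * P) (fun u hu => by
      have h1 := norm_cellFun_le hd hα hα2 hm b u
      have h2 := hPoin μp m hm 0 zero_mem_dualCell u ((hYmem _).1 hu)
      have h3 := profInt_nonneg (d := d) α
      have h4 := hm.pos'
      rw [hb1, one_mul] at h1
      rw [hl]
      calc _ ≤ _ := h1
        _ ≤ √(μp * profInt d α) * ‖fmap α m 0 u‖
            + 4 * (μp * profInt d α) * (P * ‖fmap α m 0 u‖) := by gcongr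
        _ = _ := by ring)
  refine ⟨u, (isCellSolution_iff hd hα hα2 hm hμ k u).2 ⟨u.2, (hYmem _).1 hu, fun η => ?_⟩⟩
  -- subtract the mean value from the test function
  set e : formDom α m := ⟨expL 0, expL_mem_formDom hd hα hα2 hm 0⟩ with he
  set c : ℂ := fc (η : L2 d) 0 with hc
  have h1 := hsol (η - c • e) ((hYmem _).2 (by
    rw [Submodule.coe_sub, Submodule.coe_smul, fc_sub, fc_smul, he, fc_expL]
    simp [hc]))
  have h2 : fmap α m 0 (η - c • e) = fmap α m 0 η := by
    rw [map_sub, map_smul, fmap_zero_one (e := e) rfl, smul_zero, sub_zero]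
  have h3 : l (η - c • e) = l η := by
    have h4 : l e = 0 := by
      rw [hl, cellFun]
      refine integral_eq_zero_of_ae ?_
      filter_upwards [(formMeasure_ac α m).ae_le (delta_one_ae (d := d) 0)] with q hq
      rw [he, hq]
      simp
    rw [map_sub, map_smul, h4, smul_zero, sub_zero]
  rw [h2, h3] at h1
  exact h1

/-! ### The effective matrix -/

lemma effMatrix_eq (hd : 1 ≤ d) (hα : 1 < α) (hα2 : α < 2) (hm : GoodCoeff μm μp m)
    {μ : E d → E d → ℝ} (hμ : ∀ᵐ q ∂((cm d).prod volume), μ q.1 (q.1 + q.2) = m q)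
    {v : Fin d → L2 d} (hv : ∀ k, v k ∈ formDom α m) (j k : Fin d) :
    effMatrix α μ v j k = -(1 / 2) * ((cellFun α m (EuclideanSpace.single j 1) (v k)).re
      + (cellFun α m (EuclideanSpace.single k 1) (v j)).re) + starMatrix α μ j k := by
  rw [effMatrix, ← starMatrix]
  congr 1
  have e1 := integral_cellProd_eq (α := α) hm hμ (fun p : E d × E d =>
      ((p.1 j - p.2 j) * (perExt (v k) p.1 - perExt (v k) p.2).re +
        (p.1 k - p.2 k) * (perExt (v j) p.1 - perExt (v j) p.2).re))
  simp only [smul_eq_mul] at e1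
  rw [e1]
  have hre : ∀ j k : Fin d, (cellFun α m (EuclideanSpace.single j 1) (v k)).re
      = ∫ q, q.2 j * (delta 0 (v k) q).re ∂(formMeasure α m) ∧
      Integrable (fun q => q.2 j * (delta 0 (v k) q).re) (formMeasure α m) := fun j k => by
    have hi := integrable_cellFun hd hα hα2 hm (EuclideanSpace.single j 1) ⟨v k, hv k⟩
    have e : ∀ q : E d × E d, (((inner ℝ (EuclideanSpace.single j (1 : ℝ)) q.2 : ℝ) : ℂ)
        * delta 0 (v k) q).re = q.2 j * (delta 0 (v k) q).re := fun q => by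
      rw [Complex.re_ofReal_mul, EuclideanSpace.inner_single_left]
      simp
    have h1 : Integrable (fun q => (((inner ℝ (EuclideanSpace.single j (1 : ℝ)) q.2 : ℝ) : ℂ)
        * delta 0 (v k) q).re) (formMeasure α m) := hi.re
    have h2 : (cellFun α m (EuclideanSpace.single j 1) (v k)).re
        = ∫ q, (((inner ℝ (EuclideanSpace.single j (1 : ℝ)) q.2 : ℝ) : ℂ)
        * delta 0 (v k) q).re ∂(formMeasure α m) := (integral_re hi).symm
    simp only [e] at h1 h2
    exact ⟨h2, h1⟩
  have e2 : ∀ q : E d × E d, (q.1 j - (q.1 + q.2) j) * (perExt (v k) q.1 -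
        perExt (v k) (q.1 + q.2)).re + (q.1 k - (q.1 + q.2) k) * (perExt (v j) q.1
          - perExt (v j) (q.1 + q.2)).re
      = -(q.2 j * (delta 0 (v k) q).re + q.2 k * (delta 0 (v j) q).re) := fun q => by
    simp only [delta, phase_zero_left, one_mul, PiLp.add_apply]
    ring
  simp only [e2]
  rw [integral_neg, integral_add (hre j k).2 (hre k j).2, ← (hre j k).1, ← (hre k j).1]
  ring

/-- The solution `w = ∑ ξ_k v_k` of the cell problem in the direction `ξ`, and the expression of
the quadratic form of the effective matrix through its energy. -/
lemma exists_cell_combination (hd : 1 ≤ d) (hα : 1 < α) (hα2 : α < 2) (hm : GoodCoeff μm μp m)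
    {μ : E d → E d → ℝ} (hμ : ∀ᵐ q ∂((cm d).prod volume), μ q.1 (q.1 + q.2) = m q)
    {v : Fin d → L2 d} (hv : ∀ k, IsCellSolution α μ k (v k)) (ξ : E d) :
    ∃ w : formDom α m, fc (w : L2 d) 0 = 0 ∧
      (∀ η : formDom α m, inner ℂ (fmap α m 0 w) (fmap α m 0 η) = cellFun α m ξ η) ∧
      qform (effMatrix α μ v) ξ = -‖fmap α m 0 w‖ ^ 2 + qform (starMatrix α μ) ξ := by
  choose hv1 hv2 hv3 using fun k => (isCellSolution_iff hd hα hα2 hm hμ k (v k)).1 (hv k)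
  let V : Fin d → formDom α m := fun k => ⟨v k, hv1 k⟩
  have hw : fmap α m 0 (∑ k, (ξ k : ℂ) • V k) = ∑ k, (ξ k : ℂ) • fmap α m 0 (V k) := by
    rw [map_sum]; simp only [map_smul]
  have hsum : ∀ η : formDom α m, cellFun α m ξ η
      = ∑ k, (ξ k : ℂ) * cellFun α m (EuclideanSpace.single k 1) η := fun η => by
    simp only [cellFun, ← integral_const_mul]
    rw [← integral_finsetSum _ fun k _ =>
      (integrable_cellFun hd hα hα2 hm (EuclideanSpace.single k 1) η).const_mul _]
    refine integral_congr_ae (ae_of_all _ fun q => ?_)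
    dsimp only
    have : (inner ℝ ξ q.2 : ℝ) = ∑ k, ξ k * inner ℝ (EuclideanSpace.single k (1 : ℝ)) q.2 := by
      simp only [EuclideanSpace.inner_single_left, map_one, one_mul]
      simp only [PiLp.inner_apply, RCLike.inner_apply, conj_trivial]
      exact Finset.sum_congr rfl fun i _ => mul_comm _ _
    rw [this]
    push_cast
    rw [Finset.sum_mul]
    exact Finset.sum_congr rfl fun i _ => by ring
  refine ⟨∑ k, (ξ k : ℂ) • V k, ?_, fun η => ?_, ?_⟩
  · rw [fc, Submodule.coe_sum, inner_sum]
    refine Finset.sum_eq_zero fun k _ => ?_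
    rw [Submodule.coe_smul, inner_smul_right]
    have := hv2 k
    rw [fc] at this
    rw [this, mul_zero]
  · rw [hw, sum_inner, hsum]
    refine Finset.sum_congr rfl fun k _ => ?_
    rw [inner_smul_left, Complex.conj_ofReal, hv3]
  · have h1 : ‖fmap α m 0 (∑ k, (ξ k : ℂ) • V k)‖ ^ 2
        = ∑ j, ∑ k, ξ j * ξ k * (cellFun α m (EuclideanSpace.single j 1) (v k)).re := by
      have h0 : (inner ℂ (fmap α m 0 (∑ k, (ξ k : ℂ) • V k))
        (fmap α m 0 (∑ k, (ξ k : ℂ) • V k))).re = _ := inner_self_eq_norm_sq (𝕜 := ℂ) _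
      rw [← h0, hw, sum_inner, Complex.re_sum]
      refine Finset.sum_congr rfl fun j _ => ?_
      rw [inner_sum, Complex.re_sum]
      refine Finset.sum_congr rfl fun k _ => ?_
      rw [inner_smul_left, inner_smul_right, Complex.conj_ofReal, hv3, ← mul_assoc,
        ← Complex.ofReal_mul, Complex.re_ofReal_mul]
    have h2 : ‖fmap α m 0 (∑ k, (ξ k : ℂ) • V k)‖ ^ 2
        = ∑ j, ∑ k, ξ j * ξ k * (cellFun α m (EuclideanSpace.single k 1) (v j)).re := by
      rw [h1, Finset.sum_comm]
      exact Finset.sum_congr rfl fun j _ => Finset.sum_congr rfl fun k _ => by ring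
    have h3 : -‖fmap α m 0 (∑ k, (ξ k : ℂ) • V k)‖ ^ 2
        = -(1 / 2) * (‖fmap α m 0 (∑ k, (ξ k : ℂ) • V k)‖ ^ 2
          + ‖fmap α m 0 (∑ k, (ξ k : ℂ) • V k)‖ ^ 2) := by ring
    rw [h3]
    nth_rewrite 1 [h1]
    rw [h2]
    simp only [qform, effMatrix_eq hd hα hα2 hm hμ hv1, ← Finset.sum_add_distrib, Finset.mul_sum]
    refine Finset.sum_congr rfl fun j _ => Finset.sum_congr rfl fun k _ => by ring

/-! ### The dual cell -/

lemma norm_le_of_mem_dualCell {ξ : E d} (hξ : ξ ∈ dualCell d) : ‖ξ‖ ≤ 1 + Real.pi * d := by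
  have h := norm_le_sum_norm_apply ξ
  have h2 : ∑ i, ‖ξ i‖ ≤ ∑ _i : Fin d, Real.pi := Finset.sum_le_sum fun i _ => by
    rw [Real.norm_eq_abs, abs_le]; exact ⟨(hξ i).1, (hξ i).2.le⟩
  simp only [Finset.sum_const, Finset.card_univ, Fintype.card_fin, nsmul_eq_mul] at h2
  nlinarith

/-- The points of the dual cell are the shortest ones in their classes modulo `2πℤ^d`. -/
lemma norm_le_norm_add_freq {ξ : E d} (hξ : ξ ∈ dualCell d) (n : Fin d → ℤ) :
    ‖ξ‖ ≤ ‖ξ + freq n‖ := by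
  rw [EuclideanSpace.norm_eq, EuclideanSpace.norm_eq]
  refine Real.sqrt_le_sqrt (Finset.sum_le_sum fun i _ => ?_)
  have h1 : (ξ + freq n) i = ξ i + 2 * Real.pi * n i := by simp [freq]
  rw [h1, Real.norm_eq_abs, Real.norm_eq_abs, sq_abs, sq_abs]
  have h2 := hξ i
  have hp := Real.pi_pos
  rcases lt_trichotomy (n i) 0 with h | h | h
  · have : (n i : ℝ) ≤ -1 := by exact_mod_cast Int.le_sub_one_of_lt h
    have h3 : 0 ≤ -(2 * Real.pi * n i) := by nlinarith
    have h4 : 0 ≤ -(2 * ξ i + 2 * Real.pi * n i) := by nlinarith [h2.2]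
    nlinarith [mul_nonneg h3 h4]
  · simp [h]
  · have : (1 : ℝ) ≤ n i := by exact_mod_cast h
    have h3 : 0 ≤ 2 * Real.pi * n i := by nlinarith
    have h4 : 0 ≤ 2 * ξ i + 2 * Real.pi * n i := by nlinarith [h2.1]
    nlinarith [mul_nonneg h3 h4]

/-- The lower bound of the form over the whole form domain. -/
lemma le_norm_fmap_sq (hm : GoodCoeff μm μp m) {c : ℝ} (hc0 : 0 ≤ c)
    (hc : ∀ k : E d, c * ‖k‖ ^ α ≤ symb d α k) (hα : 1 < α) {ξ : E d} (hξ : ξ ∈ dualCell d)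
    (u : formDom α m) :
    μm / 2 * (c * ‖ξ‖ ^ α * ‖(u : L2 d)‖ ^ 2) ≤ ‖fmap α m ξ u‖ ^ 2 := by
  refine le_norm_fmap_sq_of_enorm (le_trans ?_ (le_enorm_fmap_sq hm ξ u))
  have := hm.pos
  rw [ENNReal.ofReal_mul (by positivity), ENNReal.ofReal_mul (by positivity),
    ENNReal.ofReal_pow (norm_nonneg _), ofReal_norm, ← tsum_enorm_fc_sq, ← ENNReal.tsum_mul_left]
  refine mul_le_mul' le_rfl (ENNReal.tsum_le_tsum fun n => ?_)
  rw [mul_comm]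
  gcongr
  refine ENNReal.ofReal_le_of_le_toReal (le_trans ?_ (hc (ξ + freq n)))
  have := norm_le_norm_add_freq hξ n
  gcongr

/-! ### The corrected constant `1 + i w` -/

lemma rpow_le_of_le {s S β : ℝ} (hs : 0 ≤ s) (hS : 1 ≤ S) (hsS : s ≤ S) (hβ : 0 ≤ β)
    (hβ1 : β ≤ 1) : s ^ β ≤ S :=
  (Real.rpow_le_rpow hs hsS hβ).trans ((Real.rpow_le_rpow_of_exponent_le hS hβ1).trans
    (le_of_eq (Real.rpow_one S)))

/-- The bounds for the solution of the cell problem. -/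
lemma norm_cell_solution_le (hd : 1 ≤ d) (hα : 1 < α) (hα2 : α < 2) (hm : GoodCoeff μm μp m)
    {P : ℝ} (hP : 0 < P)
    (hPoin : ∀ ξ ∈ dualCell d, ∀ u : formDom α m, fc (u : L2 d) 0 = 0 →
      ‖(u : L2 d)‖ ≤ P * ‖fmap α m ξ u‖) {ξ : E d} {w : formDom α m} (hw0 : fc (w : L2 d) 0 = 0)
    (hw : ∀ η : formDom α m, inner ℂ (fmap α m 0 w) (fmap α m 0 η) = cellFun α m ξ η) :
    ‖fmap α m 0 w‖ ≤ (√(μp * profInt d α) + 4 * (μp * profInt d α) * P) * ‖ξ‖ ∧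
      ‖(w : L2 d)‖ ≤ P * (√(μp * profInt d α) + 4 * (μp * profInt d α) * P) * ‖ξ‖ := by
  have hI := profInt_nonneg (d := d) α
  have hμ := hm.pos'
  set K : ℝ := μp * profInt d α with hK
  have hK0 : 0 ≤ K := by positivity
  have h1 := norm_cellFun_le hd hα hα2 hm ξ w
  have h2 := hPoin 0 zero_mem_dualCell w hw0
  have h3 : ‖fmap α m 0 w‖ ^ 2 = ‖cellFun α m ξ w‖ := by
    rw [← hw w, inner_self_eq_norm_sq_to_K]
    simp
  have h4 : ‖fmap α m 0 w‖ * ‖fmap α m 0 w‖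
      ≤ ((√K + 4 * K * P) * ‖ξ‖) * ‖fmap α m 0 w‖ := by
    rw [← sq, h3]
    refine h1.trans ?_
    calc _ ≤ ‖ξ‖ * (√K * ‖fmap α m 0 w‖ + 4 * K * (P * ‖fmap α m 0 w‖)) := by gcongr
      _ = _ := by ring
  have h5 : ‖fmap α m 0 w‖ ≤ (√K + 4 * K * P) * ‖ξ‖ := by
    rcases eq_or_lt_of_le (norm_nonneg (fmap α m 0 w)) with h | h
    · rw [← h]; positivity
    · exact le_of_mul_le_mul_right h4 h
  refine ⟨h5, h2.trans ?_⟩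
  rw [mul_assoc]
  gcongr

/-- The corrected constant is orthogonal to the functions of mean value zero in leading order. -/
lemma norm_inner_fmap_corrected_le (hd : 1 ≤ d) (hα : 1 < α) (hα2 : α < 2)
    (hm : GoodCoeff μm μp m) {P S C₁ : ℝ} (hP : 0 < P) (hS : 1 ≤ S) (hC₁ : 0 ≤ C₁) {ξ : E d}
    (hξS : ‖ξ‖ ≤ S) {e w η : formDom α m} (he : (e : L2 d) = expL 0)
    (hw : ∀ η : formDom α m, inner ℂ (fmap α m 0 w) (fmap α m 0 η) = cellFun α m ξ η)
    (hw1 : ‖fmap α m 0 w‖ ≤ C₁ * ‖ξ‖) (hw2 : ‖(w : L2 d)‖ ≤ P * C₁ * ‖ξ‖)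
    (hη : ‖(η : L2 d)‖ ≤ P * ‖fmap α m ξ η‖) :
    ‖inner ℂ (fmap α m ξ η) (fmap α m ξ e + Complex.I • fmap α m ξ w)‖
      ≤ (3 * (μp * profInt d α) * P + 2 * S * √(μp * profInt d α) * P * C₁) * ‖ξ‖ ^ α *
        ‖fmap α m ξ η‖ := by
  have hI := profInt_nonneg (d := d) α
  have hμ := hm.pos'
  set K : ℝ := μp * profInt d α with hK
  have hK0 : 0 ≤ K := by positivity
  set s : ℝ := ‖ξ‖ with hs
  have hs0 : 0 ≤ s := norm_nonneg _
  have h1 := norm_inner_fmap_one_sub_le hd hα hα2 hm he ξ η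
  have h2 := norm_fmap_sub_le hm hd hα hα2 ξ η
  have h3 := norm_fmap_sub_le hm hd hα hα2 ξ w
  rw [← hK, ← hs] at h1 h2 h3
  have e1 : inner ℂ (fmap α m ξ η) (fmap α m ξ e + Complex.I • fmap α m ξ w)
      = conj (inner ℂ (fmap α m ξ e) (fmap α m ξ η) - Complex.I * cellFun α m ξ η)
        + Complex.I * (inner ℂ (fmap α m ξ η) (fmap α m ξ w - fmap α m 0 w)
          + inner ℂ (fmap α m ξ η - fmap α m 0 η) (fmap α m 0 w)) := by
    rw [← hw η, map_sub, map_mul, inner_conj_symm, inner_conj_symm, Complex.conj_I, inner_add_right,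
      inner_smul_right, inner_sub_right, inner_sub_left]
    ring
  have hpow : s ^ (α / 2) * s ≤ S * s ^ α := by
    have a1 : s ^ (α / 2) * s = s ^ (1 - α / 2) * s ^ α := by
      rw [← Real.rpow_add' hs0 (by linarith)]
      nth_rewrite 2 [← Real.rpow_one s]
      rw [← Real.rpow_add' hs0 (by linarith)]
      congr 1; ring
    rw [a1]
    gcongr
    exact rpow_le_of_le hs0 hS hξS (by linarith) (by linarith)
  have h4 : ‖inner ℂ (fmap α m ξ η) (fmap α m ξ w - fmap α m 0 w)‖
      ≤ ‖fmap α m ξ η‖ * (√K * (S * s ^ α) * (P * C₁)) := by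
    refine (norm_inner_le_norm _ _).trans ?_
    gcongr
    refine h3.trans ?_
    calc √K * s ^ (α / 2) * ‖(w : L2 d)‖ ≤ √K * s ^ (α / 2) * (P * C₁ * s) := by gcongr
      _ = √K * (s ^ (α / 2) * s) * (P * C₁) := by ring
      _ ≤ _ := by gcongr
  have h5 : ‖inner ℂ (fmap α m ξ η - fmap α m 0 η) (fmap α m 0 w)‖
      ≤ √K * (S * s ^ α) * (P * ‖fmap α m ξ η‖ * C₁) := by
    refine (norm_inner_le_norm _ _).trans ?_
    calc _ ≤ (√K * s ^ (α / 2) * (P * ‖fmap α m ξ η‖)) * (C₁ * s) := by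
          gcongr
          exact h2.trans (by gcongr)
      _ = √K * (s ^ (α / 2) * s) * (P * ‖fmap α m ξ η‖ * C₁) := by ring
      _ ≤ _ := by gcongr
  have h6 : ‖inner ℂ (fmap α m ξ e) (fmap α m ξ η) - Complex.I * cellFun α m ξ η‖
      ≤ 3 * K * s ^ α * (P * ‖fmap α m ξ η‖) := h1.trans (by gcongr)
  rw [e1]
  refine (norm_add_le _ _).trans ?_
  rw [RCLike.norm_conj, norm_mul, Complex.norm_I, one_mul]
  have h7 := norm_add_le (inner ℂ (fmap α m ξ η) (fmap α m ξ w - fmap α m 0 w))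
    (inner ℂ (fmap α m ξ η - fmap α m 0 η) (fmap α m 0 w))
  calc _ ≤ 3 * K * s ^ α * (P * ‖fmap α m ξ η‖) + (‖fmap α m ξ η‖ * (√K * (S * s ^ α) * (P * C₁))
        + √K * (S * s ^ α) * (P * ‖fmap α m ξ η‖ * C₁)) := by linarith
    _ = _ := by ring

/-- The energy of the corrected constant: the effective symbol, up to `O(|ξ|^{1+α})`. -/
lemma norm_inner_one_corrected_sub_le (hd : 1 ≤ d) (hα : 1 < α) (hα2 : α < 2)
    {μ : E d → E d → ℝ} (h : CoeffData μm μp μ m) {W q : ℝ} {ξ : E d}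
    {e w : formDom α m} (he : (e : L2 d) = expL 0)
    (hw : ∀ η : formDom α m, inner ℂ (fmap α m 0 w) (fmap α m 0 η) = cellFun α m ξ η)
    (hw2 : ‖(w : L2 d)‖ ≤ W * ‖ξ‖)
    (hq : q = -‖fmap α m 0 w‖ ^ 2 + qform (starMatrix α μ) ξ) :
    ‖inner ℂ (fmap α m ξ e) (fmap α m ξ e + Complex.I • fmap α m ξ w)
        - ((meanCoeff μ / 2 * symb d α ξ + q : ℝ) : ℂ)‖
      ≤ (4 * μp * (1 + (d + α)) * d * profInt d α + 3 * (μp * profInt d α) * W) *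
        ‖ξ‖ ^ (1 + α) := by
  have hI := profInt_nonneg (d := d) α
  have hμ := h.good.pos'
  have h1 := norm_inner_fmap_one_sub_le hd hα hα2 h.good he ξ w
  have h2 := h.expansion hd hα hα2 ξ
  obtain ⟨hs1, hs2⟩ := integrable_symbFun hd hα hα2 ξ
  have h3 : ∫ z, avgCoeff m z * symbFun α ξ z = (∫ z, (avgCoeff m z - meanCoeff μ) * symbFun α ξ z)
      + meanCoeff μ / 2 * symb d α ξ := by
    have a1 : Integrable fun z => avgCoeff m z * symbFun α ξ z :=
      hs1.bdd_mul h.good.measurable_avg.aestronglyMeasurable (ae_of_all _ fun z => by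
        have := h.good.avg_mem z
        rw [Real.norm_eq_abs, abs_of_pos (h.good.pos.trans_le this.1)]
        exact this.2)
    have a2 : ∀ z, (avgCoeff m z - meanCoeff μ) * symbFun α ξ z
        = avgCoeff m z * symbFun α ξ z - meanCoeff μ * symbFun α ξ z := fun z => by ring
    simp only [a2]
    rw [integral_sub a1 (hs1.const_mul _), integral_const_mul, hs2]
    ring
  set T : ℝ := (∫ z, (avgCoeff m z - meanCoeff μ) * symbFun α ξ z) - qform (starMatrix α μ) ξ
    with hT
  have hself : inner ℂ (fmap α m 0 w) (fmap α m 0 w) = ((‖fmap α m 0 w‖ ^ 2 : ℝ) : ℂ) := by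
    rw [inner_self_eq_norm_sq_to_K]; push_cast; rfl
  have e1 : inner ℂ (fmap α m ξ e) (fmap α m ξ e + Complex.I • fmap α m ξ w)
        - ((meanCoeff μ / 2 * symb d α ξ + q : ℝ) : ℂ)
      = (T : ℂ) + Complex.I *
        (inner ℂ (fmap α m ξ e) (fmap α m ξ w) - Complex.I * cellFun α m ξ w) := by
    rw [inner_add_right, inner_smul_right, fmap_one_norm_sq hd hα hα2 h.good he, h3, ← hw w, hself,
      hq, hT]
    push_cast
    linear_combination ((‖fmap α m 0 w‖ : ℂ) ^ 2) * Complex.I_mul_I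
  rw [e1]
  refine (norm_add_le _ _).trans ?_
  rw [norm_mul, Complex.norm_I, one_mul, Complex.norm_real, Real.norm_eq_abs]
  have h5 : ‖ξ‖ ^ (1 + α) = ‖ξ‖ ^ α * ‖ξ‖ := by
    rw [add_comm, Real.rpow_add' (norm_nonneg _) (by linarith), Real.rpow_one]
  calc _ ≤ 4 * μp * (1 + (d + α)) * d * profInt d α * ‖ξ‖ ^ (1 + α)
        + 3 * (μp * profInt d α) * ‖ξ‖ ^ α * (W * ‖ξ‖) := by
        refine add_le_add h2 (h1.trans (by gcongr))
    _ = _ := by rw [h5]; ring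

/-! ### The mean value of the resolvent -/

/-- The resolvent is bounded by the inverse of the lower bound of the form. -/
lemma norm_resolvent_le {H D : Type*} [NormedAddCommGroup H] [InnerProductSpace ℂ H]
    [NormedAddCommGroup D] [InnerProductSpace ℂ D] {u f : H} {Du : D} {κ a : ℝ}
    (h : inner ℂ Du Du + κ * inner ℂ u u = inner ℂ u f) (ha : a * ‖u‖ ^ 2 ≤ ‖Du‖ ^ 2) :
    ‖u‖ * (a + κ) ≤ ‖f‖ := by
  have h1 : ‖Du‖ ^ 2 + κ * ‖u‖ ^ 2 ≤ ‖u‖ * ‖f‖ := by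
    have r1 : (inner ℂ Du Du).re = _ := inner_self_eq_norm_sq (𝕜 := ℂ) _
    have r2 : (inner ℂ u u).re = _ := inner_self_eq_norm_sq (𝕜 := ℂ) _
    rw [← r1, ← r2, ← Complex.re_ofReal_mul, ← Complex.add_re, h]
    exact (Complex.re_le_norm _).trans (norm_inner_le_norm _ _)
  rcases eq_or_lt_of_le (norm_nonneg u) with h0 | h0
  · rw [← h0, zero_mul]; exact norm_nonneg _
  · refine le_of_mul_le_mul_left ?_ h0
    nlinarith

/-- The energy estimate for the part of the solution of mean value zero: here `x` and `y` are
the norms of its twisted difference and of itself, and `c` is the absolute value of the mean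
value of the solution. -/
lemma energy_le {x y F c P B W S A κ t s : ℝ} (hx : 0 ≤ x) (hF : 0 ≤ F) (hc : 0 ≤ c)
    (hP : 0 < P) (hB : 0 ≤ B) (hW : 0 ≤ W) (hA : 0 < A) (hκ : 0 ≤ κ) (ht : 0 ≤ t)
    (hs : 0 ≤ s) (hsS : s ≤ S) (hyx : y ≤ P * x) (hcF : c * (A * t + κ) ≤ F)
    (h : x ^ 2 ≤ y * F + c * (B * t * x + κ * (y * (W * s)))) :
    x ≤ (P + B / A + P * W * S) * F := by
  have hS : 0 ≤ S := hs.trans hsS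
  have h1 : c * t ≤ F / A := by
    rw [le_div_iff₀ hA]
    nlinarith [mul_nonneg hc hκ]
  have h2 : c * κ ≤ F := by nlinarith [mul_nonneg hc (mul_nonneg hA.le ht)]
  have h3 : x * x ≤ ((P + B / A + P * W * S) * F) * x := by
    calc x * x = x ^ 2 := by ring
      _ ≤ y * F + c * (B * t * x + κ * (y * (W * s))) := h
      _ ≤ P * x * F + c * (B * t * x + κ * (P * x * (W * S))) := by gcongr
      _ = P * x * F + B * x * (c * t) + P * x * (W * S) * (c * κ) := by ring
      _ ≤ P * x * F + B * x * (F / A) + P * x * (W * S) * F := by gcongr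
      _ = _ := by ring
  rcases eq_or_lt_of_le hx with h | h
  · rw [← h]; positivity
  · exact le_of_mul_le_mul_right h3 h

/-- The estimate for the part `η` of mean value zero of a solution `u = η + c (e + i w)`, where `e`
is the constant `1`, from the equation for `u` tested with `η`. -/
lemma norm_mean_zero_part_le {H D : Type*} [NormedAddCommGroup H] [InnerProductSpace ℂ H]
    [NormedAddCommGroup D] [InnerProductSpace ℂ D] {η e w f : H} {Dη Dφ : D} {c : ℂ}
    {P B W S A κ t s : ℝ} (hP : 0 < P) (hB : 0 ≤ B) (hW : 0 ≤ W) (hA : 0 < A) (hκ : 0 ≤ κ)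
    (ht : 0 ≤ t) (hs : 0 ≤ s) (hsS : s ≤ S) (hη : ‖η‖ ≤ P * ‖Dη‖)
    (hcF : ‖c‖ * (A * t + κ) ≤ ‖f‖) (hηe : inner ℂ η e = 0)
    (hBη : ‖inner ℂ Dη Dφ‖ ≤ B * t * ‖Dη‖) (hw : ‖w‖ ≤ W * s)
    (h : inner ℂ Dη (Dη + c • Dφ) + κ * inner ℂ η (η + c • (e + Complex.I • w)) = inner ℂ η f) :
    ‖Dη‖ ≤ (P + B / A + P * W * S) * ‖f‖ := by
  rw [inner_add_right, inner_smul_right, inner_add_right η, inner_smul_right,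
    inner_add_right η, hηe, zero_add, inner_smul_right] at h
  have r1 : (inner ℂ Dη Dη).re = _ := inner_self_eq_norm_sq (𝕜 := ℂ) _
  have r2 : (inner ℂ η η).re = _ := inner_self_eq_norm_sq (𝕜 := ℂ) _
  have t3 : inner ℂ Dη Dη + κ * inner ℂ η η
      = inner ℂ η f - c * (inner ℂ Dη Dφ + κ * (Complex.I * inner ℂ η w)) := by
    linear_combination h
  have t4 := congrArg Complex.re t3
  rw [Complex.add_re, Complex.re_ofReal_mul, r1, r2] at t4
  have t5 := (Complex.re_le_norm (inner ℂ η f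
    - c * (inner ℂ Dη Dφ + κ * (Complex.I * inner ℂ η w)))).trans (norm_sub_le _ _)
  rw [norm_mul c] at t5
  have t6 := norm_inner_le_norm (𝕜 := ℂ) η f
  have t7 : ‖inner ℂ Dη Dφ + κ * (Complex.I * inner ℂ η w)‖
      ≤ B * t * ‖Dη‖ + κ * (‖η‖ * (W * s)) := by
    refine (norm_add_le _ _).trans (add_le_add hBη ?_)
    rw [norm_mul, norm_mul, Complex.norm_I, one_mul, Complex.norm_real, Real.norm_of_nonneg hκ]
    gcongr
    exact (norm_inner_le_norm _ _).trans (by gcongr)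
  have t8 := mul_le_mul_of_nonneg_left t7 (norm_nonneg c)
  refine energy_le (norm_nonneg _) (norm_nonneg f) (norm_nonneg c) hP hB hW hA hκ ht hs hsS hη
    hcF ?_
  have t9 : 0 ≤ κ * ‖η‖ ^ 2 := by positivity
  linarith

/-- The form `a(ξ)[η,1]` is small of order `O(|ξ|)`. -/
lemma norm_inner_fmap_one_le (hd : 1 ≤ d) (hα : 1 < α) (hα2 : α < 2) (hm : GoodCoeff μm μp m)
    {P S : ℝ} (hS : 1 ≤ S) {ξ : E d} (hξS : ‖ξ‖ ≤ S) {e η : formDom α m}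
    (he : (e : L2 d) = expL 0) (hη : ‖(η : L2 d)‖ ≤ P * ‖fmap α m ξ η‖) :
    ‖inner ℂ (fmap α m ξ e) (fmap α m ξ η)‖
      ≤ ‖ξ‖ * (√(μp * profInt d α) + 4 * (μp * profInt d α) * S * P + 4 * (μp * profInt d α) * P)
        * ‖fmap α m ξ η‖ := by
  have hI := profInt_nonneg (d := d) α
  have hμ := hm.pos'
  set K : ℝ := μp * profInt d α with hK
  have hK0 : 0 ≤ K := by positivity
  set s : ℝ := ‖ξ‖ with hs
  have hs0 : 0 ≤ s := norm_nonneg _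
  have h1 := norm_inner_fmap_one_sub_le hd hα hα2 hm he ξ η
  have h2 := norm_cellFun_le hd hα hα2 hm ξ η
  have h3 := norm_fmap_sub_le hm hd hα hα2 ξ η
  rw [← hK, ← hs] at h1 h2 h3
  have h4 : s ^ (α / 2) ≤ S := rpow_le_of_le hs0 hS hξS (by linarith) (by linarith)
  have h5 : s ^ α ≤ s * S := by
    have : s ^ α = s * s ^ (α - 1) := by
      nth_rewrite 2 [← Real.rpow_one s]
      rw [← Real.rpow_add' hs0 (by linarith)]
      congr 1; ring
    rw [this]
    gcongr
    exact rpow_le_of_le hs0 hS hξS (by linarith) (by linarith)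
  have h6 : ‖fmap α m 0 η‖ ≤ ‖fmap α m ξ η‖ + √K * S * (P * ‖fmap α m ξ η‖) := by
    have a1 := norm_sub_norm_le (fmap α m 0 η) (fmap α m ξ η)
    rw [norm_sub_rev] at a1
    have a2 : √K * s ^ (α / 2) * ‖(η : L2 d)‖ ≤ √K * S * (P * ‖fmap α m ξ η‖) := by gcongr
    linarith
  have a1 := norm_le_norm_sub_add (inner ℂ (fmap α m ξ e) (fmap α m ξ η))
    (Complex.I * cellFun α m ξ η)
  rw [norm_mul, Complex.norm_I, one_mul] at a1
  have hKK := Real.mul_self_sqrt hK0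
  calc _ ≤ 3 * K * s ^ α * ‖(η : L2 d)‖ + s * (√K * ‖fmap α m 0 η‖ + 4 * K * ‖(η : L2 d)‖) := by
        linarith
    _ ≤ 3 * K * (s * S) * (P * ‖fmap α m ξ η‖) + s * (√K * (‖fmap α m ξ η‖
        + √K * S * (P * ‖fmap α m ξ η‖)) + 4 * K * (P * ‖fmap α m ξ η‖)) := by
        gcongr
    _ = s * (√K + 3 * K * S * P + (√K * √K) * S * P + 4 * K * P) * ‖fmap α m ξ η‖ := by ring
    _ = _ := by rw [hKK]; ring

set_option maxHeartbeats 1000000 in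
/-- The mean value `c` of `(𝔸(ξ) + κ)⁻¹ f` solves the effective equation, and the rest of the
resolvent is bounded, up to errors of the relative order `O(|ξ|)`. -/
lemma resolvent_mean (hd : 1 ≤ d) (hα : 1 < α) (hα2 : α < 2) (hμm : 0 < μm) (μp : ℝ) :
    ∃ A G C : ℝ, 0 < A ∧ A ≤ 1 ∧ 0 ≤ G ∧ 0 ≤ C ∧ ∀ μ : E d → E d → ℝ, IsCoefficient μm μp μ →
      0 < meanCoeff μ ∧
      (∀ k, A * ‖k‖ ^ α ≤ meanCoeff μ / 2 * symb d α k) ∧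
      ∀ v : Fin d → L2 d, (∀ k, IsCellSolution α μ k (v k)) →
      (∀ k, |qform (effMatrix α μ v) k| ≤ G * ‖k‖ ^ 2) ∧
      ∀ ξ ∈ dualCell d, ∀ κ : ℝ, 0 < κ → ∀ R, IsResolvent (levyOp α μ ξ) κ R → ∀ f : L2 d,
        ‖R f‖ * (A * ‖ξ‖ ^ α + κ) ≤ ‖f‖ ∧
        ‖fc (R f) 0 * ((meanCoeff μ / 2 * symb d α ξ + qform (effMatrix α μ v) ξ + κ : ℝ) : ℂ)
          - fc f 0‖ ≤ C * ‖ξ‖ * ‖f‖ ∧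
        ‖R f - fc (R f) 0 • expL 0‖ ≤ C * (1 + ‖ξ‖ / (A * ‖ξ‖ ^ α + κ)) * ‖f‖ := by
  obtain ⟨a, ha, has⟩ := exists_symb_ge hd hα hα2
  obtain ⟨P, hP, hPoin⟩ := exists_poincare hd hα hα2 hμm
  have hI := profInt_nonneg (d := d) α
  -- the case where the class of coefficients is empty is separated
  rcases le_or_gt μp 0 with hneg | hμp
  · refine ⟨1, 0, 0, one_pos, le_rfl, le_rfl, le_rfl, fun μ hμ => ?_⟩
    obtain ⟨m, hm⟩ := exists_coeffData hμm hμ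
    exact absurd hm.good.pos' (not_lt.2 hneg)
  set A : ℝ := min 1 (μm / 2 * a) with hA
  have hA0 : 0 < A := by positivity
  have hAa : A ≤ μm / 2 * a := min_le_right _ _
  set K : ℝ := μp * profInt d α with hK
  have hK0 : 0 ≤ K := by positivity
  set S : ℝ := 1 + Real.pi * d with hSdef
  have hS : 1 ≤ S := by have := Real.pi_pos; rw [hSdef]; nlinarith [Nat.cast_nonneg (α := ℝ) d]
  -- `C₁` bounds the solution of the cell problem, `B` and `Q` the errors of the corrected constant
  -- when tested with functions of mean value zero and with constants
  set C₁ : ℝ := √K + 4 * K * P with hC₁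
  have hC₁0 : 0 ≤ C₁ := by positivity
  set B : ℝ := 3 * K * P + 2 * S * √K * P * C₁ with hB
  have hB0 : 0 ≤ B := by positivity
  set Q : ℝ := 4 * μp * (1 + (d + α)) * d * profInt d α + 3 * K * (P * C₁) with hQ
  have hQ0 : 0 ≤ Q := by positivity
  -- `C₂` bounds the part of the resolvent of mean value zero, `C₃` the error in the equation for
  -- the mean value
  set C₂ : ℝ := P + B / A + P * (P * C₁) * S with hC₂
  have hC₂0 : 0 ≤ C₂ := by positivity
  set C₃ : ℝ := (√K + 4 * K * S * P + 4 * K * P) * C₂ + Q / A with hC₃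
  have hC₃0 : 0 ≤ C₃ := by positivity
  refine ⟨A, C₁ ^ 2 + (μp + 4 * μp * (1 + (d + α)) * d) * profInt d α, C₃ + P * C₂ + P * C₁,
    hA0, min_le_left _ _, by positivity, by positivity, fun μ hμ => ?_⟩
  obtain ⟨m, hm⟩ := exists_coeffData hμm hμ
  have hmean := hm.meanCoeff_mem
  have hPm := hPoin μp m hm.good
  refine ⟨hμm.trans_le hmean.1, fun k => ?_, fun v hv => ⟨fun k => ?_, fun ξ hξ κ hκ R hR f => ?_⟩⟩
  · calc A * ‖k‖ ^ α ≤ μm / 2 * a * ‖k‖ ^ α := by gcongr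
      _ = μm / 2 * (a * ‖k‖ ^ α) := by ring
      _ ≤ meanCoeff μ / 2 * symb d α k := by
        have := has k
        have : 0 ≤ meanCoeff μ / 2 := by linarith [hmean.1]
        gcongr
        exact hmean.1
  · obtain ⟨w, hw0, hw, hq⟩ := exists_cell_combination hd hα hα2 hm.good hm.ae_eq hv k
    obtain ⟨hw1, -⟩ := norm_cell_solution_le hd hα hα2 hm.good hP hPm hw0 hw
    have h1 := hm.abs_qform_starMatrix_le hd hα hα2 k
    rw [← hK, ← hC₁] at hw1
    have h2 : ‖fmap α m 0 w‖ ^ 2 ≤ (C₁ * ‖k‖) ^ 2 := by gcongr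
    rw [hq]
    refine (abs_add_le _ _).trans ?_
    rw [abs_neg, abs_of_nonneg (by positivity)]
    nlinarith
  obtain ⟨w, hw0, hw, hq⟩ := exists_cell_combination hd hα hα2 hm.good hm.ae_eq hv ξ
  obtain ⟨hw1, hw2⟩ := norm_cell_solution_le hd hα hα2 hm.good hP hPm hw0 hw
  rw [← hK, ← hC₁] at hw1 hw2
  have hξS : ‖ξ‖ ≤ S := norm_le_of_mem_dualCell hξ
  obtain ⟨hu, heq⟩ := hR.form_eq hd hα hα2 hm.good hm.ae_eq f
  set u : formDom α m := ⟨R f, hu⟩ with hudef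
  have huR : (u : L2 d) = R f := rfl
  rw [← huR] at heq ⊢
  set e : formDom α m := ⟨expL 0, expL_mem_formDom hd hα hα2 hm.good 0⟩ with hedef
  have he : (e : L2 d) = expL 0 := rfl
  set c : ℂ := fc (u : L2 d) 0 with hc
  set s : ℝ := ‖ξ‖ with hs
  have hs0 : 0 ≤ s := norm_nonneg _
  set q : ℝ := qform (effMatrix α μ v) ξ with hqdef
  set η : formDom α m := u - c • (e + Complex.I • w) with hη
  have hue : u = η + c • (e + Complex.I • w) := by rw [hη, sub_add_cancel]
  have hη0 : fc (η : L2 d) 0 = 0 := by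
    rw [hη, Submodule.coe_sub, Submodule.coe_smul, Submodule.coe_add, Submodule.coe_smul, fc_sub,
      fc_smul, fc_add, fc_smul, hw0, he, fc_expL]
    simp [hc]
  have hηP := hPm ξ hξ η hη0
  -- the bound for the resolvent
  have hbound : ‖(u : L2 d)‖ * (A * s ^ α + κ) ≤ ‖f‖ := by
    refine norm_resolvent_le (heq u) ?_
    calc A * s ^ α * ‖(u : L2 d)‖ ^ 2 ≤ μm / 2 * a * s ^ α * ‖(u : L2 d)‖ ^ 2 := by gcongr
      _ = μm / 2 * (a * s ^ α * ‖(u : L2 d)‖ ^ 2) := by ring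
      _ ≤ _ := le_norm_fmap_sq hm.good ha.le has hα hξ u
  have hcu : ‖c‖ ≤ ‖(u : L2 d)‖ := norm_fc_le _ _
  have hcF : ‖c‖ * (A * s ^ α + κ) ≤ ‖f‖ := le_trans (by gcongr) hbound
  have hcα : ‖c‖ * s ^ α ≤ ‖f‖ / A := by
    rw [le_div_iff₀ hA0]
    nlinarith [mul_nonneg (norm_nonneg c) hκ.le]
  -- the equation tested with the part of mean value zero
  have hDu : fmap α m ξ u = fmap α m ξ η + c • (fmap α m ξ e + Complex.I • fmap α m ξ w) := by
    conv_lhs => rw [hue]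
    simp only [map_add, map_smul]
  have hBη := norm_inner_fmap_corrected_le hd hα hα2 hm.good hP hS hC₁0 hξS he hw hw1 hw2 hηP
  rw [← hK, ← hB, ← hs] at hBη
  have hx : ‖fmap α m ξ η‖ ≤ C₂ * ‖f‖ := by
    have t1 := heq η
    have hηe : inner ℂ (η : L2 d) (e : L2 d) = 0 := by
      rw [← inner_conj_symm, he]
      change conj (fc (η : L2 d) 0) = 0
      rw [hη0, map_zero]
    have t2 : (u : L2 d) = (η : L2 d) + c • ((e : L2 d) + Complex.I • (w : L2 d)) := by
      conv_lhs => rw [hue]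
      simp only [Submodule.coe_add, Submodule.coe_smul]
    rw [hDu, t2] at t1
    exact norm_mean_zero_part_le hP hB0 (by positivity : 0 ≤ P * C₁) hA0 hκ.le
      (by positivity : 0 ≤ s ^ α) hs0 hξS hηP hcF hηe hBη hw2 t1
  have hy : ‖(η : L2 d)‖ ≤ P * (C₂ * ‖f‖) := hηP.trans (by gcongr)
  have hD : 0 < A * s ^ α + κ := by positivity
  refine ⟨hbound, ?_, ?_⟩
  · -- the equation tested with the constant
    have t1 := heq e
    have hec : inner ℂ (e : L2 d) (u : L2 d) = c := rfl
    have hef : inner ℂ (e : L2 d) f = fc f 0 := rfl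
    rw [hDu, inner_add_right, inner_smul_right, hec, hef] at t1
    have hC := norm_inner_one_corrected_sub_le hd hα hα2 hm he hw hw2 hq
    rw [← hK, ← hQ, ← hs] at hC
    have e1 : c * ((meanCoeff μ / 2 * symb d α ξ + q + κ : ℝ) : ℂ) - fc f 0
        = -(inner ℂ (fmap α m ξ e) (fmap α m ξ η))
          - c * (inner ℂ (fmap α m ξ e) (fmap α m ξ e + Complex.I • fmap α m ξ w)
            - ((meanCoeff μ / 2 * symb d α ξ + q : ℝ) : ℂ)) := by
      rw [← t1]; push_cast; ring
    have h7 := norm_inner_fmap_one_le hd hα hα2 hm.good hS hξS he hηP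
    rw [← hK, ← hs] at h7
    have h8 : ‖c‖ * ‖inner ℂ (fmap α m ξ e) (fmap α m ξ e + Complex.I • fmap α m ξ w)
            - ((meanCoeff μ / 2 * symb d α ξ + q : ℝ) : ℂ)‖ ≤ Q * s * (‖f‖ / A) := by
      calc _ ≤ ‖c‖ * (Q * s ^ (1 + α)) := by gcongr
        _ = Q * s * (‖c‖ * s ^ α) := by
          rw [Real.rpow_add' hs0 (by linarith), Real.rpow_one]; ring
        _ ≤ _ := by gcongr
    rw [e1]
    refine (norm_sub_le _ _).trans ?_
    rw [norm_neg, norm_mul]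
    calc _ ≤ s * (√K + 4 * K * S * P + 4 * K * P) * (C₂ * ‖f‖) + Q * s * (‖f‖ / A) :=
          add_le_add (h7.trans (by gcongr)) h8
      _ = C₃ * s * ‖f‖ := by rw [hC₃]; ring
      _ ≤ _ := by
        gcongr
        have : 0 ≤ P * C₂ := by positivity
        have : 0 ≤ P * C₁ := by positivity
        linarith
  · have e1 : (u : L2 d) - c • expL 0 = (η : L2 d) + (c * Complex.I) • (w : L2 d) := by
      rw [hη, Submodule.coe_sub, Submodule.coe_smul, Submodule.coe_add, Submodule.coe_smul, he,
        smul_add, smul_smul]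
      abel
    rw [e1]
    refine (norm_add_le _ _).trans ?_
    rw [norm_smul, norm_mul, Complex.norm_I, mul_one]
    have h1 : ‖c‖ ≤ ‖f‖ / (A * s ^ α + κ) := by rwa [le_div_iff₀ hD]
    calc _ ≤ P * (C₂ * ‖f‖) + ‖f‖ / (A * s ^ α + κ) * (P * C₁ * s) := by gcongr
      _ = (P * C₂) * 1 * ‖f‖ + (P * C₁) * (s / (A * s ^ α + κ)) * ‖f‖ := by ring
      _ ≤ (C₃ + P * C₂ + P * C₁) * 1 * ‖f‖
          + (C₃ + P * C₂ + P * C₁) * (s / (A * s ^ α + κ)) * ‖f‖ := by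
        have : 0 ≤ P * C₂ := by positivity
        have : 0 ≤ P * C₁ := by positivity
        gcongr
        · linarith
        · linarith
      _ = _ := by ring

/-! ### The Neumann series of the effective symbol -/

/-- The exponent `σ` for which the rate is `ε^{σ-α}`. -/
def rateExp (N : ℕ) (α : ℝ) : ℝ :=
  if α ≤ 2 - 1 / ((N : ℝ) + 1) then 1 else ((N : ℝ) + 1) * (2 - α)

lemma rate_eq (N : ℕ) (α ε : ℝ) : rate N α ε = ε ^ (rateExp N α - α) := by
  unfold rate rateExp
  split_ifs <;> rfl

lemma rateExp_bounds {N : ℕ} (hN : 1 ≤ N) (hα : 2 - 1 / (N : ℝ) < α) (hα2 : α < 2) :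
    0 ≤ rateExp N α ∧ rateExp N α ≤ 1 ∧ rateExp N α ≤ ((N : ℝ) + 1) * (2 - α) ∧
      N * (2 - α) ≤ rateExp N α := by
  have hN0 : (0 : ℝ) < N := by exact_mod_cast hN
  have h1 : N * (2 - α) < 1 := by
    have : 2 - α < 1 / (N : ℝ) := by linarith
    rw [lt_div_iff₀ hN0] at this
    linarith
  have hN1 : (0 : ℝ) < (N : ℝ) + 1 := by linarith
  unfold rateExp
  split_ifs with h
  · have h2 : 1 / ((N : ℝ) + 1) ≤ 2 - α := by linarith
    rw [div_le_iff₀ hN1] at h2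
    exact ⟨zero_le_one, le_rfl, by linarith, h1.le⟩
  · have h2 : 2 - α < 1 / ((N : ℝ) + 1) := by linarith [not_le.1 h]
    rw [lt_div_iff₀ hN1] at h2
    refine ⟨mul_nonneg hN1.le (by linarith), by linarith, le_rfl, ?_⟩
    have : 0 < 2 - α := by linarith
    nlinarith

/-- The interpolation inequality that produces the powers of `ε`. -/
lemma rpow_le_mul_add {r ε σ : ℝ} (hr : 0 ≤ r) (hε : 0 < ε) (hσ : 0 ≤ σ) (hσα : σ ≤ α) :
    r ^ σ ≤ ε ^ (σ - α) * (r ^ α + ε ^ α) := by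
  rcases le_total r ε with h | h
  · have h1 : ε ^ (σ - α) * ε ^ α = ε ^ σ := by rw [← Real.rpow_add hε]; congr 1; ring
    have h2 : r ^ σ ≤ ε ^ σ := Real.rpow_le_rpow hr h hσ
    have h3 : 0 ≤ ε ^ (σ - α) * r ^ α := by positivity
    rw [mul_add]; linarith
  · have hr0 : 0 < r := hε.trans_le h
    have h1 : r ^ (σ - α) * r ^ α = r ^ σ := by rw [← Real.rpow_add hr0]; congr 1; ring
    have h2 : r ^ (σ - α) ≤ ε ^ (σ - α) :=
      Real.rpow_le_rpow_of_nonpos hε h (by linarith)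
    have h3 : 0 ≤ ε ^ (σ - α) * ε ^ α := by positivity
    have h4 : r ^ (σ - α) * r ^ α ≤ ε ^ (σ - α) * r ^ α := by gcongr
    rw [mul_add]; linarith

lemma abs_symbol_div_le {A G q r L : ℝ} (hA : 0 < A) (hG : 0 ≤ G) (hr : 0 ≤ r)
    (hq : |q| ≤ G * r ^ 2) (hL0 : 0 < L) (hL : A * r ^ α ≤ L) :
    |q / L| ≤ (G / A + 1) * r ^ (2 - α) := by
  rw [abs_div, abs_of_pos hL0, div_le_iff₀ hL0]
  have h1 : r ^ 2 = r ^ (2 - α) * r ^ α := by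
    rw [← Real.rpow_natCast, ← Real.rpow_add' hr (by norm_num)]
    congr 1; push_cast; ring
  have h2 : 0 ≤ r ^ (2 - α) := by positivity
  calc |q| ≤ G * r ^ 2 := hq
    _ = G / A * r ^ (2 - α) * (A * r ^ α) := by rw [h1]; field_simp
    _ ≤ G / A * r ^ (2 - α) * L := by gcongr
    _ ≤ _ := by
      have : 0 ≤ 1 * r ^ (2 - α) * L := by positivity
      rw [add_mul, add_mul]; linarith

/-- The partial sums of the Neumann series for `(L + q)⁻¹`. -/
def neumann (N : ℕ) (q L : ℝ) : ℝ := ∑ m ∈ Finset.range (N + 1), (-q) ^ m / L ^ (m + 1)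

lemma neumann_eq (N : ℕ) (q L : ℝ) :
    neumann N q L = (∑ m ∈ Finset.range (N + 1), (-(q / L)) ^ m) / L := by
  rw [neumann, Finset.sum_div]
  refine Finset.sum_congr rfl fun m _ => ?_
  rw [← neg_div, div_pow, pow_succ, div_div]

lemma abs_neumann_le {N : ℕ} {H T q L : ℝ} (hL : 0 < L)
    (h : ∀ m ≤ N, |q / L| ^ m ≤ H * T) : |neumann N q L| ≤ (N + 1) * H * (T / L) := by
  rw [neumann_eq, abs_div, abs_of_pos hL, ← mul_div_assoc]
  gcongr
  refine (Finset.abs_sum_le_sum_abs _ _).trans ?_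
  refine (Finset.sum_le_sum (g := fun _ => H * T) fun m hm => ?_).trans (le_of_eq ?_)
  · rw [abs_pow, abs_neg]
    exact h m (by simpa [Nat.lt_succ_iff] using hm)
  · rw [Finset.sum_const, Finset.card_range, nsmul_eq_mul]
    push_cast
    ring

/-- The solution of `(L + q) c = a + δ` in terms of the Neumann series. -/
lemma norm_sub_neumann_mul_le {N : ℕ} {q L : ℝ} (hL : 0 < L) (c a : ℂ) :
    ‖c - (neumann N q L : ℂ) * a‖
      ≤ |neumann N q L| * ‖c * ((L + q : ℝ) : ℂ) - a‖ + |q / L| ^ (N + 1) * ‖c‖ := by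
  set x : ℝ := -(q / L) with hx
  have hgeom : (∑ m ∈ Finset.range (N + 1), x ^ m) * (1 - x) = 1 - x ^ (N + 1) :=
    geom_sum_mul_neg x (N + 1)
  have h1 : neumann N q L * (L + q) = 1 - x ^ (N + 1) := by
    rw [neumann_eq, ← hgeom, hx]
    field_simp
    ring
  have e : c - (neumann N q L : ℂ) * a = (neumann N q L : ℂ) * (c * ((L + q : ℝ) : ℂ) - a)
      + ((x ^ (N + 1) : ℝ) : ℂ) * c := by
    have h2 : (neumann N q L : ℂ) * ((L + q : ℝ) : ℂ) = 1 - ((x ^ (N + 1) : ℝ) : ℂ) := by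
      rw [← Complex.ofReal_mul, h1]; push_cast; ring
    linear_combination (-c) * h2
  rw [e]
  refine (norm_add_le _ _).trans (le_of_eq ?_)
  rw [norm_mul, norm_mul, Complex.norm_real, Complex.norm_real, Real.norm_eq_abs, Real.norm_eq_abs,
    abs_pow, hx, abs_neg]

/-! ### The estimate for the Fourier multipliers -/

lemma pow_symbol_le_one_add {N m : ℕ} {H x r σ : ℝ} (hH : 1 ≤ H) (hα2 : α < 2) (hr : 0 ≤ r)
    (hσ : N * (2 - α) ≤ σ) (hx0 : 0 ≤ x) (hx : x ≤ H * r ^ (2 - α)) (hm : m ≤ N) :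
    x ^ m ≤ H ^ N * (1 + r ^ σ) := by
  have hmN : (m : ℝ) ≤ N := by exact_mod_cast hm
  have h1 : (r ^ (2 - α)) ^ m ≤ 1 + r ^ σ := by
    rw [← Real.rpow_mul_natCast hr]
    rcases le_total r 1 with h | h
    · have a1 : r ^ ((2 - α) * m) ≤ 1 := Real.rpow_le_one hr h
        (mul_nonneg (by linarith) (Nat.cast_nonneg _))
      have a2 : 0 ≤ r ^ σ := by positivity
      linarith
    · have a1 : r ^ ((2 - α) * m) ≤ r ^ σ := Real.rpow_le_rpow_of_exponent_le h (by nlinarith)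
      linarith
  calc x ^ m ≤ (H * r ^ (2 - α)) ^ m := pow_le_pow_left₀ hx0 hx m
    _ = H ^ m * (r ^ (2 - α)) ^ m := mul_pow _ _ _
    _ ≤ H ^ N * (1 + r ^ σ) := by
      gcongr

lemma pow_succ_symbol_le {N : ℕ} {H x r S σ : ℝ} (hH : 0 ≤ H) (hα : 1 < α) (hα2 : α < 2)
    (hr : 0 ≤ r) (hS : 1 ≤ S) (hrS : r ≤ S) (hσ0 : 0 ≤ σ) (hσ : σ ≤ ((N : ℝ) + 1) * (2 - α))
    (hx0 : 0 ≤ x) (hx : x ≤ H * r ^ (2 - α)) :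
    x ^ (N + 1) ≤ H ^ (N + 1) * S ^ (N + 1) * r ^ σ := by
  have h1 : (r ^ (2 - α)) ^ (N + 1) ≤ S ^ (N + 1) * r ^ σ := by
    rw [← Real.rpow_mul_natCast hr]
    rcases eq_or_lt_of_le hr with rfl | hr0
    · rw [Real.zero_rpow (by
        have : (0 : ℝ) < 2 - α := by linarith
        push_cast; positivity)]
      positivity
    · have e : r ^ ((2 - α) * ((N + 1 : ℕ) : ℝ)) = r ^ ((2 - α) * ((N + 1 : ℕ) : ℝ) - σ) * r ^ σ := by
        rw [← Real.rpow_add hr0]; congr 1; ring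
      rw [e]
      gcongr
      push_cast
      have hN : (0 : ℝ) ≤ N := Nat.cast_nonneg N
      calc r ^ ((2 - α) * ((N : ℝ) + 1) - σ) ≤ S ^ ((2 - α) * ((N : ℝ) + 1) - σ) :=
            Real.rpow_le_rpow hr hrS (by linarith)
        _ ≤ S ^ (((N + 1 : ℕ) : ℝ)) := Real.rpow_le_rpow_of_exponent_le hS (by push_cast; nlinarith)
        _ = S ^ (N + 1) := Real.rpow_natCast _ _
  calc x ^ (N + 1) ≤ (H * r ^ (2 - α)) ^ (N + 1) := pow_le_pow_left₀ hx0 hx _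
    _ = H ^ (N + 1) * (r ^ (2 - α)) ^ (N + 1) := mul_pow _ _ _
    _ ≤ H ^ (N + 1) * (S ^ (N + 1) * r ^ σ) := by gcongr
    _ = _ := by ring

/-- The sum of the resolvent with constant coefficient and of the correctors is the Fourier
multiplier given by the Neumann series. -/
lemma fc_add_sum_correctors {L : E d → ℝ} {ξ : E d} {R₀ : L2 d →L[ℂ] L2 d} (h : IsMultInv L ξ R₀)
    (hL : ∀ k, 0 < L k) {g : Fin d → Fin d → ℝ} {N : ℕ} {K : ℕ → (L2 d →L[ℂ] L2 d)}
    (hK : ∀ m ∈ Finset.Icc 1 N, IsCorrector (diffOp g ξ) R₀ m (K m)) (f : L2 d) (n : Fin d → ℤ) :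
    fc ((R₀ + ∑ m ∈ Finset.Icc 1 N, K m) f) n
      = (neumann N (qform g (ξ + freq n)) (L (ξ + freq n)) : ℂ) * fc f n := by
  have hr : Finset.range (N + 1) = insert 0 (Finset.Icc 1 N) := by
    ext i; simp only [Finset.mem_range, Finset.mem_insert, Finset.mem_Icc]; omega
  have hs : fc ((∑ m ∈ Finset.Icc 1 N, K m) f) n = ∑ m ∈ Finset.Icc 1 N, fc (K m f) n := by
    rw [sum_apply]
    simp only [fc, inner_sum]
  rw [add_apply, fc_add, hs, h.fc_eq hL, neumann, hr,
    Finset.sum_insert (by simp)]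
  push_cast
  rw [add_mul, Finset.sum_mul]
  congr 1
  · simp
  · refine Finset.sum_congr rfl fun m hm => ?_
    rw [IsCorrector.fc_eq h hL (hK m hm)]
    push_cast
    ring

/-- The difference of `u` and a Fourier multiplier applied to `f` is estimated separately on the
zeroth mode and on the other modes, where both terms are small. -/
lemma norm_sub_le_of_mean {u y f : L2 d} {τ : (Fin d → ℤ) → ℂ} (hy : ∀ n, fc y n = τ n * fc f n)
    {b₁ b₂ b₃ : ℝ} (hb₃ : 0 ≤ b₃) (h1 : ‖u - fc u 0 • expL 0‖ ≤ b₁)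
    (h2 : ‖fc u 0 - τ 0 * fc f 0‖ ≤ b₂) (h3 : ∀ n ≠ 0, ‖τ n‖ ≤ b₃) :
    ‖u - y‖ ≤ b₁ + b₂ + b₃ * ‖f‖ := by
  have e : u - y = (u - fc u 0 • expL 0) + (fc u 0 - τ 0 * fc f 0) • expL 0
      - (y - (τ 0 * fc f 0) • expL 0) := by
    rw [sub_smul]; abel
  have h4 : ‖y - (τ 0 * fc f 0) • expL (0 : Fin d → ℤ)‖ ≤ b₃ * ‖f‖ := by
    refine norm_le_of_fc_le hb₃ fun n => ?_
    rw [fc_sub, fc_smul, fc_expL, hy]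
    rcases eq_or_ne n 0 with rfl | hn
    · simp only [if_true, mul_one, sub_self, norm_zero]
      positivity
    · simp only [hn, if_false, mul_zero, sub_zero]
      rw [norm_mul]
      gcongr
      exact h3 n hn
  have he1 : ‖expL (0 : Fin d → ℤ)‖ = 1 := (orthonormal_expL (d := d)).1 0
  rw [e]
  refine (norm_sub_le _ _).trans (add_le_add ((norm_add_le _ _).trans (add_le_add h1 ?_)) h4)
  rw [norm_smul, he1, mul_one]
  exact h2

set_option maxHeartbeats 1000000 in
/-- The estimate for the difference of a function `u` and the Neumann series applied to `f`, if
the mean value of `u` solves the effective equation and the rest of `u` is bounded, up to errors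
of the relative order `O(|ξ|)`. -/
lemma exists_norm_sub_le (d : ℕ) {N : ℕ} (hα1 : 1 < α) (hα2 : α < 2) {σ : ℝ} (hσ0 : 0 ≤ σ)
    (hσ1 : σ ≤ 1) (hσN1 : σ ≤ ((N : ℝ) + 1) * (2 - α)) (hσN : N * (2 - α) ≤ σ) {A G B : ℝ}
    (hA : 0 < A) (hA1 : A ≤ 1) (hG : 0 ≤ G) (hB : 0 ≤ B) :
    ∃ C : ℝ, 0 ≤ C ∧ ∀ ξ ∈ dualCell d, ∀ ε : ℝ, 0 < ε → ∀ (g : Fin d → Fin d → ℝ) (L : E d → ℝ),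
      (∀ k, |qform g k| ≤ G * ‖k‖ ^ 2) → (∀ k, A * ‖k‖ ^ α + ε ^ α ≤ L k) → ∀ u y f : L2 d,
      (∀ n, fc y n = (neumann N (qform g (ξ + freq n)) (L (ξ + freq n)) : ℂ) * fc f n) →
      ‖u‖ * (A * ‖ξ‖ ^ α + ε ^ α) ≤ ‖f‖ →
      ‖fc u 0 * ((L ξ + qform g ξ : ℝ) : ℂ) - fc f 0‖ ≤ B * ‖ξ‖ * ‖f‖ →
      ‖u - fc u 0 • expL 0‖ ≤ B * (1 + ‖ξ‖ / (A * ‖ξ‖ ^ α + ε ^ α)) * ‖f‖ →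
      ‖u - y‖ ≤ C * ε ^ (σ - α) * ‖f‖ := by
  set H : ℝ := G / A + 1 with hH
  have hH1 : 1 ≤ H := by rw [hH]; linarith [div_nonneg hG hA.le]
  have hH0 : 0 ≤ H := by linarith
  set S : ℝ := 1 + Real.pi * d with hSdef
  have hS : 1 ≤ S := by
    have := Real.pi_pos
    rw [hSdef]; nlinarith [Nat.cast_nonneg (α := ℝ) d]
  -- the constant for large `ε`
  set M : ℝ := (N + 1) * H ^ N with hM
  have hM0 : 0 ≤ M := by positivity
  set Cl : ℝ := 1 + M * (1 + 1 / A) with hCl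
  -- the constant for small `ε`
  set Cs : ℝ := B * (1 + S / A) + (M * (1 + S) * (B * S / A) + H ^ (N + 1) * S ^ (N + 1) / A)
    + M * (2 / A) with hCs
  have hCl0 : 0 ≤ Cl := by positivity
  have hCs0 : 0 ≤ Cs := by positivity
  refine ⟨Cl + Cs, by positivity, fun ξ hξ ε hε g L hq hLge u y f hy hu hmeanf hrest => ?_⟩
  set κ : ℝ := ε ^ α with hκdef
  have hκ : 0 < κ := Real.rpow_pos_of_pos hε α
  have hLα : ∀ k, A * ‖k‖ ^ α ≤ L k := fun k => by linarith [hLge k]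
  have hLκ : ∀ k, κ ≤ L k := fun k => by
    have : 0 ≤ A * ‖k‖ ^ α := by positivity
    linarith [hLge k]
  have hL0 : ∀ k, 0 < L k := fun k => hκ.trans_le (hLκ k)
  set ρ : ℝ := ε ^ (σ - α) with hρ
  have hρ0 : 0 < ρ := Real.rpow_pos_of_pos hε _
  -- the symbols
  have hx : ∀ k : E d, |qform g k / L k| ≤ H * ‖k‖ ^ (2 - α) := fun k =>
    abs_symbol_div_le hA hG (norm_nonneg k) (hq k) (hL0 k) (hLα k)
  have hneu : ∀ k : E d, |neumann N (qform g k) (L k)| ≤ M * ((1 + ‖k‖ ^ σ) / L k) := fun k =>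
    abs_neumann_le (hL0 k) fun m hm =>
      pow_symbol_le_one_add hH1 hα2 (norm_nonneg k) hσN (abs_nonneg _) (hx k) hm
  have hpow : ∀ k : E d, ‖k‖ ^ σ / (A * ‖k‖ ^ α + κ) ≤ ρ / A := fun k => by
    have hD : 0 < A * ‖k‖ ^ α + κ := by positivity
    rw [div_le_div_iff₀ hD hA]
    have h1 := rpow_le_mul_add (α := α) (norm_nonneg k) hε hσ0 (hσ1.trans hα1.le)
    have h2 : A * κ ≤ κ := by nlinarith
    calc ‖k‖ ^ σ * A ≤ ρ * (‖k‖ ^ α + κ) * A := by gcongr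
      _ = ρ * (A * ‖k‖ ^ α + A * κ) := by ring
      _ ≤ ρ * (A * ‖k‖ ^ α + κ) := by gcongr
  have hpowL : ∀ k : E d, ‖k‖ ^ σ / L k ≤ ρ / A := fun k => by
    refine le_trans ?_ (hpow k)
    have hD : 0 < A * ‖k‖ ^ α + κ := by positivity
    gcongr
    exact hLge k
  set s : ℝ := ‖ξ‖ with hs
  have hs0 : 0 ≤ s := norm_nonneg _
  have hsS : s ≤ S := norm_le_of_mem_dualCell hξ
  have hD : 0 < A * s ^ α + κ := by positivity
  have hκinv : κ⁻¹ = ε ^ (-α) := (Real.rpow_neg hε.le α).symm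
  rcases le_total 1 ε with h1ε | hε1
  · -- for large `ε` every term is of the order `ε^{-α}`
    have hκρ : κ⁻¹ ≤ ρ := by
      rw [hκinv]
      exact Real.rpow_le_rpow_of_exponent_le h1ε (by linarith)
    have h1 : ‖u‖ ≤ ρ * ‖f‖ := by
      have a0 : 0 ≤ A * s ^ α := by positivity
      have a1 : ‖u‖ * κ ≤ ‖f‖ := by nlinarith [mul_nonneg (norm_nonneg u) a0]
      calc ‖u‖ = κ⁻¹ * (‖u‖ * κ) := by field_simp
        _ ≤ ρ * ‖f‖ := by gcongr
    have h2 : ‖y‖ ≤ M * ((1 + 1 / A) * ρ) * ‖f‖ := by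
      refine norm_le_of_fc_le (by positivity) fun n => ?_
      rw [hy, norm_mul, Complex.norm_real, Real.norm_eq_abs]
      gcongr
      refine (hneu _).trans ?_
      gcongr
      rw [add_div, add_mul, one_mul, one_div_mul_eq_div]
      refine add_le_add (le_trans ?_ hκρ) (hpowL _)
      rw [one_div]
      exact inv_anti₀ hκ (hLκ _)
    calc ‖u - y‖ ≤ ‖u‖ + ‖y‖ := norm_sub_le _ _
      _ ≤ ρ * ‖f‖ + M * ((1 + 1 / A) * ρ) * ‖f‖ := add_le_add h1 h2
      _ = Cl * ρ * ‖f‖ := by rw [hCl]; ring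
      _ ≤ _ := by gcongr; linarith
  · have hρ1 : 1 ≤ ρ := Real.one_le_rpow_of_pos_of_le_one_of_nonpos hε hε1 (by linarith)
    have hsσ : s ≤ S * s ^ σ := by
      rcases eq_or_lt_of_le hs0 with h | h
      · rw [← h]; positivity
      · have e : s = s ^ (1 - σ) * s ^ σ := by
          rw [← Real.rpow_add h]; simp
        calc s = s ^ (1 - σ) * s ^ σ := e
          _ ≤ S * s ^ σ := by
            gcongr
            exact rpow_le_of_le hs0 hS hsS (by linarith) (by linarith)
    have hsD : s / (A * s ^ α + κ) ≤ S / A * ρ := by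
      calc s / (A * s ^ α + κ) ≤ S * s ^ σ / (A * s ^ α + κ) := by gcongr
        _ = S * (s ^ σ / (A * s ^ α + κ)) := mul_div_assoc _ _ _
        _ ≤ S * (ρ / A) := mul_le_mul_of_nonneg_left (hpow ξ) (by linarith)
        _ = _ := by ring
    have hsL : s / L ξ ≤ S / A * ρ := le_trans (by gcongr; exact hLge ξ) hsD
    have hc : ‖fc (u) 0‖ ≤ ‖f‖ / (A * s ^ α + κ) := by
      rw [le_div_iff₀ hD]
      refine le_trans ?_ hu
      gcongr
      exact norm_fc_le _ _
    have hξ0 : ξ + freq (0 : Fin d → ℤ) = ξ := by rw [freq_zero, add_zero]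
    have b1 : ‖u - fc (u) 0 • expL 0‖ ≤ B * (1 + S / A) * ρ * ‖f‖ := by
      refine hrest.trans ?_
      calc _ ≤ B * (ρ + S / A * ρ) * ‖f‖ := by gcongr
        _ = _ := by ring
    have b2 : ‖fc (u) 0 - (neumann N (qform g (ξ + freq 0)) (L (ξ + freq 0)) : ℂ) * fc f 0‖
        ≤ (M * (1 + S) * (B * S / A) + H ^ (N + 1) * S ^ (N + 1) / A) * ρ * ‖f‖ := by
      rw [hξ0]
      refine (norm_sub_neumann_mul_le (hL0 ξ) _ _).trans ?_
      have a1 : |neumann N (qform g ξ) (L ξ)| ≤ M * ((1 + S) / L ξ) := by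
        refine (hneu ξ).trans ?_
        have := (hL0 ξ).le
        gcongr
        exact rpow_le_of_le hs0 hS hsS hσ0 hσ1
      have a2 := pow_succ_symbol_le (N := N) hH0 hα1 hα2 hs0 hS hsS hσ0 hσN1 (abs_nonneg _) (hx ξ)
      calc _ ≤ M * ((1 + S) / L ξ) * (B * s * ‖f‖)
            + H ^ (N + 1) * S ^ (N + 1) * s ^ σ * (‖f‖ / (A * s ^ α + κ)) := by
            have := (hL0 ξ).le
            gcongr
        _ = M * (1 + S) * B * (s / L ξ) * ‖f‖
            + H ^ (N + 1) * S ^ (N + 1) * (s ^ σ / (A * s ^ α + κ)) * ‖f‖ := by ring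
        _ ≤ M * (1 + S) * B * (S / A * ρ) * ‖f‖ + H ^ (N + 1) * S ^ (N + 1) * (ρ / A) * ‖f‖ := by
            have a3 := mul_le_mul_of_nonneg_left (hpow ξ)
              (by positivity : 0 ≤ H ^ (N + 1) * S ^ (N + 1))
            gcongr
        _ = _ := by ring
    have b3 : ∀ n : Fin d → ℤ, n ≠ 0 →
        ‖(neumann N (qform g (ξ + freq n)) (L (ξ + freq n)) : ℂ)‖ ≤ M * (2 / A) * ρ := by
      intro n hn
      rw [Complex.norm_real, Real.norm_eq_abs]
      refine (hneu _).trans ?_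
      have a1 : 1 ≤ ‖ξ + freq n‖ ^ σ := Real.one_le_rpow
        (by linarith [norm_freq_add_ge hξ hn, Real.pi_gt_three]) hσ0
      have a2 := (hL0 (ξ + freq n)).le
      calc _ ≤ M * ((‖ξ + freq n‖ ^ σ + ‖ξ + freq n‖ ^ σ) / L (ξ + freq n)) := by gcongr
        _ = M * (2 * (‖ξ + freq n‖ ^ σ / L (ξ + freq n))) := by ring
        _ ≤ M * (2 * (ρ / A)) := by
          have a3 := hpowL (ξ + freq n)
          gcongr M * (2 * ?_)
        _ = _ := by ring
    have h := norm_sub_le_of_mean hy (by positivity) b1 b2 b3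
    calc ‖u - y‖ ≤ _ := h
      _ = Cs * ρ * ‖f‖ := by rw [hCs]; ring
      _ ≤ _ := by gcongr; linarith

end LevyHomog

end

open LevyHomog in
theorem theorem4p6 (d N : ℕ) (hd : 1 ≤ d) (hN : 1 ≤ N) (α : ℝ) (hα : 2 - 1 / (N : ℝ) < α)
    (hα2 : α < 2) (μm μp : ℝ) (hμm : 0 < μm) :
    ∃ C : ℝ, ∀ μ : LevyHomog.E d → LevyHomog.E d → ℝ, LevyHomog.IsCoefficient μm μp μ →
      -- the auxiliary problems are solvable
      (∃ v : Fin d → LevyHomog.L2 d, ∀ k, LevyHomog.IsCellSolution α μ k (v k)) ∧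
      ∀ v : Fin d → LevyHomog.L2 d, (∀ k, LevyHomog.IsCellSolution α μ k (v k)) →
        ∀ ξ ∈ LevyHomog.dualCell d, ∀ ε : ℝ, 0 < ε →
          -- the resolvents and the correctors exist
          (∃ R, LevyHomog.IsResolvent (LevyHomog.levyOp α μ ξ) (ε ^ α) R) ∧
          (∃ R₀, LevyHomog.IsResolvent
            (LevyHomog.levyOp α (fun _ _ => LevyHomog.meanCoeff μ) ξ) (ε ^ α) R₀) ∧
          ∀ R R₀ : LevyHomog.L2 d →L[ℂ] LevyHomog.L2 d,
            LevyHomog.IsResolvent (LevyHomog.levyOp α μ ξ) (ε ^ α) R →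
            LevyHomog.IsResolvent
              (LevyHomog.levyOp α (fun _ _ => LevyHomog.meanCoeff μ) ξ) (ε ^ α) R₀ →
            (∀ m ∈ Finset.Icc 1 N, ∃ K, LevyHomog.IsCorrector
              (LevyHomog.diffOp (LevyHomog.effMatrix α μ v) ξ) R₀ m K) ∧
            ∀ K : ℕ → (LevyHomog.L2 d →L[ℂ] LevyHomog.L2 d),
              (∀ m ∈ Finset.Icc 1 N, LevyHomog.IsCorrector
                (LevyHomog.diffOp (LevyHomog.effMatrix α μ v) ξ) R₀ m (K m)) →
              ‖R - R₀ - ∑ m ∈ Finset.Icc 1 N, K m‖ ≤ C * LevyHomog.rate N α ε := by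
  have hN1 : (1 : ℝ) ≤ N := by exact_mod_cast hN
  have hα1 : 1 < α := by
    have : 1 / (N : ℝ) ≤ 1 := by rw [div_le_one (by linarith)]; exact hN1
    linarith
  obtain ⟨hσ0, hσ1, hσN1, hσN⟩ := rateExp_bounds hN hα hα2
  set σ : ℝ := rateExp N α with hσ
  obtain ⟨A, G, B, hA, hA1, hG, hB, key⟩ := resolvent_mean hd hα1 hα2 hμm μp
  obtain ⟨C, hC0, hC⟩ := exists_norm_sub_le d (N := N) hα1 hα2 hσ0 hσ1 hσN1 hσN hA hA1 hG hB
  refine ⟨C, fun μ hμ => ?_⟩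
  obtain ⟨m₀, hm₀⟩ := exists_coeffData hμm hμ
  obtain ⟨hmean, hsymb, key⟩ := key μ hμ
  refine ⟨Classical.axiomOfChoice fun k =>
    exists_isCellSolution hd hα1 hα2 hm₀.good hm₀.ae_eq k, fun v hv ξ hξ ε hε => ?_⟩
  obtain ⟨hq, key⟩ := key v hv
  set κ : ℝ := ε ^ α with hκdef
  have hκ : 0 < κ := Real.rpow_pos_of_pos hε α
  refine ⟨exists_isResolvent hd hα1 hα2 hm₀.good hm₀.ae_eq ξ hκ,
    exists_isResolvent hd hα1 hα2 (goodCoeff_const hmean) (ae_of_all _ fun q => rfl) ξ hκ,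
    fun R R₀ hR hR₀ => ?_⟩
  set L : E d → ℝ := fun k => meanCoeff μ / 2 * symb d α k + κ with hL
  have hLge : ∀ k, A * ‖k‖ ^ α + κ ≤ L k := fun k => by
    have := hsymb k
    simp only [hL]; linarith
  have hL0 : ∀ k, 0 < L k := fun k => by
    have : 0 ≤ A * ‖k‖ ^ α := by positivity
    linarith [hLge k]
  have hinv : IsMultInv L ξ R₀ := fun f n => hR₀.fc_const hd hα1 hα2 hmean f n
  refine ⟨fun m hm => ?_, fun K hK => ?_⟩
  · refine exists_isCorrector hinv hA hκ hLge _ ?_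
    have h1 : (m : ℝ) ≤ N := by exact_mod_cast (Finset.mem_Icc.1 hm).2
    have h2 : N * (2 - α) ≤ 1 := hσN.trans hσ1
    nlinarith
  set g : Fin d → Fin d → ℝ := effMatrix α μ v with hg
  rw [rate_eq, ← hσ]
  refine ContinuousLinearMap.opNorm_le_bound _
    (mul_nonneg hC0 (Real.rpow_nonneg hε.le _)) fun f => ?_
  have hTy : (R - R₀ - ∑ m ∈ Finset.Icc 1 N, K m) f
      = R f - (R₀ + ∑ m ∈ Finset.Icc 1 N, K m) f := by
    rw [sub_sub, sub_apply]
  obtain ⟨hRf, hmeanf, hrest⟩ := key ξ hξ κ hκ R hR f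
  rw [hTy]
  refine hC ξ hξ ε hε g L hq hLge (R f) _ f (fc_add_sum_correctors hinv hL0 hK f) hRf ?_ hrest
  have e : L ξ + qform g ξ = meanCoeff μ / 2 * symb d α ξ + qform g ξ + κ := by
    simp only [hL]; ring
  rw [e]
  exact hmeanf
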